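/- Let $\mathrm{Sym}(2,\mathbb R)$ be the space of real symmetric $2\times2$ matrices and let $$Q=\Bigl\{\begin{bmatrix}h&0\\\sigma h&{}^th^{-1}\end{bmatrix}:h\in GL(2,\mathbb R),\ \sigma\in\mathrm{Sym}(2,\mathbb R)\Bigr\}\subset Sp(2,\mathbb R)\subset GL(4,\mathbb R)$$ be the standard maximal parabolic subgroup. Writing $(\sigma,h)$ for the displayed matrix, the product is $(\sigma,h)(\sigma',h')=(\sigma+{}^th^{-1}\sigma'h^{-1},hh')$, so $Q=\mathrm{Sym}(2,\mathbb R)\rtimes GL(2,\mathbb R)$. For a vector subspace $\Sigma\subset\mathrm{Sym}(2,\mathbb R)$ and a subgroup $H\subset GL(2,\mathbb R)$ with ${}^th^{-1}\Sigma h^{-1}=\Sigma$ for all $h\in H$, let $\Sigma\rtimes H\subset Q$ be the subgroup of all $(\sigma,h)$ with $\sigma\in\Sigma$, $h\in H$. A connected Lie subgroup of $GL(n,\mathbb R)$ is a subgroup $G$ such that $\mathfrak g=\{X:\exp(tX)\in G\text{ for all }t\in\mathbb R\}$ is a Lie subalgebra of $\mathfrak{gl}(n,\mathbb R)$ and every element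 of $G$ is a product of exponentials of elements of $\mathfrak g$; its dimension is $\dim\mathfrak g$. Let $\mathcal E_2$ be the class of all connected Lie subgroups of $Q$ of the form $\Sigma\rtimes H$, where $0\ne\Sigma\subsetneq\mathrm{Sym}(2,\mathbb R)$ is a vector subspace (a line or a plane) and $H\ne\{1\}$ is a connected Lie subgroup of $GL(2,\mathbb R)$. The group $GL(2,\mathbb R)$ is embedded in $Sp(2,\mathbb R)$ by $g\mapsto\mathrm{diag}(g,{}^tg^{-1})$ and acts by conjugation. Put $R_\theta=\begin{bmatrix}\cos\theta&-\sin\theta\\\sin\theta&\cos\theta\end{bmatrix}$. Theorem. Every group in $\mathcal E_2$ is conjugate by an element of $GL(2,\mathbb R)$ to one of the following groups. 5-dimensional groups: $$\begin{aligned} &\Bigl\{\begin{bmatrix}0&u\\u&v\end{bmatrix}:u,v\in\mathbb R\Bigr\}\rtimes \Bigl\{\begin{bmatrix}e^t&r\\0&e^s\end{bmatrix}:t,s,r\in\mathbb R\Bigr\} \end{aligned}$$ 4-dimensional groups: $$\begin{aligned} &\Bigl\{\begin{bmatrix}u&v\\v&-u\end{bmatrix}:u,v\in\mathbb R\Bigr\}\rtimes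 \Bigl\{e^tR_\theta:t,\theta\in\mathbb R\Bigr\}\\ &\Bigl\{\begin{bmatrix}u&0\\0&0\end{bmatrix}:u\in\mathbb R\Bigr\}\rtimes \Bigl\{\begin{bmatrix}e^t&0\\r&e^s\end{bmatrix}:t,s,r\in\mathbb R\Bigr\}\\ &\Bigl\{\begin{bmatrix}0&u\\u&v\end{bmatrix}:u,v\in\mathbb R\Bigr\}\rtimes \Bigl\{\begin{bmatrix}e^{t\lambda}&s\\0&e^{t(\lambda+1)}\end{bmatrix}:t,s\in\mathbb R\Bigr\},\quad \lambda\in\mathbb R\\ &\Bigl\{\begin{bmatrix}0&u\\u&v\end{bmatrix}:u,v\in\mathbb R\Bigr\}\rtimes \Bigl\{\begin{bmatrix}e^t&0\\0&e^s\end{bmatrix}:t,s\in\mathbb R\Bigr\}\\ &\Bigl\{\begin{bmatrix}0&u\\u&v\end{bmatrix}:u,v\in\mathbb R\Bigr\}\rtimes \Bigl\{\begin{bmatrix}e^t&s\\0&e^t\end{bmatrix}:t,s\in\mathbb R\Bigr\}\\ &\Bigl\{\begin{bmatrix}u&0\\0&v\end{bmatrix}:u,v\in\mathbb R\Bigr\}\rtimes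 \Bigl\{\begin{bmatrix}e^t&0\\0&e^s\end{bmatrix}:t,s\in\mathbb R\Bigr\} \end{aligned}$$ 3-dimensional groups: $$\begin{aligned} &\Bigl\{\begin{bmatrix}u&0\\0&u\end{bmatrix}:u\in\mathbb R\Bigr\}\rtimes \Bigl\{e^tR_\theta:t,\theta\in\mathbb R\Bigr\}\\ &\Bigl\{\begin{bmatrix}u&v\\v&-u\end{bmatrix}:u,v\in\mathbb R\Bigr\}\rtimes \Bigl\{e^tR_{t\alpha}:t\in\mathbb R\Bigr\},\quad \alpha\ge 0\\ &\Bigl\{\begin{bmatrix}u&v\\v&-u\end{bmatrix}:u,v\in\mathbb R\Bigr\}\rtimes \Bigl\{R_\theta:\theta\in\mathbb R\Bigr\}\\ &\Bigl\{\begin{bmatrix}u&0\\0&0\end{bmatrix}:u\in\mathbb R\Bigr\}\rtimes \Bigl\{\begin{bmatrix}e^{t\lambda}&0\\s&e^{t(\lambda+1)}\end{bmatrix}:t,s\in\mathbb R\Bigr\},\quad \lambda\in\mathbb R\\ &\Bigl\{\begin{bmatrix}u&0\\0&0\end{bmatrix}:u\in\mathbb R\Bigr\}\rtimes \Bigl\{\begin{bmatrix}e^t&0\\0&e^s\end{bmatrix}:t,s\in\mathbb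 R\Bigr\}\\ &\Bigl\{\begin{bmatrix}u&0\\0&0\end{bmatrix}:u\in\mathbb R\Bigr\}\rtimes \Bigl\{\begin{bmatrix}e^t&0\\s&e^t\end{bmatrix}:t,s\in\mathbb R\Bigr\}\\ &\Bigl\{\begin{bmatrix}0&u\\u&v\end{bmatrix}:u,v\in\mathbb R\Bigr\}\rtimes \Bigl\{e^{t\lambda}\begin{bmatrix}1&0\\0&e^t\end{bmatrix}:t\in\mathbb R\Bigr\},\quad \lambda\in\mathbb R\\ &\Bigl\{\begin{bmatrix}0&u\\u&v\end{bmatrix}:u,v\in\mathbb R\Bigr\}\rtimes \Bigl\{\begin{bmatrix}1&t\\0&1\end{bmatrix}:t\in\mathbb R\Bigr\}\\ &\Bigl\{\begin{bmatrix}0&u\\u&v\end{bmatrix}:u,v\in\mathbb R\Bigr\}\rtimes \Bigl\{e^t\begin{bmatrix}1&t\\0&1\end{bmatrix}:t\in\mathbb R\Bigr\}\\ &\Bigl\{\begin{bmatrix}0&u\\u&v\end{bmatrix}:u,v\in\mathbb R\Bigr\}\rtimes \Bigl\{\begin{bmatrix}e^t&0\\0&e^t\end{bmatrix}:t\in\mathbb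 R\Bigr\}\\ &\Bigl\{\begin{bmatrix}0&u\\u&0\end{bmatrix}:u\in\mathbb R\Bigr\}\rtimes \Bigl\{\begin{bmatrix}e^t&0\\0&e^s\end{bmatrix}:t,s\in\mathbb R\Bigr\}\\ &\Bigl\{\begin{bmatrix}u&0\\0&v\end{bmatrix}:u,v\in\mathbb R\Bigr\}\rtimes \Bigl\{\begin{bmatrix}e^t&0\\0&e^{t\beta}\end{bmatrix}:t\in\mathbb R\Bigr\},\quad \beta\in[-1,1] \end{aligned}$$ 2-dimensional groups: $$\begin{aligned} &\Bigl\{\begin{bmatrix}u&0\\0&u\end{bmatrix}:u\in\mathbb R\Bigr\}\rtimes \Bigl\{e^tR_{t\alpha}:t\in\mathbb R\Bigr\},\quad \alpha\ge 0\\ &\Bigl\{\begin{bmatrix}u&0\\0&u\end{bmatrix}:u\in\mathbb R\Bigr\}\rtimes \Bigl\{R_\theta:\theta\in\mathbb R\Bigr\}\\ &\Bigl\{\begin{bmatrix}u&0\\0&0\end{bmatrix}:u\in\mathbb R\Bigr\}\rtimes \Bigl\{e^{t\lambda}\begin{bmatrix}1&0\\0&e^t\end{bmatrix}:t\in\mathbb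 R\Bigr\},\quad \lambda\in\mathbb R\\ &\Bigl\{\begin{bmatrix}u&0\\0&0\end{bmatrix}:u\in\mathbb R\Bigr\}\rtimes \Bigl\{\begin{bmatrix}1&0\\t&1\end{bmatrix}:t\in\mathbb R\Bigr\}\\ &\Bigl\{\begin{bmatrix}u&0\\0&0\end{bmatrix}:u\in\mathbb R\Bigr\}\rtimes \Bigl\{e^t\begin{bmatrix}1&0\\t&1\end{bmatrix}:t\in\mathbb R\Bigr\}\\ &\Bigl\{\begin{bmatrix}u&0\\0&0\end{bmatrix}:u\in\mathbb R\Bigr\}\rtimes \Bigl\{\begin{bmatrix}e^t&0\\0&e^t\end{bmatrix}:t\in\mathbb R\Bigr\}\\ &\Bigl\{\begin{bmatrix}0&u\\u&0\end{bmatrix}:u\in\mathbb R\Bigr\}\rtimes \Bigl\{\begin{bmatrix}e^t&0\\0&e^{t\beta}\end{bmatrix}:t\in\mathbb R\Bigr\},\quad \beta\in[-1,1] \end{aligned}$$ All the groups in this list belong to $\mathcal E_2$ and have the indicated dimension, and no two of them (different entries of the list, or the same entry with different values of its parameter) are conjugate by an element of $GL(2,\mathbb R)$. -/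

import Mathlib

namespace SympClass

section Generalities

open Matrix

/-- For a subgroup `G` of `GL(n, ℝ)`, the set of all matrices `X` whose one-parameter group
`t ↦ exp (t X)` stays in `G`: the Lie algebra of `G`. -/
def lieAlg {n : Type*} [Fintype n] [DecidableEq n] (G : Subgroup (GL n ℝ)) :
    Set (Matrix n n ℝ) :=
  {X | ∀ t : ℝ, ∃ g ∈ G, (g : Matrix n n ℝ) = NormedSpace.exp (t • X)}

/-- Connected Lie subgroups of `GL(n, ℝ)` (the standard definition for matrix groups): the Lie
algebra of `G` is a Lie subalgebra of `𝔤𝔩(n, ℝ)` (a subspace closed under commutators), and every element of `G` is a product of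
exponentials of elements of this Lie algebra.
(No closedness in `GL(n, ℝ)` is required.) -/
def IsConnectedLieSubgroup {n : Type*} [Fintype n] [DecidableEq n]
    (G : Subgroup (GL n ℝ)) : Prop :=
  (∃ 𝔤 : Submodule ℝ (Matrix n n ℝ), (𝔤 : Set (Matrix n n ℝ)) = lieAlg G ∧
    ∀ X ∈ 𝔤, ∀ Y ∈ 𝔤, X * Y - Y * X ∈ 𝔤) ∧
  ∀ g ∈ G, ∃ L : List (Matrix n n ℝ), (∀ X ∈ L, X ∈ lieAlg G) ∧
    (g : Matrix n n ℝ) = (L.map NormedSpace.exp).prod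

/-- The dimension of a Lie subgroup of `GL(n, ℝ)`: the dimension of its Lie algebra. (For a Lie
subgroup the span is the Lie algebra itself.) -/
noncomputable def lieDim {n : Type*} [Fintype n] [DecidableEq n] (G : Subgroup (GL n ℝ)) : ℕ :=
  Module.finrank ℝ (Submodule.span ℝ (lieAlg G))

/-- `Sym(d, ℝ)`, the space of real symmetric `d × d` matrices. -/
def Sym (d : ℕ) : Submodule ℝ (Matrix (Fin d) (Fin d) ℝ) where
  carrier := {σ | σ.IsSymm}
  add_mem' ha hb := Matrix.IsSymm.add ha hb
  zero_mem' := Matrix.isSymm_zero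
  smul_mem' c _ ha := Matrix.IsSymm.smul ha c

/-- The block lower triangular matrix `[h, 0; σ h, ᵗh⁻¹]`. -/
noncomputable def parabolicElt {d : ℕ} (σ : Matrix (Fin d) (Fin d) ℝ) (h : GL (Fin d) ℝ) :
    GL (Fin d ⊕ Fin d) ℝ where
  val := fromBlocks (h : Matrix (Fin d) (Fin d) ℝ) 0 (σ * (h : Matrix (Fin d) (Fin d) ℝ))
    ((h⁻¹ : GL (Fin d) ℝ) : Matrix (Fin d) (Fin d) ℝ)ᵀ
  inv := fromBlocks ((h⁻¹ : GL (Fin d) ℝ) : Matrix (Fin d) (Fin d) ℝ) 0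
    (-((h : Matrix (Fin d) (Fin d) ℝ)ᵀ * σ)) (h : Matrix (Fin d) (Fin d) ℝ)ᵀ
  val_inv := by
    have e : ((h⁻¹ : GL (Fin d) ℝ) : Matrix (Fin d) (Fin d) ℝ)ᵀ * (h : Matrix (Fin d) (Fin d) ℝ)ᵀ = 1 := by
      rw [← Matrix.transpose_mul, Units.mul_inv, Matrix.transpose_one]
    have e3 : ((h⁻¹ : GL (Fin d) ℝ) : Matrix (Fin d) (Fin d) ℝ)ᵀ *
        (-((h : Matrix (Fin d) (Fin d) ℝ)ᵀ * σ)) = -σ := by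
      rw [Matrix.mul_neg, ← Matrix.mul_assoc, e, Matrix.one_mul]
    rw [fromBlocks_multiply, Matrix.mul_assoc σ, Units.mul_inv, e3, e]
    simp
  inv_val := by
    have e : (h : Matrix (Fin d) (Fin d) ℝ)ᵀ * ((h⁻¹ : GL (Fin d) ℝ) : Matrix (Fin d) (Fin d) ℝ)ᵀ = 1 := by
      rw [← Matrix.transpose_mul, Units.inv_mul, Matrix.transpose_one]
    rw [fromBlocks_multiply, Units.inv_mul, e]
    simp [Matrix.mul_assoc]

/-- The action `h† σ = ᵗh⁻¹ σ h⁻¹`. -/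
noncomputable def dag {d : ℕ} (h : GL (Fin d) ℝ) (σ : Matrix (Fin d) (Fin d) ℝ) :
    Matrix (Fin d) (Fin d) ℝ :=
  ((h⁻¹ : GL (Fin d) ℝ) : Matrix (Fin d) (Fin d) ℝ)ᵀ * σ * ((h⁻¹ : GL (Fin d) ℝ) : Matrix (Fin d) (Fin d) ℝ)

theorem dag_mem_Sym {d : ℕ} (h : GL (Fin d) ℝ) {σ : Matrix (Fin d) (Fin d) ℝ}
    (hσ : σ ∈ Sym d) : dag h σ ∈ Sym d := by
  change (dag h σ)ᵀ = dag h σ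
  have : σᵀ = σ := hσ
  simp [dag, Matrix.transpose_mul, this, Matrix.mul_assoc]

/-- The product in coordinates: `(σ, h)(σ', h') = (σ + h† σ', h h')`. -/
theorem parabolicElt_mul {d : ℕ} (σ σ' : Matrix (Fin d) (Fin d) ℝ) (h h' : GL (Fin d) ℝ) :
    parabolicElt σ h * parabolicElt σ' h' = parabolicElt (σ + dag h σ') (h * h') := by
  apply Units.ext
  have e : ((h⁻¹ : GL (Fin d) ℝ) : Matrix (Fin d) (Fin d) ℝ) * (h : Matrix (Fin d) (Fin d) ℝ) = 1 :=
    Units.inv_mul h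
  change fromBlocks _ _ _ _ * fromBlocks _ _ _ _ = fromBlocks _ _ _ _
  rw [fromBlocks_multiply]
  congr 1
  · simp
  · simp
  · rw [dag, Units.val_mul, Matrix.add_mul, Matrix.mul_assoc σ]
    congr 1
    rw [Matrix.mul_assoc (_ * σ'), ← Matrix.mul_assoc _ (h : Matrix (Fin d) (Fin d) ℝ), e,
      Matrix.one_mul, ← Matrix.mul_assoc]
  · rw [_root_.mul_inv_rev, Units.val_mul, Matrix.transpose_mul, Matrix.mul_zero, zero_add]

theorem parabolicElt_zero_one (d : ℕ) : parabolicElt (d := d) 0 1 = 1 := by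
  apply Units.ext
  change fromBlocks _ _ _ _ = 1
  simp

/-- The standard maximal parabolic subgroup `Q` of `Sp(d, ℝ)`, as a group of invertible
`2d × 2d` matrices. -/
noncomputable def Q (d : ℕ) : Subgroup (GL (Fin d ⊕ Fin d) ℝ) where
  carrier := {g | ∃ σ ∈ Sym d, ∃ h : GL (Fin d) ℝ, g = parabolicElt σ h}
  mul_mem' := by
    rintro _ _ ⟨σ, hσ, h, rfl⟩ ⟨σ', hσ', h', rfl⟩
    exact ⟨_, (Sym d).add_mem hσ (dag_mem_Sym h hσ'), _, parabolicElt_mul σ σ' h h'⟩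
  one_mem' := ⟨0, (Sym d).zero_mem, 1, (parabolicElt_zero_one d).symm⟩
  inv_mem' := by
    rintro _ ⟨σ, hσ, h, rfl⟩
    refine ⟨-dag h⁻¹ σ, (Sym d).neg_mem (dag_mem_Sym _ hσ), h⁻¹, ?_⟩
    rw [inv_eq_iff_mul_eq_one, parabolicElt_mul]
    have : σ + dag h (-dag h⁻¹ σ) = 0 := by
      have e1 : ((h⁻¹ : GL (Fin d) ℝ) : Matrix (Fin d) (Fin d) ℝ)ᵀ * (h : Matrix (Fin d) (Fin d) ℝ)ᵀ = 1 := by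
        rw [← Matrix.transpose_mul, Units.mul_inv, Matrix.transpose_one]
      have e2 : (h : Matrix (Fin d) (Fin d) ℝ) * ((h⁻¹ : GL (Fin d) ℝ) : Matrix (Fin d) (Fin d) ℝ) = 1 :=
        Units.mul_inv h
      rw [dag, dag, inv_inv, Matrix.mul_neg, Matrix.neg_mul, ← Matrix.mul_assoc,
        ← Matrix.mul_assoc, e1, Matrix.one_mul, Matrix.mul_assoc, e2, Matrix.mul_one,
        add_neg_cancel]
    rw [this, mul_inv_cancel, parabolicElt_zero_one]

/-- `Q` is contained in the symplectic group `Sp(d, ℝ)`. -/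
theorem Q_symplectic (d : ℕ) (g : GL (Fin d ⊕ Fin d) ℝ) (hg : g ∈ Q d) :
    (g : Matrix (Fin d ⊕ Fin d) (Fin d ⊕ Fin d) ℝ) ∈ Matrix.symplecticGroup (Fin d) ℝ := by
  obtain ⟨σ, hσ, h, rfl⟩ := hg
  have hs : σᵀ = σ := hσ
  have e1 : ((h⁻¹ : GL (Fin d) ℝ) : Matrix (Fin d) (Fin d) ℝ)ᵀ * (h : Matrix (Fin d) (Fin d) ℝ)ᵀ = 1 := by
    rw [← Matrix.transpose_mul, Units.mul_inv, Matrix.transpose_one]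
  have e2 : (h : Matrix (Fin d) (Fin d) ℝ) * ((h⁻¹ : GL (Fin d) ℝ) : Matrix (Fin d) (Fin d) ℝ) = 1 :=
    Units.mul_inv h
  rw [SymplecticGroup.mem_iff]
  change fromBlocks _ _ _ _ * _ * (fromBlocks _ _ _ _)ᵀ = _
  rw [Matrix.J, fromBlocks_transpose, fromBlocks_multiply, fromBlocks_multiply]
  congr 1
  · simp
  · simp [-coe_units_inv, e2]
  · simp [-coe_units_inv, e1]
  · simp [-coe_units_inv, Matrix.transpose_mul, hs]
    rw [← Matrix.mul_assoc _ _ σ, e1, Matrix.one_mul, add_neg_cancel]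

/-- The embedding `g ↦ diag(g, ᵗg⁻¹)` of `GL(d, ℝ)` into `Sp(d, ℝ)`. -/
noncomputable def glEmb {d : ℕ} (g : GL (Fin d) ℝ) : GL (Fin d ⊕ Fin d) ℝ := parabolicElt 0 g

/-- The conjugate `g S g⁻¹` of a set `S` of `2d × 2d` matrices by `g ∈ GL(d, ℝ)`. -/
def conjSet {d : ℕ} (g : GL (Fin d) ℝ) (S : Set (GL (Fin d ⊕ Fin d) ℝ)) :
    Set (GL (Fin d ⊕ Fin d) ℝ) :=
  (fun x => glEmb g * x * (glEmb g)⁻¹) '' S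

/-- The set of all `[h, 0; σ h, ᵗh⁻¹]` with `σ ∈ S` and `h ∈ H`. -/
def semidirectSet {d : ℕ} (S H : Set (Matrix (Fin d) (Fin d) ℝ)) :
    Set (GL (Fin d ⊕ Fin d) ℝ) :=
  {g | ∃ σ ∈ S, ∃ h : GL (Fin d) ℝ, (h : Matrix (Fin d) (Fin d) ℝ) ∈ H ∧ g = parabolicElt σ h}

end Generalities

/-- The class `𝓔₂`: the connected (Lie) subgroups `G` of `Q` of the form `Σ ⋊ H`, where `Σ` is a
vector subspace with `0 ≠ Σ ⊊ Sym(2, ℝ)` (a line or a plane) and `H` is a connected (Lie) subgroup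
of `GL(2, ℝ)`, `H ≠ 1`. As `G` is a group, `Σ` is automatically invariant under `H`. -/
def E2 : Set (Subgroup (GL (Fin 2 ⊕ Fin 2) ℝ)) :=
  {G | G ≤ Q 2 ∧ IsConnectedLieSubgroup G ∧
    ∃ (S : Submodule ℝ (Matrix (Fin 2) (Fin 2) ℝ)) (H : Subgroup (GL (Fin 2) ℝ)),
      S ≠ ⊥ ∧ S < Sym 2 ∧ H ≠ ⊥ ∧ IsConnectedLieSubgroup H ∧
      (G : Set (GL (Fin 2 ⊕ Fin 2) ℝ)) =
        semidirectSet (S : Set (Matrix (Fin 2) (Fin 2) ℝ))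
          ((fun h : GL (Fin 2) ℝ => (h : Matrix (Fin 2) (Fin 2) ℝ)) '' H)}

section TheList

/-! The six vector parts. -/

/-- `[u, 0; 0, u]` -/
def sigmaOne : Set (Matrix (Fin 2) (Fin 2) ℝ) := {M | ∃ u : ℝ, M = !![u, 0; 0, u]}
/-- `[u, 0; 0, 0]` -/
def sigmaZero : Set (Matrix (Fin 2) (Fin 2) ℝ) := {M | ∃ u : ℝ, M = !![u, 0; 0, 0]}
/-- `[0, u; u, 0]` -/
def sigmaNeg : Set (Matrix (Fin 2) (Fin 2) ℝ) := {M | ∃ u : ℝ, M = !![0, u; u, 0]}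
/-- `[u, v; v, -u]` -/
def sigmaOnePerp : Set (Matrix (Fin 2) (Fin 2) ℝ) := {M | ∃ u v : ℝ, M = !![u, v; v, -u]}
/-- `[0, u; u, v]` -/
def sigmaZeroPerp : Set (Matrix (Fin 2) (Fin 2) ℝ) := {M | ∃ u v : ℝ, M = !![0, u; u, v]}
/-- `[u, 0; 0, v]` -/
def sigmaNegPerp : Set (Matrix (Fin 2) (Fin 2) ℝ) := {M | ∃ u v : ℝ, M = !![u, 0; 0, v]}

/-- The rotation by the angle `θ`. -/
noncomputable def rot (θ : ℝ) : Matrix (Fin 2) (Fin 2) ℝ :=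
  !![Real.cos θ, -Real.sin θ; Real.sin θ, Real.cos θ]

/-- `e^t R_θ`, `t, θ` arbitrary. -/
def conformal : Set (Matrix (Fin 2) (Fin 2) ℝ) := {M | ∃ t θ : ℝ, M = Real.exp t • rot θ}
/-- `e^t R_{tα}` -/
def spiral (α : ℝ) : Set (Matrix (Fin 2) (Fin 2) ℝ) :=
  {M | ∃ t : ℝ, M = Real.exp t • rot (t * α)}
/-- `R_θ` -/
def rotations : Set (Matrix (Fin 2) (Fin 2) ℝ) := {M | ∃ θ : ℝ, M = rot θ}
/-- `[e^t, 0; 0, e^s]` -/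
def diagonals : Set (Matrix (Fin 2) (Fin 2) ℝ) :=
  {M | ∃ t s : ℝ, M = !![Real.exp t, 0; 0, Real.exp s]}
/-- `[e^t, 0; 0, e^{tβ}]` -/
def diagCurve (β : ℝ) : Set (Matrix (Fin 2) (Fin 2) ℝ) :=
  {M | ∃ t : ℝ, M = !![Real.exp t, 0; 0, Real.exp (t * β)]}
/-- `e^{tλ} [1, 0; 0, e^t]` -/
def diagLine (l : ℝ) : Set (Matrix (Fin 2) (Fin 2) ℝ) :=
  {M | ∃ t : ℝ, M = Real.exp (t * l) • !![1, 0; 0, Real.exp t]}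
/-- `[e^t, 0; 0, e^t]` -/
def scalars : Set (Matrix (Fin 2) (Fin 2) ℝ) :=
  {M | ∃ t : ℝ, M = !![Real.exp t, 0; 0, Real.exp t]}

/-- `[e^t, r; 0, e^s]` -/
def upperFull : Set (Matrix (Fin 2) (Fin 2) ℝ) :=
  {M | ∃ t s r : ℝ, M = !![Real.exp t, r; 0, Real.exp s]}
/-- `[e^{tλ}, s; 0, e^{t(λ+1)}]` -/
def upperParam (l : ℝ) : Set (Matrix (Fin 2) (Fin 2) ℝ) :=
  {M | ∃ t s : ℝ, M = !![Real.exp (t * l), s; 0, Real.exp (t * (l + 1))]}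
/-- `[e^t, s; 0, e^t]` -/
def upperScalar : Set (Matrix (Fin 2) (Fin 2) ℝ) :=
  {M | ∃ t s : ℝ, M = !![Real.exp t, s; 0, Real.exp t]}
/-- `[1, t; 0, 1]` -/
def upperUnip : Set (Matrix (Fin 2) (Fin 2) ℝ) := {M | ∃ t : ℝ, M = !![1, t; 0, 1]}
/-- `e^t [1, t; 0, 1]` -/
def upperJordan : Set (Matrix (Fin 2) (Fin 2) ℝ) :=
  {M | ∃ t : ℝ, M = Real.exp t • !![1, t; 0, 1]}

/-- `[e^t, 0; r, e^s]` -/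
def lowerFull : Set (Matrix (Fin 2) (Fin 2) ℝ) :=
  {M | ∃ t s r : ℝ, M = !![Real.exp t, 0; r, Real.exp s]}
/-- `[e^{tλ}, 0; s, e^{t(λ+1)}]` -/
def lowerParam (l : ℝ) : Set (Matrix (Fin 2) (Fin 2) ℝ) :=
  {M | ∃ t s : ℝ, M = !![Real.exp (t * l), 0; s, Real.exp (t * (l + 1))]}
/-- `[e^t, 0; s, e^t]` -/
def lowerScalar : Set (Matrix (Fin 2) (Fin 2) ℝ) :=
  {M | ∃ t s : ℝ, M = !![Real.exp t, 0; s, Real.exp t]}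
/-- `[1, 0; t, 1]` -/
def lowerUnip : Set (Matrix (Fin 2) (Fin 2) ℝ) := {M | ∃ t : ℝ, M = !![1, 0; t, 1]}
/-- `e^t [1, 0; t, 1]` -/
def lowerJordan : Set (Matrix (Fin 2) (Fin 2) ℝ) :=
  {M | ∃ t : ℝ, M = Real.exp t • !![1, 0; t, 1]}

/-- The entries of the list, with their parameters. The first number in each name is the
dimension of the group. -/
inductive Entry : Type
  | d5_1
  | d4_1
  | d4_2
  | d4_3 (l : ℝ)
  | d4_4
  | d4_5
  | d4_6
  | d3_1
  | d3_2 (α : Set.Ici (0 : ℝ))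
  | d3_3
  | d3_4 (l : ℝ)
  | d3_5
  | d3_6
  | d3_7 (l : ℝ)
  | d3_8
  | d3_9
  | d3_10
  | d3_11
  | d3_12 (β : Set.Icc (-1 : ℝ) 1)
  | d2_1 (α : Set.Ici (0 : ℝ))
  | d2_2
  | d2_3 (l : ℝ)
  | d2_4
  | d2_5
  | d2_6
  | d2_7 (β : Set.Icc (-1 : ℝ) 1)

/-- The group `Σ ⋊ H` of each entry of the list (as a set of matrices). -/
def Entry.group : Entry → Set (GL (Fin 2 ⊕ Fin 2) ℝ)
  | .d5_1 => semidirectSet sigmaZeroPerp upperFull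
  | .d4_1 => semidirectSet sigmaOnePerp conformal
  | .d4_2 => semidirectSet sigmaZero lowerFull
  | .d4_3 l => semidirectSet sigmaZeroPerp (upperParam l)
  | .d4_4 => semidirectSet sigmaZeroPerp diagonals
  | .d4_5 => semidirectSet sigmaZeroPerp upperScalar
  | .d4_6 => semidirectSet sigmaNegPerp diagonals
  | .d3_1 => semidirectSet sigmaOne conformal
  | .d3_2 α => semidirectSet sigmaOnePerp (spiral α)
  | .d3_3 => semidirectSet sigmaOnePerp rotations
  | .d3_4 l => semidirectSet sigmaZero (lowerParam l)
  | .d3_5 => semidirectSet sigmaZero diagonals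
  | .d3_6 => semidirectSet sigmaZero lowerScalar
  | .d3_7 l => semidirectSet sigmaZeroPerp (diagLine l)
  | .d3_8 => semidirectSet sigmaZeroPerp upperUnip
  | .d3_9 => semidirectSet sigmaZeroPerp upperJordan
  | .d3_10 => semidirectSet sigmaZeroPerp scalars
  | .d3_11 => semidirectSet sigmaNeg diagonals
  | .d3_12 β => semidirectSet sigmaNegPerp (diagCurve β)
  | .d2_1 α => semidirectSet sigmaOne (spiral α)
  | .d2_2 => semidirectSet sigmaOne rotations
  | .d2_3 l => semidirectSet sigmaZero (diagLine l)
  | .d2_4 => semidirectSet sigmaZero lowerUnip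
  | .d2_5 => semidirectSet sigmaZero lowerJordan
  | .d2_6 => semidirectSet sigmaZero scalars
  | .d2_7 β => semidirectSet sigmaNeg (diagCurve β)

/-- The dimension under which each entry is listed. -/
def Entry.dim : Entry → ℕ
  | .d5_1 => 5
  | .d4_1 | .d4_2 | .d4_3 _ | .d4_4 | .d4_5 | .d4_6 => 4
  | .d3_1 | .d3_2 _ | .d3_3 | .d3_4 _ | .d3_5 | .d3_6 | .d3_7 _ | .d3_8 | .d3_9 | .d3_10
  | .d3_11 | .d3_12 _ => 3
  | .d2_1 _ | .d2_2 | .d2_3 _ | .d2_4 | .d2_5 | .d2_6 | .d2_7 _ => 2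

end TheList

end SympClass

/-! A connected Lie subgroup is determined by its Lie algebra (`IsExpGenerated.eq`), and conjugation
by `g` carries `Σ ⋊ H` to `g†Σ ⋊ gHg⁻¹` (`conjSet_semidirectSet`). The classification thus becomes
linear algebra for pairs `(Σ, A)`, where `A` is the Lie algebra of `H`.

The vector part is normalised first (`exists_isNormalVec`). A line in `Sym 2` is spanned by a
nonzero binary quadratic form, which up to congruence and scaling is `x² + y²`, `x²` or `2xy`. A
plane is the annihilator of a line for the pairing `tr (ρσ)`, on which `g†` acts dually, so there
are again three types. Differentiating the invariance of `Σ` gives `XᵀΣ + ΣX ⊆ Σ` for `X` in `A`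
(`transpose_mul_add_mul_mem`). This confines `A` to the matrices `aI + bJ` (definite form and its
annihilator), to the diagonal matrices (hyperbolic form and its annihilator), or to triangular
matrices (form of rank one: lower; its annihilator: upper).

What remains is to classify subalgebras under conjugations preserving `Σ`
(`exists_shape_of_isNormalVec`). In the conformal case a reflection makes the slope nonnegative; in
the diagonal case exchanging the axes brings the slope into `[-1, 1]`. A triangular algebra either
contains the nilpotent `[0, 1; 0, 0]`, hence is determined by its diagonal part, or projects
injectively to the diagonal; in the latter case a shear or a rescaling brings it to normal form.

Conversely, each linear part of the list is a group of exponentials with an explicit Lie algebra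
(`IsLieModel`), and the Lie algebra of `Σ ⋊ H` is the sum of the two pieces (`lieAlg_semidirect`),
which yields membership in `E2` and the dimension.

Non-conjugacy (`Shape.eq_of_conjSet`) rests on invariants. The signs of determinants on `Σ` and `dim
Σ` separate the six vector parts. For equal vector parts, the trace-determinant pairs separate the
conformal and the diagonal algebras. In the triangular cases the conjugating matrix is itself
triangular, so the ordered diagonal pairs and the presence of `[0, 1; 0, 0]` and of `1` are
invariants, and they suffice. -/

namespace SympClass

/-! ### Curves of matrices, exponentials and generation by exponentials -/

section MatrixCurves

open Matrix

variable {l m n : Type*}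

/-- Entrywise differentiability of a curve of matrices. -/
def HasEntryDeriv (f : ℝ → Matrix m n ℝ) (f' : Matrix m n ℝ) (t : ℝ) : Prop :=
  ∀ i j, HasDerivAt (fun s => f s i j) (f' i j) t

theorem HasEntryDeriv.mul [Fintype m] {f : ℝ → Matrix l m ℝ} {g : ℝ → Matrix m n ℝ}
    {f' : Matrix l m ℝ} {g' : Matrix m n ℝ} {t : ℝ} (hf : HasEntryDeriv f f' t) (hg : HasEntryDeriv g g' t) :
    HasEntryDeriv (fun s => f s * g s) (f' * g t + f t * g') t := by
  intro i j
  simp only [Matrix.mul_apply, Matrix.add_apply, ← Finset.sum_add_distrib]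
  exact HasDerivAt.fun_sum fun k _ => (hf i k).mul (hg k j)

theorem HasEntryDeriv.transpose {f : ℝ → Matrix l m ℝ} {f' : Matrix l m ℝ}
    {t : ℝ} (hf : HasEntryDeriv f f' t) : HasEntryDeriv (fun s => (f s)ᵀ) f'ᵀ t :=
  fun i j => hf j i

theorem hasEntryDeriv_const (A : Matrix l m ℝ) (t : ℝ) : HasEntryDeriv (fun _ => A) 0 t :=
  fun i j => hasDerivAt_const t (A i j)

theorem HasEntryDeriv.unique {f : ℝ → Matrix l m ℝ} {f' f'' : Matrix l m ℝ}
    {t : ℝ} (h : HasEntryDeriv f f' t) (h' : HasEntryDeriv f f'' t) : f' = f'' := by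
  ext i j
  exact (h i j).unique (h' i j)

theorem eq_of_forall_hasEntryDeriv_zero {f : ℝ → Matrix m n ℝ}
    (h : ∀ t, HasEntryDeriv f 0 t) (t : ℝ) : f t = f 0 := by
  ext i j
  exact is_const_of_deriv_eq_zero (fun s => (h s i j).differentiableAt)
    (fun s => (h s i j).deriv) t 0

variable [Fintype m] [Fintype n]

theorem HasEntryDeriv.linear {f : ℝ → Matrix m n ℝ} {f' : Matrix m n ℝ} {t : ℝ}
    (h : HasEntryDeriv f f' t) (φ : Matrix m n ℝ →ₗ[ℝ] ℝ) :
    HasDerivAt (fun s => φ (f s)) (φ f') t := by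
  classical
  have key : ∀ M : Matrix m n ℝ, φ M = ∑ i, ∑ j, M i j * φ (Matrix.single i j 1) := by
    intro M
    conv_lhs => rw [Matrix.matrix_eq_sum_single M]
    simp only [map_sum]
    refine Finset.sum_congr rfl fun i _ => Finset.sum_congr rfl fun j _ => ?_
    rw [← smul_eq_mul, ← map_smul, Matrix.smul_single, smul_eq_mul, mul_one]
  rw [show (fun s => φ (f s)) = _ from funext fun s => key (f s), key f']
  exact HasDerivAt.fun_sum fun i _ => HasDerivAt.fun_sum fun j _ => (h i j).mul_const _

/-- The velocity of a curve in a subspace lies in the subspace. -/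
theorem HasEntryDeriv.mem {f : ℝ → Matrix m n ℝ} {f' : Matrix m n ℝ} {t : ℝ}
    (h : HasEntryDeriv f f' t) {S : Submodule ℝ (Matrix m n ℝ)} (hS : ∀ s, f s ∈ S) : f' ∈ S := by
  by_contra hn
  -- A functional vanishing on `S` but not at `f'` would be constantly zero along the curve and yet
  -- have derivative `φ f' ≠ 0`.
  obtain ⟨φ, hφ, hk⟩ := Submodule.exists_le_ker_of_notMem hn
  have h0 : (fun s => φ (f s)) = fun _ => 0 := funext fun s => hk (hS s)
  have h1 := h.linear φ
  rw [h0] at h1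
  exact hφ (h1.unique (hasDerivAt_const t (0 : ℝ)))

/-- A curve starting in a subspace with velocity in the subspace stays in the subspace. -/
theorem mem_of_forall_hasEntryDeriv {f f' : ℝ → Matrix m n ℝ}
    (h : ∀ t, HasEntryDeriv f (f' t) t) {S : Submodule ℝ (Matrix m n ℝ)}
    (h0 : f 0 ∈ S) (hS : ∀ t, f' t ∈ S) (t : ℝ) : f t ∈ S := by
  by_contra hn
  obtain ⟨φ, hφ, hk⟩ := Submodule.exists_le_ker_of_notMem hn
  have hc : ∀ s, HasDerivAt (fun s => φ (f s)) 0 s := fun s => by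
    have := (h s).linear φ
    rwa [show φ (f' s) = 0 from hk (hS s)] at this
  have := is_const_of_deriv_eq_zero (fun s => (hc s).differentiableAt) (fun s => (hc s).deriv) t 0
  exact hφ (this.trans (hk h0))

variable [DecidableEq n]

-- The operator norm serves only to differentiate the exponential; read entrywise, the result no
-- longer refers to a norm.
open scoped Matrix.Norms.Operator in
theorem hasEntryDeriv_exp (Y : Matrix n n ℝ) (t : ℝ) :
    HasEntryDeriv (fun s => NormedSpace.exp (s • Y)) (NormedSpace.exp (t • Y) * Y) t := by
  have h := hasDerivAt_exp_smul_const (𝕂 := ℝ) Y t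
  intro i j
  exact (hasDerivAt_pi.1 ((hasDerivAt_pi.1 h) i)) j

theorem hasEntryDeriv_exp_neg (Y : Matrix n n ℝ) (t : ℝ) :
    HasEntryDeriv (fun s => NormedSpace.exp (-(s • Y))) (-(Y * NormedSpace.exp (-(t • Y)))) t := by
  have h := hasEntryDeriv_exp (-Y) t
  have hc : Commute (NormedSpace.exp (t • -Y)) (-Y) :=
    ((Commute.refl (-Y)).smul_left t).exp_left
  rw [hc.eq] at h
  simpa only [smul_neg, neg_mul] using h

theorem exp_mul_exp_neg (X : Matrix n n ℝ) : NormedSpace.exp X * NormedSpace.exp (-X) = 1 := by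
  rw [← Matrix.exp_add_of_commute _ _ (Commute.neg_right (Commute.refl X)), add_neg_cancel,
    NormedSpace.exp_zero]

theorem exp_neg_mul_exp (X : Matrix n n ℝ) : NormedSpace.exp (-X) * NormedSpace.exp X = 1 := by
  simpa using exp_mul_exp_neg (-X)

/-- The solution of `f' = f X`. -/
theorem eq_mul_exp_of_hasEntryDeriv {k : Type*} {f : ℝ → Matrix k n ℝ} {X : Matrix n n ℝ}
    (h : ∀ t, HasEntryDeriv f (f t * X) t) (t : ℝ) :
    f t = f 0 * NormedSpace.exp (t • X) := by
  have hd : ∀ t, HasEntryDeriv (fun s => f s * NormedSpace.exp (-(s • X))) 0 t := by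
    intro t
    have := (h t).mul (hasEntryDeriv_exp_neg X t)
    rwa [Matrix.mul_neg, Matrix.mul_assoc, add_neg_cancel] at this
  have h1 := eq_of_forall_hasEntryDeriv_zero hd t
  simp only [zero_smul, neg_zero, NormedSpace.exp_zero, Matrix.mul_one] at h1
  rw [← h1, Matrix.mul_assoc, exp_neg_mul_exp, Matrix.mul_one]

/-- The matrix exponential is determined by its differential equation. -/
theorem exp_eq_of_hasEntryDeriv {f : ℝ → Matrix n n ℝ} {X : Matrix n n ℝ}
    (h : ∀ t, HasEntryDeriv f (f t * X) t) (h0 : f 0 = 1) (t : ℝ) :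
    NormedSpace.exp (t • X) = f t := by
  rw [eq_mul_exp_of_hasEntryDeriv h t, h0, Matrix.one_mul]

theorem eq_of_forall_exp_smul_eq {X Y : Matrix n n ℝ}
    (h : ∀ t : ℝ, NormedSpace.exp (t • X) = NormedSpace.exp (t • Y)) : X = Y := by
  have h1 := hasEntryDeriv_exp X 0
  have h2 := hasEntryDeriv_exp Y 0
  simp only [h] at h1
  have := h1.unique h2
  simpa [NormedSpace.exp_zero] using this

/-- The generator is the velocity at time `0`. Applied to the linear hull of a group (diagonal,
triangular, conformal matrices), this gives a first bound on its Lie algebra. -/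
theorem mem_of_forall_exp_smul_mem {S : Submodule ℝ (Matrix n n ℝ)} {X : Matrix n n ℝ}
    (h : ∀ t : ℝ, NormedSpace.exp (t • X) ∈ S) : X ∈ S := by
  simpa [NormedSpace.exp_zero] using (hasEntryDeriv_exp X 0).mem h

/-- The exponential of a matrix as an invertible matrix. -/
noncomputable def expGL (X : Matrix n n ℝ) : GL n ℝ where
  val := NormedSpace.exp X
  inv := NormedSpace.exp (-X)
  val_inv := exp_mul_exp_neg X
  inv_val := exp_neg_mul_exp X

@[simp] theorem coe_expGL (X : Matrix n n ℝ) : (expGL X : Matrix n n ℝ) = NormedSpace.exp X := rfl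

theorem mem_lieAlg {G : Subgroup (GL n ℝ)} {X : Matrix n n ℝ} :
    X ∈ lieAlg G ↔ ∀ t : ℝ, expGL (t • X) ∈ G := by
  refine forall_congr' fun t => ⟨?_, fun h => ⟨_, h, rfl⟩⟩
  rintro ⟨g, hg, h⟩
  rwa [show expGL (t • X) = g from Units.ext h.symm]

/-- Every element is a product of exponentials of elements of the Lie algebra. -/
def IsExpGenerated (G : Subgroup (GL n ℝ)) : Prop :=
  ∀ g ∈ G, ∃ L : List (Matrix n n ℝ), (∀ X ∈ L, X ∈ lieAlg G) ∧
    (g : Matrix n n ℝ) = (L.map NormedSpace.exp).prod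

theorem coe_prod_expGL (L : List (Matrix n n ℝ)) :
    (((L.map expGL).prod : GL n ℝ) : Matrix n n ℝ) = (L.map NormedSpace.exp).prod := by
  induction L with
  | nil => rfl
  | cons X L ih => simp [ih]

/-- Each exponential factor is the time-one value of a one-parameter group that also lies in `G'`.
-/
theorem IsExpGenerated.le {G G' : Subgroup (GL n ℝ)} (h : IsExpGenerated G)
    (hl : lieAlg G ⊆ lieAlg G') : G ≤ G' := by
  intro g hg
  obtain ⟨L, hL, e⟩ := h g hg
  rw [← coe_prod_expGL] at e
  rw [Units.ext e]
  refine Subgroup.list_prod_mem _ fun x hx => ?_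
  obtain ⟨X, hX, rfl⟩ := List.mem_map.1 hx
  simpa using mem_lieAlg.1 (hl (hL X hX)) 1

/-- A connected Lie subgroup is determined by its Lie algebra. -/
theorem IsExpGenerated.eq {G G' : Subgroup (GL n ℝ)} (h : IsExpGenerated G)
    (h' : IsExpGenerated G') (hl : lieAlg G = lieAlg G') : G = G' :=
  le_antisymm (h.le hl.le) (h'.le hl.ge)

theorem exp_conj_GL (g : GL n ℝ) (X : Matrix n n ℝ) :
    NormedSpace.exp ((g : Matrix n n ℝ) * X * ((g⁻¹ : GL n ℝ) : Matrix n n ℝ)) =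
      g * NormedSpace.exp X * ((g⁻¹ : GL n ℝ) : Matrix n n ℝ) :=
  Matrix.exp_units_conj g X

theorem expGL_conj (g : GL n ℝ) (X : Matrix n n ℝ) :
    expGL ((g : Matrix n n ℝ) * X * ((g⁻¹ : GL n ℝ) : Matrix n n ℝ)) = g * expGL X * g⁻¹ :=
  Units.ext (exp_conj_GL g X)

/-- The conjugate `g H g⁻¹`. -/
def conjGL (g : GL n ℝ) (H : Subgroup (GL n ℝ)) : Subgroup (GL n ℝ) :=
  H.map (MulAut.conj g).toMonoidHom

theorem mem_conjGL {g x : GL n ℝ} {H : Subgroup (GL n ℝ)} :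
    x ∈ conjGL g H ↔ g⁻¹ * x * g ∈ H := by
  rw [conjGL, Subgroup.mem_map]
  constructor
  · rintro ⟨y, hy, rfl⟩
    simpa [mul_assoc] using hy
  · intro h
    exact ⟨_, h, by simp [mul_assoc]⟩

theorem mem_lieAlg_conjGL {g : GL n ℝ} {H : Subgroup (GL n ℝ)} {X : Matrix n n ℝ} :
    X ∈ lieAlg (conjGL g H) ↔
      ((g⁻¹ : GL n ℝ) : Matrix n n ℝ) * X * (g : Matrix n n ℝ) ∈ lieAlg H := by
  rw [mem_lieAlg, mem_lieAlg]
  refine forall_congr' fun t => ?_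
  rw [mem_conjGL]
  have := expGL_conj g⁻¹ (t • X)
  rw [inv_inv] at this
  rw [← this, Matrix.mul_smul, Matrix.smul_mul]

theorem IsExpGenerated.conjGL {H : Subgroup (GL n ℝ)} (h : IsExpGenerated H) (g : GL n ℝ) :
    IsExpGenerated (conjGL g H) := by
  rintro _ ⟨x, hx, rfl⟩
  obtain ⟨L, hL, e⟩ := h x hx
  refine ⟨L.map fun X => (g : Matrix n n ℝ) * X * ((g⁻¹ : GL n ℝ) : Matrix n n ℝ), ?_, ?_⟩
  · intro Y hY
    obtain ⟨X, hX, rfl⟩ := List.mem_map.1 hY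
    rw [mem_lieAlg_conjGL]
    have : ((g⁻¹ : GL n ℝ) : Matrix n n ℝ) * ((g : Matrix n n ℝ) * X *
        ((g⁻¹ : GL n ℝ) : Matrix n n ℝ)) * (g : Matrix n n ℝ) = X := by
      simp only [← Matrix.mul_assoc, Units.inv_mul, Matrix.one_mul]
      rw [Matrix.mul_assoc, Units.inv_mul, Matrix.mul_one]
    rw [this]
    exact hL X hX
  · rw [← coe_prod_expGL] at e ⊢
    congr 1
    have : x = (L.map expGL).prod := Units.ext e
    rw [this, MulEquiv.coe_toMonoidHom, map_list_prod, List.map_map, List.map_map]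
    congr 2
    funext X
    exact (expGL_conj g X).symm

theorem IsConnectedLieSubgroup.isExpGenerated {G : Subgroup (GL n ℝ)}
    (h : IsConnectedLieSubgroup G) : IsExpGenerated G := h.2

end MatrixCurves

/-! ### The groups `Σ ⋊ H` and their Lie algebras -/

section Semidirect

open Matrix

variable {d : ℕ}

theorem coe_parabolicElt (σ : Matrix (Fin d) (Fin d) ℝ) (h : GL (Fin d) ℝ) :
    (parabolicElt σ h : Matrix (Fin d ⊕ Fin d) (Fin d ⊕ Fin d) ℝ) =
      fromBlocks (h : Matrix (Fin d) (Fin d) ℝ) 0 (σ * (h : Matrix (Fin d) (Fin d) ℝ))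
        ((h⁻¹ : GL (Fin d) ℝ) : Matrix (Fin d) (Fin d) ℝ)ᵀ := rfl

theorem parabolicElt_inj {σ σ' : Matrix (Fin d) (Fin d) ℝ} {h h' : GL (Fin d) ℝ} :
    parabolicElt σ h = parabolicElt σ' h' ↔ σ = σ' ∧ h = h' := by
  refine ⟨fun e => ?_, by rintro ⟨rfl, rfl⟩; rfl⟩
  have e' := congrArg Units.val e
  rw [coe_parabolicElt, coe_parabolicElt, fromBlocks_inj] at e'
  obtain ⟨e1, -, e3, -⟩ := e'
  obtain rfl : h = h' := Units.ext e1
  refine ⟨?_, rfl⟩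
  have := congrArg (· * ((h⁻¹ : GL (Fin d) ℝ) : Matrix (Fin d) (Fin d) ℝ)) e3
  simpa only [Matrix.mul_assoc, Units.mul_inv, Matrix.mul_one] using this

theorem dag_zero (h : GL (Fin d) ℝ) : dag h 0 = 0 := by simp [dag]

theorem dag_one (σ : Matrix (Fin d) (Fin d) ℝ) : dag 1 σ = σ := by simp [dag]

theorem dag_mul (g h : GL (Fin d) ℝ) (σ : Matrix (Fin d) (Fin d) ℝ) :
    dag (g * h) σ = dag g (dag h σ) := by
  simp only [dag, _root_.mul_inv_rev, Units.val_mul, Matrix.transpose_mul, Matrix.mul_assoc]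

theorem glEmb_inv (g : GL (Fin d) ℝ) : (glEmb g)⁻¹ = glEmb g⁻¹ := by
  rw [inv_eq_iff_mul_eq_one, glEmb, glEmb, parabolicElt_mul, dag_zero, add_zero, mul_inv_cancel,
    parabolicElt_zero_one]

theorem glEmb_mul (g h : GL (Fin d) ℝ) : glEmb (g * h) = glEmb g * glEmb h := by
  rw [glEmb, glEmb, glEmb, parabolicElt_mul, dag_zero, add_zero]

theorem glEmb_conj (g h : GL (Fin d) ℝ) (σ : Matrix (Fin d) (Fin d) ℝ) :
    glEmb g * parabolicElt σ h * (glEmb g)⁻¹ = parabolicElt (dag g σ) (g * h * g⁻¹) := by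
  rw [glEmb_inv, glEmb, glEmb, parabolicElt_mul, parabolicElt_mul, dag_zero, add_zero, zero_add]

/-- The matrices of the elements of a linear group. -/
def matSet (H : Subgroup (GL (Fin d) ℝ)) : Set (Matrix (Fin d) (Fin d) ℝ) :=
  (fun h : GL (Fin d) ℝ => (h : Matrix (Fin d) (Fin d) ℝ)) '' H

@[simp] theorem coe_mem_matSet {H : Subgroup (GL (Fin d) ℝ)} {h : GL (Fin d) ℝ} :
    (h : Matrix (Fin d) (Fin d) ℝ) ∈ matSet H ↔ h ∈ H :=
  Function.Injective.mem_set_image Units.val_injective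

theorem parabolicElt_mem_semidirectSet {S : Set (Matrix (Fin d) (Fin d) ℝ)}
    {H : Subgroup (GL (Fin d) ℝ)} {σ : Matrix (Fin d) (Fin d) ℝ} {h : GL (Fin d) ℝ} :
    parabolicElt σ h ∈ semidirectSet S (matSet H) ↔ σ ∈ S ∧ h ∈ H := by
  constructor
  · rintro ⟨σ', hσ', h', hh', e⟩
    obtain ⟨rfl, rfl⟩ := parabolicElt_inj.1 e
    exact ⟨hσ', coe_mem_matSet.1 hh'⟩
  · rintro ⟨h1, h2⟩
    exact ⟨σ, h1, h, coe_mem_matSet.2 h2, rfl⟩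

/-- Conjugacy of semidirect products becomes simultaneous conjugacy of the pairs formed by the
vector part and the linear part. -/
theorem conjSet_semidirectSet (g : GL (Fin d) ℝ) (S : Set (Matrix (Fin d) (Fin d) ℝ))
    (H : Subgroup (GL (Fin d) ℝ)) :
    conjSet g (semidirectSet S (matSet H)) = semidirectSet (dag g '' S) (matSet (conjGL g H)) := by
  ext x
  constructor
  · rintro ⟨_, ⟨σ, hσ, h, hh, rfl⟩, rfl⟩
    refine ⟨_, ⟨σ, hσ, rfl⟩, g * h * g⁻¹, ?_, glEmb_conj g h σ⟩
    rw [coe_mem_matSet, mem_conjGL]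
    simpa [mul_assoc] using hh
  · rintro ⟨_, ⟨σ, hσ, rfl⟩, h, hh, rfl⟩
    rw [coe_mem_matSet, mem_conjGL] at hh
    refine ⟨_, ⟨σ, hσ, _, coe_mem_matSet.2 hh, rfl⟩, ?_⟩
    simp only [glEmb_conj]
    congr 1
    group

/-- The two factors are recovered from the elements `(σ, 1)` and `(0, x)`. -/
theorem semidirectSet_inj {S S' : Submodule ℝ (Matrix (Fin d) (Fin d) ℝ)}
    {H H' : Subgroup (GL (Fin d) ℝ)}
    (h : semidirectSet (S : Set (Matrix (Fin d) (Fin d) ℝ)) (matSet H) =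
      semidirectSet S' (matSet H')) : S = S' ∧ H = H' := by
  constructor
  · ext σ
    have : parabolicElt σ 1 ∈ semidirectSet (S : Set (Matrix (Fin d) (Fin d) ℝ)) (matSet H) ↔
      parabolicElt σ 1 ∈ semidirectSet (S' : Set (Matrix (Fin d) (Fin d) ℝ)) (matSet H') := by
      rw [h]
    simpa [parabolicElt_mem_semidirectSet, H.one_mem, H'.one_mem] using this
  · ext x
    have : parabolicElt 0 x ∈ semidirectSet (S : Set (Matrix (Fin d) (Fin d) ℝ)) (matSet H) ↔
      parabolicElt 0 x ∈ semidirectSet (S' : Set (Matrix (Fin d) (Fin d) ℝ)) (matSet H') := by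
      rw [h]
    simpa [parabolicElt_mem_semidirectSet] using this

/-- `h†` as a linear map. -/
noncomputable def dagLinear (h : GL (Fin d) ℝ) :
    Matrix (Fin d) (Fin d) ℝ →ₗ[ℝ] Matrix (Fin d) (Fin d) ℝ where
  toFun := dag h
  map_add' := by simp [dag, Matrix.mul_add, Matrix.add_mul]
  map_smul' := by simp [dag]

@[simp] theorem dagLinear_apply (h : GL (Fin d) ℝ) (σ : Matrix (Fin d) (Fin d) ℝ) :
    dagLinear h σ = dag h σ := rfl

/-- The group `Σ ⋊ H`. -/
noncomputable def semidirect (S : Submodule ℝ (Matrix (Fin d) (Fin d) ℝ))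
    (H : Subgroup (GL (Fin d) ℝ)) (hinv : ∀ h ∈ H, ∀ σ ∈ S, dag h σ ∈ S) :
    Subgroup (GL (Fin d ⊕ Fin d) ℝ) where
  carrier := semidirectSet S (matSet H)
  mul_mem' := by
    rintro _ _ ⟨σ, hσ, h, hh, rfl⟩ ⟨σ', hσ', h', hh', rfl⟩
    rw [coe_mem_matSet] at hh hh'
    rw [parabolicElt_mul, parabolicElt_mem_semidirectSet]
    exact ⟨S.add_mem hσ (hinv h hh _ hσ'), H.mul_mem hh hh'⟩
  one_mem' := by
    rw [← parabolicElt_zero_one, parabolicElt_mem_semidirectSet]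
    exact ⟨S.zero_mem, H.one_mem⟩
  inv_mem' := by
    rintro _ ⟨σ, hσ, h, hh, rfl⟩
    rw [coe_mem_matSet] at hh
    have : (parabolicElt σ h)⁻¹ = parabolicElt (-dag h⁻¹ σ) h⁻¹ := by
      rw [inv_eq_iff_mul_eq_one, parabolicElt_mul, ← dagLinear_apply, map_neg, dagLinear_apply,
        ← dag_mul, mul_inv_cancel, dag_one, add_neg_cancel, parabolicElt_zero_one]
    rw [this, parabolicElt_mem_semidirectSet]
    exact ⟨S.neg_mem (hinv _ (H.inv_mem hh) _ hσ), H.inv_mem hh⟩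

/-- The vector part of a group `Σ ⋊ H` is invariant. -/
theorem dag_mem_of_semidirectSet {S : Submodule ℝ (Matrix (Fin d) (Fin d) ℝ)}
    {H : Subgroup (GL (Fin d) ℝ)} {G : Subgroup (GL (Fin d ⊕ Fin d) ℝ)}
    (hG : (G : Set (GL (Fin d ⊕ Fin d) ℝ)) = semidirectSet S (matSet H)) :
    ∀ h ∈ H, ∀ σ ∈ S, dag h σ ∈ S := by
  intro h hh σ hσ
  have hm : ∀ {x}, x ∈ G ↔ x ∈ semidirectSet (S : Set (Matrix (Fin d) (Fin d) ℝ)) (matSet H) :=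
    fun {x} => by rw [← hG]; rfl
  have h1 : glEmb h ∈ G := hm.2 (parabolicElt_mem_semidirectSet.2 ⟨S.zero_mem, hh⟩)
  have h2 : parabolicElt σ 1 ∈ G := hm.2 (parabolicElt_mem_semidirectSet.2 ⟨hσ, H.one_mem⟩)
  have h3 := G.mul_mem (G.mul_mem h1 h2) (G.inv_mem h1)
  rw [glEmb_conj] at h3
  exact (parabolicElt_mem_semidirectSet.1 (hm.1 h3)).1

/-- The embedding `(X, σ) ↦ [X, 0; σ, -ᵗX]` of Lie algebras. -/
def blockLinear (d : ℕ) : (Matrix (Fin d) (Fin d) ℝ × Matrix (Fin d) (Fin d) ℝ) →ₗ[ℝ]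
    Matrix (Fin d ⊕ Fin d) (Fin d ⊕ Fin d) ℝ where
  toFun p := fromBlocks p.1 0 p.2 (-p.1ᵀ)
  map_add' p q := by
    rw [fromBlocks_add]
    simp [add_comm]
  map_smul' c p := by
    rw [fromBlocks_smul]
    simp

theorem blockLinear_injective : Function.Injective (blockLinear d) := by
  rintro ⟨X, σ⟩ ⟨X', σ'⟩ h
  have := fromBlocks_inj.1 h
  exact Prod.ext this.1 this.2.2.1

theorem HasEntryDeriv.fromBlocks {k l m n : Type*} {A : ℝ → Matrix k m ℝ} {B : ℝ → Matrix k n ℝ}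
    {C : ℝ → Matrix l m ℝ} {D : ℝ → Matrix l n ℝ} {A' : Matrix k m ℝ} {B' : Matrix k n ℝ}
    {C' : Matrix l m ℝ} {D' : Matrix l n ℝ} {t : ℝ} (hA : HasEntryDeriv A A' t)
    (hB : HasEntryDeriv B B' t) (hC : HasEntryDeriv C C' t) (hD : HasEntryDeriv D D' t) :
    HasEntryDeriv (fun s => Matrix.fromBlocks (A s) (B s) (C s) (D s))
      (Matrix.fromBlocks A' B' C' D') t := by
  rintro (i | i) (j | j)
  exacts [hA i j, hB i j, hC i j, hD i j]

theorem exp_smul_neg_transpose (t : ℝ) (X : Matrix (Fin d) (Fin d) ℝ) :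
    NormedSpace.exp (t • -Xᵀ) = (NormedSpace.exp (-(t • X)))ᵀ := by
  rw [← Matrix.exp_transpose, Matrix.transpose_neg, Matrix.transpose_smul, smul_neg]

theorem coe_inv_expGL {n : Type*} [Fintype n] [DecidableEq n] (X : Matrix n n ℝ) :
    (((expGL X)⁻¹ : GL n ℝ) : Matrix n n ℝ) = NormedSpace.exp (-X) := rfl

/-- The block matrix has square zero, so its one-parameter group is affine in `t`. -/
theorem expGL_blockLinear_zero_left (σ : Matrix (Fin d) (Fin d) ℝ) :
    expGL (blockLinear d (0, σ)) = parabolicElt σ 1 := by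
  apply Units.ext
  have := exp_eq_of_hasEntryDeriv (X := blockLinear d (0, σ))
    (f := fun t => Matrix.fromBlocks 1 0 (t • σ) 1) ?_ (by simp) 1
  · rw [one_smul] at this
    rw [coe_expGL, this, coe_parabolicElt]
    simp
  · intro t
    have hσ : HasEntryDeriv (fun s => s • σ) σ t := fun i j => by
      simpa using (hasDerivAt_id t).mul_const (σ i j)
    have := HasEntryDeriv.fromBlocks (hasEntryDeriv_const (1 : Matrix (Fin d) (Fin d) ℝ) t)
      (hasEntryDeriv_const (0 : Matrix (Fin d) (Fin d) ℝ) t) hσ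
      (hasEntryDeriv_const (1 : Matrix (Fin d) (Fin d) ℝ) t)
    convert this using 1
    simp [blockLinear, fromBlocks_multiply]

theorem expGL_blockLinear_zero_right (X : Matrix (Fin d) (Fin d) ℝ) :
    expGL (blockLinear d (X, 0)) = glEmb (expGL X) := by
  apply Units.ext
  have := exp_eq_of_hasEntryDeriv (X := blockLinear d (X, 0))
    (f := fun t => Matrix.fromBlocks (NormedSpace.exp (t • X)) 0 0 (NormedSpace.exp (t • -Xᵀ)))
    ?_ (by simp [NormedSpace.exp_zero]) 1
  · rw [one_smul, exp_smul_neg_transpose, one_smul] at this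
    rw [coe_expGL, this, glEmb, coe_parabolicElt, coe_inv_expGL]
    simp
  · intro t
    have := HasEntryDeriv.fromBlocks (hasEntryDeriv_exp X t)
      (hasEntryDeriv_const (0 : Matrix (Fin d) (Fin d) ℝ) t)
      (hasEntryDeriv_const (0 : Matrix (Fin d) (Fin d) ℝ) t)
      (hasEntryDeriv_exp (-Xᵀ) t)
    convert this using 1
    simp [blockLinear, fromBlocks_multiply]

variable {S : Submodule ℝ (Matrix (Fin d) (Fin d) ℝ)} {H : Subgroup (GL (Fin d) ℝ)}
  (hinv : ∀ h ∈ H, ∀ σ ∈ S, dag h σ ∈ S)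

theorem mem_semidirect {x : GL (Fin d ⊕ Fin d) ℝ} :
    x ∈ semidirect S H hinv ↔ ∃ σ ∈ S, ∃ h ∈ H, x = parabolicElt σ h := by
  constructor
  · rintro ⟨σ, hσ, h, hh, rfl⟩
    exact ⟨σ, hσ, h, coe_mem_matSet.1 hh, rfl⟩
  · rintro ⟨σ, hσ, h, hh, rfl⟩
    exact ⟨σ, hσ, h, coe_mem_matSet.2 hh, rfl⟩

/-- The equation `M' = M Y` is read block by block along `M = exp (tY)`. The diagonal blocks are
one-parameter groups, inverse transposes of each other, and the vector component is a curve in `S`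
whose velocity at `0` is the lower left block of `Y`. -/
theorem lieAlg_semidirect_subset {Y : Matrix (Fin d ⊕ Fin d) (Fin d ⊕ Fin d) ℝ}
    (hY : Y ∈ lieAlg (semidirect S H hinv)) :
    ∃ X ∈ lieAlg H, ∃ σ ∈ S, blockLinear d (X, σ) = Y := by
  have hY' : ∀ t : ℝ, ∃ σ ∈ S, ∃ h ∈ H, NormedSpace.exp (t • Y) = Matrix.fromBlocks
      (h : Matrix (Fin d) (Fin d) ℝ) 0 (σ * (h : Matrix (Fin d) (Fin d) ℝ))
        ((h⁻¹ : GL (Fin d) ℝ) : Matrix (Fin d) (Fin d) ℝ)ᵀ := by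
    intro t
    obtain ⟨σ, hσ, h, hh, e⟩ := (mem_semidirect hinv).1 (mem_lieAlg.1 hY t)
    exact ⟨σ, hσ, h, hh, congrArg Units.val e⟩
  choose σ hσ h hh he using hY'
  obtain ⟨A, B, C, D, rfl⟩ : ∃ A B C D, Y = Matrix.fromBlocks A B C D :=
    ⟨_, _, _, _, (fromBlocks_toBlocks Y).symm⟩
  have hd := hasEntryDeriv_exp (Matrix.fromBlocks A B C D)
  simp only [he, fromBlocks_multiply] at hd
  have h0 := he 0
  rw [zero_smul, NormedSpace.exp_zero, ← fromBlocks_one, fromBlocks_inj] at h0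
  obtain ⟨h1, -, h3, h4⟩ := h0
  have d11 : ∀ t, HasEntryDeriv (fun s => (h s : Matrix (Fin d) (Fin d) ℝ))
      (h t * A + 0 * C) t := fun t i j => hd t (.inl i) (.inl j)
  have d12 : ∀ t, HasEntryDeriv (fun _ => (0 : Matrix (Fin d) (Fin d) ℝ))
      (h t * B + 0 * D) t := fun t i j => hd t (.inl i) (.inr j)
  have d21 : ∀ t, HasEntryDeriv (fun s => σ s * (h s : Matrix (Fin d) (Fin d) ℝ))
      (σ t * (h t : Matrix (Fin d) (Fin d) ℝ) * A +
        (((h t)⁻¹ : GL (Fin d) ℝ) : Matrix (Fin d) (Fin d) ℝ)ᵀ * C) t :=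
    fun t i j => hd t (.inr i) (.inl j)
  have d22 : ∀ t, HasEntryDeriv
      (fun s => (((h s)⁻¹ : GL (Fin d) ℝ) : Matrix (Fin d) (Fin d) ℝ)ᵀ)
      (σ t * (h t : Matrix (Fin d) (Fin d) ℝ) * B +
        (((h t)⁻¹ : GL (Fin d) ℝ) : Matrix (Fin d) (Fin d) ℝ)ᵀ * D) t :=
    fun t i j => hd t (.inr i) (.inr j)
  -- The upper right block vanishes identically, and its velocity at `0` is `B`.
  obtain rfl : B = 0 := by
    have := (d12 0).unique (hasEntryDeriv_const 0 0)
    rwa [← h1, Matrix.one_mul, Matrix.zero_mul, add_zero] at this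
  have e11 : ∀ t, NormedSpace.exp (t • A) = h t :=
    exp_eq_of_hasEntryDeriv (fun t => by simpa only [Matrix.zero_mul, add_zero] using d11 t) h1.symm
  have e11' : ∀ t, expGL (t • A) = h t := fun t => Units.ext (e11 t)
  have e22 : ∀ t, NormedSpace.exp (t • D) =
      (((h t)⁻¹ : GL (Fin d) ℝ) : Matrix (Fin d) (Fin d) ℝ)ᵀ :=
    exp_eq_of_hasEntryDeriv (fun t => by simpa only [Matrix.mul_zero, zero_add] using d22 t) h4.symm
  obtain rfl : D = -Aᵀ := eq_of_forall_exp_smul_eq fun t => by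
    rw [e22, ← e11', coe_inv_expGL, exp_smul_neg_transpose]
  refine ⟨A, mem_lieAlg.2 fun t => by rw [e11']; exact hh t, C, ?_, rfl⟩
  -- Multiplying the lower left block `σ s * h s` by `exp (-(s A)) = (h s)⁻¹` isolates `σ s`; the
  -- derivative of this product at `0` is `C`.
  have dσ := (d21 0).mul (hasEntryDeriv_exp_neg A 0)
  rw [← h3, ← h4] at dσ
  simp only [zero_smul, neg_zero, NormedSpace.exp_zero, Matrix.zero_mul, Matrix.one_mul,
    Matrix.mul_one, zero_add, add_zero] at dσ
  refine dσ.mem fun s => ?_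
  rw [← e11, Matrix.mul_assoc, exp_mul_exp_neg, Matrix.mul_one]
  exact hσ s

/-- The off-diagonal part of the exponential needs no formula. Only its differential equation is
used, to show that the vector component moves inside `S`. -/
theorem blockLinear_mem_lieAlg {X σ : Matrix (Fin d) (Fin d) ℝ} (hX : X ∈ lieAlg H)
    (hσ : σ ∈ S) : blockLinear d (X, σ) ∈ lieAlg (semidirect S H hinv) := by
  set Y := blockLinear d (X, σ) with hYdef
  have hY : Y = Matrix.fromBlocks X 0 σ (-Xᵀ) := rfl
  set P : ℝ → Matrix (Fin d) (Fin d) ℝ := fun t => (NormedSpace.exp (t • Y)).toBlocks₁₁ with hP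
  set N : ℝ → Matrix (Fin d) (Fin d) ℝ := fun t => (NormedSpace.exp (t • Y)).toBlocks₁₂ with hN
  set R : ℝ → Matrix (Fin d) (Fin d) ℝ := fun t => (NormedSpace.exp (t • Y)).toBlocks₂₁ with hR
  set U : ℝ → Matrix (Fin d) (Fin d) ℝ := fun t => (NormedSpace.exp (t • Y)).toBlocks₂₂ with hU
  have hM : ∀ t, NormedSpace.exp (t • Y) = Matrix.fromBlocks (P t) (N t) (R t) (U t) :=
    fun t => (fromBlocks_toBlocks _).symm
  have hd := hasEntryDeriv_exp Y
  simp only [hM] at hd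
  simp only [hY, fromBlocks_multiply, Matrix.mul_zero, zero_add] at hd
  have h0 := hM 0
  rw [zero_smul, NormedSpace.exp_zero, ← fromBlocks_one, fromBlocks_inj] at h0
  obtain ⟨h1, h2, h3, h4⟩ := h0
  have d12 : ∀ t, HasEntryDeriv N (N t * -Xᵀ) t := fun t i j => hd t (.inl i) (.inr j)
  -- The upper right block solves a linear homogeneous equation with zero initial value.
  have eN : ∀ t, N t = 0 := fun t => by
    rw [eq_mul_exp_of_hasEntryDeriv d12 t, ← h2, Matrix.zero_mul]
  simp only [eN, Matrix.zero_mul, add_zero] at hd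
  have d11 : ∀ t, HasEntryDeriv P (P t * X) t := fun t i j => hd t (.inl i) (.inl j)
  have d21 : ∀ t, HasEntryDeriv R (R t * X + U t * σ) t := fun t i j => hd t (.inr i) (.inl j)
  have d22 : ∀ t, HasEntryDeriv U (U t * -Xᵀ) t := fun t i j => hd t (.inr i) (.inr j)
  have e11 := exp_eq_of_hasEntryDeriv d11 h1.symm
  have e22 := exp_eq_of_hasEntryDeriv d22 h4.symm
  -- This is the vector component of `exp (tY)`. It starts at `0`, and its velocity `U t * σ * exp
  -- (-(tX))` is `(exp (tX))† σ`, an element of `S` by invariance.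
  have hτ : ∀ t, R t * NormedSpace.exp (-(t • X)) ∈ S := by
    refine mem_of_forall_hasEntryDeriv (fun t => (d21 t).mul (hasEntryDeriv_exp_neg X t)) ?_ ?_
    · simp only [← h3, Matrix.zero_mul, S.zero_mem]
    · intro t
      have := hinv _ (mem_lieAlg.1 hX t) _ hσ
      rw [dag, coe_inv_expGL, ← exp_smul_neg_transpose, e22] at this
      convert this using 1
      rw [Matrix.mul_neg, Matrix.add_mul, Matrix.mul_assoc (R t) X]
      abel
  rw [mem_lieAlg]
  intro t
  refine (mem_semidirect hinv).2 ⟨_, hτ t, _, mem_lieAlg.1 hX t, Units.ext ?_⟩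
  rw [coe_expGL, hM, coe_parabolicElt, coe_inv_expGL, coe_expGL, ← exp_smul_neg_transpose,
    Matrix.mul_assoc, exp_neg_mul_exp, Matrix.mul_one, e11, e22, eN]

/-- Infinitesimal invariance of the vector part. -/
theorem transpose_mul_add_mul_mem {S : Submodule ℝ (Matrix (Fin d) (Fin d) ℝ)}
    {H : Subgroup (GL (Fin d) ℝ)} (hinv : ∀ h ∈ H, ∀ σ ∈ S, dag h σ ∈ S)
    {X σ : Matrix (Fin d) (Fin d) ℝ} (hX : X ∈ lieAlg H) (hσ : σ ∈ S) :
    Xᵀ * σ + σ * X ∈ S := by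
  -- The curve is `(exp (tX))† σ`, which stays in `S`; the inverses in `†` produce the sign.
  have h1 : HasEntryDeriv (fun t : ℝ => (NormedSpace.exp (-(t • X)))ᵀ * σ *
      NormedSpace.exp (-(t • X))) (-(Xᵀ * σ + σ * X)) 0 := by
    convert ((hasEntryDeriv_exp_neg X 0).transpose.mul (hasEntryDeriv_const σ 0)).mul
      (hasEntryDeriv_exp_neg X 0) using 1
    simp [NormedSpace.exp_zero, add_comm]
  exact (Submodule.neg_mem_iff _).1 (h1.mem fun t => hinv _ (mem_lieAlg.1 hX t) σ hσ)

/-- `Σ ⋊ H` is generated by exponentials. -/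
theorem isExpGenerated_semidirect (hH : IsExpGenerated H) :
    IsExpGenerated (semidirect S H hinv) := by
  intro x hx
  obtain ⟨σ, hσ, h, hh, rfl⟩ := (mem_semidirect hinv).1 hx
  have h0 : (0 : Matrix (Fin d) (Fin d) ℝ) ∈ lieAlg H :=
    mem_lieAlg.2 fun t => by
      rw [smul_zero, show expGL 0 = 1 from Units.ext NormedSpace.exp_zero]
      exact H.one_mem
  obtain ⟨L, hL, e⟩ := hH h hh
  -- The list mirrors the factorisation `(σ, h) = (σ, 1)(0, h)`: one exponential for the vector,
  -- followed by those generating `h`.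
  refine ⟨blockLinear d (0, σ) :: L.map fun X => blockLinear d (X, 0), ?_, ?_⟩
  · intro Y hY
    rcases List.mem_cons.1 hY with rfl | hY
    · exact blockLinear_mem_lieAlg hinv h0 hσ
    · obtain ⟨X, hX, rfl⟩ := List.mem_map.1 hY
      exact blockLinear_mem_lieAlg hinv (hL X hX) S.zero_mem
  · rw [← coe_prod_expGL] at e ⊢
    congr 1
    rw [List.map_cons, List.prod_cons, expGL_blockLinear_zero_left, Units.ext e, List.map_map]
    have : ∀ L : List (Matrix (Fin d) (Fin d) ℝ),
        (L.map (expGL ∘ fun X => blockLinear d (X, 0))).prod = glEmb (L.map expGL).prod := by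
      intro L
      induction L with
      | nil => exact (parabolicElt_zero_one d).symm
      | cons X L ih =>
        rw [List.map_cons, List.prod_cons, ih, List.map_cons, List.prod_cons, glEmb_mul,
          Function.comp_apply, expGL_blockLinear_zero_right]
    rw [this, glEmb, parabolicElt_mul, dag_zero, add_zero, one_mul]

theorem lieAlg_semidirect {A : Submodule ℝ (Matrix (Fin d) (Fin d) ℝ)}
    (hA : (A : Set (Matrix (Fin d) (Fin d) ℝ)) = lieAlg H) :
    (((A.prod S).map (blockLinear d) : Submodule ℝ _) : Set _) =
      lieAlg (semidirect S H hinv) := by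
  ext Y
  constructor
  · rintro ⟨⟨X, σ⟩, ⟨hX, hσ⟩, rfl⟩
    exact blockLinear_mem_lieAlg hinv (hA ▸ hX) hσ
  · intro hY
    obtain ⟨X, hX, σ, hσ, rfl⟩ := lieAlg_semidirect_subset hinv hY
    exact ⟨(X, σ), ⟨by rw [hA]; exact hX, hσ⟩, rfl⟩

theorem isConnectedLieSubgroup_semidirect (hH : IsConnectedLieSubgroup H) :
    IsConnectedLieSubgroup (semidirect S H hinv) := by
  obtain ⟨⟨A, hA, hbr⟩, hgen⟩ := hH
  have hA' : ∀ {X}, X ∈ A ↔ X ∈ lieAlg H := fun {X} => by rw [← hA]; rfl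
  refine ⟨⟨_, lieAlg_semidirect hinv hA, ?_⟩, isExpGenerated_semidirect hinv hgen⟩
  rintro _ ⟨⟨X, σ⟩, ⟨hX, hσ⟩, rfl⟩ _ ⟨⟨X', σ'⟩, ⟨hX', hσ'⟩, rfl⟩
  -- The lower left block of the commutator is the difference of the infinitesimal actions of `X'`
  -- on `σ` and of `X` on `σ'`, each of which preserves `S`.
  refine ⟨(X * X' - X' * X, (X'ᵀ * σ + σ * X') - (Xᵀ * σ' + σ' * X)), ⟨hbr X hX X' hX',
    S.sub_mem (transpose_mul_add_mul_mem hinv (hA'.1 hX') hσ)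
      (transpose_mul_add_mul_mem hinv (hA'.1 hX) hσ')⟩, ?_⟩
  simp only [blockLinear, LinearMap.coe_mk, AddHom.coe_mk, fromBlocks_multiply, sub_eq_add_neg,
    fromBlocks_neg, fromBlocks_add]
  congr 1
  · simp
  · simp
  · simp only [Matrix.neg_mul, neg_add]
    abel
  · simp

theorem finrank_submodule_prod {V W : Type*} [AddCommGroup V] [Module ℝ V] [FiniteDimensional ℝ V]
    [AddCommGroup W] [Module ℝ W] [FiniteDimensional ℝ W] (p : Submodule ℝ V)
    (q : Submodule ℝ W) :
    Module.finrank ℝ (p.prod q) = Module.finrank ℝ p + Module.finrank ℝ q := by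
  have h : p.prod q = LinearMap.range (p.subtype.prodMap q.subtype) := by
    rw [LinearMap.range_prodMap, Submodule.range_subtype, Submodule.range_subtype]
  rw [h, LinearMap.finrank_range_of_inj, Module.finrank_prod]
  exact Function.Injective.prodMap p.injective_subtype q.injective_subtype

theorem finrank_map_of_injective {V W : Type*} [AddCommGroup V] [Module ℝ V]
    [AddCommGroup W] [Module ℝ W] {f : V →ₗ[ℝ] W} (hf : Function.Injective f)
    (p : Submodule ℝ V) : Module.finrank ℝ (p.map f) = Module.finrank ℝ p :=
  (Submodule.equivMapOfInjective f hf p).finrank_eq.symm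

theorem lieDim_semidirect {A : Submodule ℝ (Matrix (Fin d) (Fin d) ℝ)}
    (hA : (A : Set (Matrix (Fin d) (Fin d) ℝ)) = lieAlg H) :
    lieDim (semidirect S H hinv) = Module.finrank ℝ S + Module.finrank ℝ A := by
  rw [lieDim, ← lieAlg_semidirect hinv hA, Submodule.span_eq,
    finrank_map_of_injective blockLinear_injective, finrank_submodule_prod, add_comm]

end Semidirect

/-! ### Explicit linear groups and their Lie algebras -/

section LieModels

open Matrix

/-- `K` is the set of matrices of a connected Lie group with Lie algebra `A`. -/
structure IsLieModel {n : Type*} [Fintype n] [DecidableEq n] (K : Set (Matrix n n ℝ))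
    (A : Submodule ℝ (Matrix n n ℝ)) : Prop where
  one_mem : 1 ∈ K
  mul_mem : ∀ M ∈ K, ∀ N ∈ K, M * N ∈ K
  mem_iff : ∀ X, X ∈ A ↔ ∀ t : ℝ, NormedSpace.exp (t • X) ∈ K
  bracket_mem : ∀ X ∈ A, ∀ Y ∈ A, X * Y - Y * X ∈ A
  exists_list : ∀ M ∈ K, ∃ L : List (Matrix n n ℝ), (∀ X ∈ L, X ∈ A) ∧
    M = (L.map NormedSpace.exp).prod

theorem IsLieModel.exp_mem {n : Type*} [Fintype n] [DecidableEq n] {K : Set (Matrix n n ℝ)}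
    {A : Submodule ℝ (Matrix n n ℝ)} (h : IsLieModel K A) {X : Matrix n n ℝ} (hX : X ∈ A) :
    NormedSpace.exp X ∈ K := by
  simpa using (h.mem_iff X).1 hX 1

/-- Inverses are not among the axioms of a model. They come for free, since a product of
exponentials is inverted by reversing it and negating the generators. -/
theorem IsLieModel.exists_subgroup {d : ℕ} {K : Set (Matrix (Fin d) (Fin d) ℝ)}
    {A : Submodule ℝ (Matrix (Fin d) (Fin d) ℝ)} (h : IsLieModel K A) :
    ∃ H : Subgroup (GL (Fin d) ℝ), matSet H = K ∧
      (A : Set (Matrix (Fin d) (Fin d) ℝ)) = lieAlg H ∧ IsConnectedLieSubgroup H := by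
  have hinv : ∀ L : List (Matrix (Fin d) (Fin d) ℝ), (∀ X ∈ L, X ∈ A) →
      (((L.map expGL).prod⁻¹ : GL (Fin d) ℝ) : Matrix (Fin d) (Fin d) ℝ) ∈ K := by
    intro L
    induction L with
    | nil => intro _; simpa using h.one_mem
    | cons X L ih =>
      intro hL
      rw [List.map_cons, List.prod_cons, _root_.mul_inv_rev, Units.val_mul, coe_inv_expGL]
      exact h.mul_mem _ (ih fun Y hY => hL Y (List.mem_cons_of_mem _ hY)) _
        (h.exp_mem (A.neg_mem (hL X List.mem_cons_self)))
  let H : Subgroup (GL (Fin d) ℝ) :=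
    { carrier := {g | (g : Matrix (Fin d) (Fin d) ℝ) ∈ K}
      mul_mem' := fun {a b} ha hb => h.mul_mem _ ha _ hb
      one_mem' := h.one_mem
      inv_mem' := fun {x} hx => by
        obtain ⟨L, hL, e⟩ := h.exists_list _ hx
        rw [← coe_prod_expGL] at e
        rw [Units.ext e]
        exact hinv L hL }
  have hlie : (A : Set (Matrix (Fin d) (Fin d) ℝ)) = lieAlg H := by
    ext X
    rw [SetLike.mem_coe, h.mem_iff, mem_lieAlg]
    rfl
  refine ⟨H, ?_, hlie, ⟨A, hlie, h.bracket_mem⟩, ?_⟩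
  · ext M
    constructor
    · rintro ⟨g, hg, rfl⟩
      exact hg
    · intro hM
      obtain ⟨L, -, e⟩ := h.exists_list _ hM
      rw [← coe_prod_expGL] at e
      exact ⟨(L.map expGL).prod, show _ ∈ K by rwa [← e], e.symm⟩
  · intro g hg
    rw [← hlie]
    exact h.exists_list _ hg

/-- The exponential image of a commutative Lie algebra. -/
theorem isLieModel_of_commute {n : Type*} [Fintype n] [DecidableEq n] {K : Set (Matrix n n ℝ)}
    {A : Submodule ℝ (Matrix n n ℝ)} (hK : K = NormedSpace.exp '' A)
    (hcomm : ∀ X ∈ A, ∀ Y ∈ A, X * Y = Y * X)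
    (hmem : ∀ X, (∀ t : ℝ, NormedSpace.exp (t • X) ∈ K) → X ∈ A) : IsLieModel K A := by
  subst hK
  refine ⟨⟨0, A.zero_mem, NormedSpace.exp_zero⟩, ?_,
    fun X => ⟨fun h t => ⟨_, A.smul_mem t h, rfl⟩, hmem X⟩, ?_, ?_⟩
  · rintro _ ⟨X, hX, rfl⟩ _ ⟨Y, hY, rfl⟩
    exact ⟨X + Y, A.add_mem hX hY, Matrix.exp_add_of_commute _ _ (hcomm X hX Y hY)⟩
  · intro X hX Y hY
    rw [hcomm X hX Y hY, sub_self]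
    exact A.zero_mem
  · rintro _ ⟨X, hX, rfl⟩
    exact ⟨[X], by simpa using hX, by simp⟩

/-- A one-parameter group is a model of the line spanned by its generator once all the
one-parameter groups it contains are reparametrizations of it. -/
theorem isLieModel_span_singleton {n : Type*} [Fintype n] [DecidableEq n] {K : Set (Matrix n n ℝ)}
    {X : Matrix n n ℝ} (hK : K = {M | ∃ t : ℝ, M = NormedSpace.exp (t • X)})
    (hmem : ∀ Y, (∀ t : ℝ, NormedSpace.exp (t • Y) ∈ K) →
      ∃ c : ℝ, ∀ t : ℝ, NormedSpace.exp (t • Y) = NormedSpace.exp ((t * c) • X)) :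
    IsLieModel K (ℝ ∙ X) := by
  refine isLieModel_of_commute ?_ ?_ ?_
  · rw [hK]
    ext M
    constructor
    · rintro ⟨t, rfl⟩
      exact ⟨_, Submodule.mem_span_singleton.2 ⟨t, rfl⟩, rfl⟩
    · rintro ⟨_, hY, rfl⟩
      obtain ⟨t, rfl⟩ := Submodule.mem_span_singleton.1 hY
      exact ⟨t, rfl⟩
  · intro Y hY Z hZ
    obtain ⟨t, rfl⟩ := Submodule.mem_span_singleton.1 hY
    obtain ⟨s, rfl⟩ := Submodule.mem_span_singleton.1 hZ
    simp [smul_smul, mul_comm]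
  · intro Y hY
    obtain ⟨c, hc⟩ := hmem Y hY
    rw [eq_of_forall_exp_smul_eq (X := Y) (Y := c • X) fun t => by rw [hc, smul_smul]]
    exact Submodule.mem_span_singleton.2 ⟨c, rfl⟩

/-- Transposition as a linear map. -/
def transposeLinear : Matrix (Fin 2) (Fin 2) ℝ →ₗ[ℝ] Matrix (Fin 2) (Fin 2) ℝ where
  toFun := Matrix.transpose
  map_add' := Matrix.transpose_add
  map_smul' := Matrix.transpose_smul

@[simp] theorem mem_comap_transposeLinear {A : Submodule ℝ (Matrix (Fin 2) (Fin 2) ℝ)}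
    {X : Matrix (Fin 2) (Fin 2) ℝ} : X ∈ A.comap transposeLinear ↔ Xᵀ ∈ A := Iff.rfl

/-- Transposition reverses products and commutes with the exponential, so the lower triangular
groups follow from the upper triangular ones. -/
theorem IsLieModel.transpose {K : Set (Matrix (Fin 2) (Fin 2) ℝ)}
    {A : Submodule ℝ (Matrix (Fin 2) (Fin 2) ℝ)} (h : IsLieModel K A) :
    IsLieModel {M | Mᵀ ∈ K} (A.comap transposeLinear) := by
  refine ⟨by simpa using h.one_mem, ?_, ?_, ?_, ?_⟩
  · intro M hM N hN
    rw [Set.mem_ofPred_eq, Matrix.transpose_mul]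
    exact h.mul_mem _ hN _ hM
  · intro X
    rw [mem_comap_transposeLinear, h.mem_iff]
    refine forall_congr' fun t => ?_
    rw [Set.mem_ofPred_eq, ← Matrix.exp_transpose, Matrix.transpose_smul]
  · intro X hX Y hY
    rw [mem_comap_transposeLinear, Matrix.transpose_sub, Matrix.transpose_mul,
      Matrix.transpose_mul]
    exact h.bracket_mem _ hY _ hX
  · intro M hM
    obtain ⟨L, hL, e⟩ := h.exists_list _ hM
    refine ⟨(L.map Matrix.transpose).reverse, ?_, ?_⟩
    · intro X hX
      obtain ⟨Y, hY, rfl⟩ := List.mem_map.1 (List.mem_reverse.1 hX)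
      rw [mem_comap_transposeLinear, Matrix.transpose_transpose]
      exact hL Y hY
    · rw [← Matrix.transpose_transpose M, e, Matrix.transpose_list_prod, List.map_map,
        List.map_reverse, List.map_map]
      congr 2
      refine List.map_congr_left fun X _ => ?_
      exact (Matrix.exp_transpose X).symm

theorem HasEntryDeriv.of_two {f : ℝ → Matrix (Fin 2) (Fin 2) ℝ} {f' : Matrix (Fin 2) (Fin 2) ℝ}
    {t : ℝ} (h00 : HasDerivAt (fun s => f s 0 0) (f' 0 0) t)
    (h01 : HasDerivAt (fun s => f s 0 1) (f' 0 1) t)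
    (h10 : HasDerivAt (fun s => f s 1 0) (f' 1 0) t)
    (h11 : HasDerivAt (fun s => f s 1 1) (f' 1 1) t) : HasEntryDeriv f f' t := by
  intro i j
  fin_cases i <;> fin_cases j
  exacts [h00, h01, h10, h11]

/-- `(a, b) ↦ diag(a, b)` -/
def diagLinear : ℝ × ℝ →ₗ[ℝ] Matrix (Fin 2) (Fin 2) ℝ where
  toFun w := !![w.1, 0; 0, w.2]
  map_add' _ _ := by ext i j; fin_cases i <;> fin_cases j <;> simp
  map_smul' _ _ := by ext i j; fin_cases i <;> fin_cases j <;> simp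

/-- `(a, b) ↦ a I + b J`, `J` the infinitesimal rotation. -/
def confLinear : ℝ × ℝ →ₗ[ℝ] Matrix (Fin 2) (Fin 2) ℝ where
  toFun w := !![w.1, -w.2; w.2, w.1]
  map_add' _ _ := by ext i j; fin_cases i <;> fin_cases j <;> simp [add_comm]
  map_smul' _ _ := by ext i j; fin_cases i <;> fin_cases j <;> simp

/-- `((a, b), r) ↦ [a, r; 0, b]` -/
def upperLinear : (ℝ × ℝ) × ℝ →ₗ[ℝ] Matrix (Fin 2) (Fin 2) ℝ where
  toFun w := !![w.1.1, w.2; 0, w.1.2]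
  map_add' _ _ := by ext i j; fin_cases i <;> fin_cases j <;> simp
  map_smul' _ _ := by ext i j; fin_cases i <;> fin_cases j <;> simp

theorem diagLinear_injective : Function.Injective diagLinear := by
  rintro ⟨a, b⟩ ⟨a', b'⟩ h
  have h0 := congrFun (congrFun h 0) 0
  have h1 := congrFun (congrFun h 1) 1
  simp [diagLinear] at h0 h1
  rw [h0, h1]

theorem confLinear_injective : Function.Injective confLinear := by
  rintro ⟨a, b⟩ ⟨a', b'⟩ h
  have h0 := congrFun (congrFun h 0) 0
  have h1 := congrFun (congrFun h 1) 0
  simp [confLinear] at h0 h1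
  rw [h0, h1]

theorem upperLinear_injective : Function.Injective upperLinear := by
  rintro ⟨⟨a, b⟩, r⟩ ⟨⟨a', b'⟩, r'⟩ h
  have h0 := congrFun (congrFun h 0) 0
  have h1 := congrFun (congrFun h 1) 1
  have h2 := congrFun (congrFun h 0) 1
  simp [upperLinear] at h0 h1 h2
  rw [h0, h1, h2]

theorem exp_smul_diagLinear (t a b : ℝ) : NormedSpace.exp (t • diagLinear (a, b)) =
    !![Real.exp (t * a), 0; 0, Real.exp (t * b)] := by
  refine exp_eq_of_hasEntryDeriv (f := fun t => !![Real.exp (t * a), 0; 0, Real.exp (t * b)])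
    (fun t => ?_) (by simp [Matrix.one_fin_two]) t
  have hexp : ∀ a : ℝ, HasDerivAt (fun s : ℝ => Real.exp (s * a)) (Real.exp (t * a) * a) t :=
    fun a => by simpa using ((hasDerivAt_id t).mul_const a).exp
  apply HasEntryDeriv.of_two
  · simpa [diagLinear, Matrix.mul_apply] using hexp a
  · simpa [diagLinear, Matrix.mul_apply] using hasDerivAt_const t (0 : ℝ)
  · simpa [diagLinear, Matrix.mul_apply] using hasDerivAt_const t (0 : ℝ)
  · simpa [diagLinear, Matrix.mul_apply] using hexp b

theorem exp_smul_confLinear (t a b : ℝ) : NormedSpace.exp (t • confLinear (a, b)) =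
    Real.exp (t * a) • rot (t * b) := by
  refine exp_eq_of_hasEntryDeriv (f := fun t => Real.exp (t * a) • rot (t * b))
    (fun t => ?_) (by simp [Matrix.one_fin_two, rot]) t
  have hexp : HasDerivAt (fun s : ℝ => Real.exp (s * a)) (Real.exp (t * a) * a) t := by
    simpa using ((hasDerivAt_id t).mul_const a).exp
  have hcos : HasDerivAt (fun s : ℝ => Real.cos (s * b)) (-Real.sin (t * b) * b) t := by
    simpa using ((hasDerivAt_id t).mul_const b).cos
  have hsin : HasDerivAt (fun s : ℝ => Real.sin (s * b)) (Real.cos (t * b) * b) t := by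
    simpa using ((hasDerivAt_id t).mul_const b).sin
  apply HasEntryDeriv.of_two
  · exact (hexp.mul hcos).congr_deriv (by simp [confLinear, rot, Matrix.mul_apply]; ring)
  · exact (hexp.mul hsin.neg).congr_deriv (by simp [confLinear, rot, Matrix.mul_apply]; ring)
  · exact (hexp.mul hsin).congr_deriv (by simp [confLinear, rot, Matrix.mul_apply]; ring)
  · exact (hexp.mul hcos).congr_deriv (by simp [confLinear, rot, Matrix.mul_apply]; ring)

theorem exp_smul_upperLinear_self (t a r : ℝ) : NormedSpace.exp (t • upperLinear ((a, a), r)) =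
    Real.exp (t * a) • !![1, t * r; 0, 1] := by
  refine exp_eq_of_hasEntryDeriv (f := fun t => Real.exp (t * a) • !![1, t * r; 0, 1])
    (fun t => ?_) (by simp [Matrix.one_fin_two]) t
  have hexp : HasDerivAt (fun s : ℝ => Real.exp (s * a)) (Real.exp (t * a) * a) t := by
    simpa using ((hasDerivAt_id t).mul_const a).exp
  have hlin : HasDerivAt (fun s : ℝ => s * r) r t := by
    simpa using (hasDerivAt_id t).mul_const r
  apply HasEntryDeriv.of_two
  · simpa [upperLinear, Matrix.mul_apply] using hexp
  · exact (hexp.mul hlin).congr_deriv (by simp [upperLinear, Matrix.mul_apply]; ring)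
  · simpa [upperLinear, Matrix.mul_apply] using hasDerivAt_const t (0 : ℝ)
  · simpa [upperLinear, Matrix.mul_apply] using hexp

/-- The corner is `r` times the divided difference of the exponential at `a, b`, which degenerates
to `r e^a` when `a = b`; hence the two cases. Later arguments use only the diagonal. -/
theorem exists_exp_upperLinear (a b r : ℝ) : ∃ s, NormedSpace.exp (upperLinear ((a, b), r)) =
    !![Real.exp a, s; 0, Real.exp b] := by
  by_cases hab : a = b
  · subst hab
    have := exp_smul_upperLinear_self 1 a r
    rw [one_smul] at this
    exact ⟨Real.exp a * r, by rw [this]; simp⟩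
  · have hab' : a - b ≠ 0 := sub_ne_zero.2 hab
    have := exp_eq_of_hasEntryDeriv (X := upperLinear ((a, b), r)) (f := fun t =>
      !![Real.exp (t * a), r / (a - b) * (Real.exp (t * a) - Real.exp (t * b));
        0, Real.exp (t * b)]) (fun t => ?_) (by simp [Matrix.one_fin_two]) 1
    · rw [one_smul, one_mul, one_mul] at this
      exact ⟨_, this⟩
    · have hexp : ∀ a : ℝ, HasDerivAt (fun s : ℝ => Real.exp (s * a)) (Real.exp (t * a) * a) t :=
        fun a => by simpa using ((hasDerivAt_id t).mul_const a).exp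
      apply HasEntryDeriv.of_two
      · simpa [upperLinear, Matrix.mul_apply] using hexp a
      · refine (((hexp a).sub (hexp b)).const_mul (r / (a - b))).congr_deriv ?_
        simp [upperLinear, Matrix.mul_apply]
        field_simp
        ring
      · simpa [upperLinear, Matrix.mul_apply] using hasDerivAt_const t (0 : ℝ)
      · simpa [upperLinear, Matrix.mul_apply] using hexp b

theorem mem_map_diagLinear {W : Submodule ℝ (ℝ × ℝ)} {X : Matrix (Fin 2) (Fin 2) ℝ} :
    X ∈ W.map diagLinear ↔ X 0 1 = 0 ∧ X 1 0 = 0 ∧ (X 0 0, X 1 1) ∈ W := by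
  constructor
  · rintro ⟨⟨a, b⟩, h, rfl⟩
    simpa [diagLinear] using h
  · rintro ⟨h1, h2, h⟩
    refine ⟨_, h, ?_⟩
    ext i j
    fin_cases i <;> fin_cases j <;> simp [diagLinear, h1, h2]

theorem mem_map_confLinear {W : Submodule ℝ (ℝ × ℝ)} {X : Matrix (Fin 2) (Fin 2) ℝ} :
    X ∈ W.map confLinear ↔ X 0 1 = -X 1 0 ∧ X 1 1 = X 0 0 ∧ (X 0 0, X 1 0) ∈ W := by
  constructor
  · rintro ⟨⟨a, b⟩, h, rfl⟩
    simpa [confLinear] using h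
  · rintro ⟨h1, h2, h⟩
    refine ⟨_, h, ?_⟩
    ext i j
    fin_cases i <;> fin_cases j <;> simp [confLinear, h1, h2]

theorem mem_map_upperLinear {W : Submodule ℝ (ℝ × ℝ)} {X : Matrix (Fin 2) (Fin 2) ℝ} :
    X ∈ (W.prod ⊤).map upperLinear ↔ X 1 0 = 0 ∧ (X 0 0, X 1 1) ∈ W := by
  constructor
  · rintro ⟨⟨⟨a, b⟩, r⟩, h, rfl⟩
    simpa [upperLinear] using h
  · rintro ⟨h1, h⟩
    refine ⟨((X 0 0, X 1 1), X 0 1), ⟨h, trivial⟩, ?_⟩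
    ext i j
    fin_cases i <;> fin_cases j <;> simp [upperLinear, h1]

/-- A generator of a one-parameter group in this set is diagonal, and by injectivity of the real
exponential its diagonal can be read off at time one. -/
theorem isLieModel_diag (W : Submodule ℝ (ℝ × ℝ)) :
    IsLieModel {M | ∃ w ∈ W, M = !![Real.exp w.1, 0; 0, Real.exp w.2]} (W.map diagLinear) := by
  have hexp : ∀ w, NormedSpace.exp (diagLinear w) = !![Real.exp w.1, 0; 0, Real.exp w.2] := by
    rintro ⟨a, b⟩
    simpa using exp_smul_diagLinear 1 a b
  refine isLieModel_of_commute ?_ ?_ ?_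
  · ext M
    constructor
    · rintro ⟨w, hw, rfl⟩
      exact ⟨_, ⟨w, hw, rfl⟩, hexp w⟩
    · rintro ⟨_, ⟨w, hw, rfl⟩, rfl⟩
      exact ⟨w, hw, hexp w⟩
  · rintro _ ⟨w, hw, rfl⟩ _ ⟨w', hw', rfl⟩
    simp [diagLinear, mul_comm]
  · intro Y hY
    have : Y ∈ (⊤ : Submodule ℝ (ℝ × ℝ)).map diagLinear := by
      refine mem_of_forall_exp_smul_mem fun t => ?_
      obtain ⟨w, -, e⟩ := hY t
      rw [mem_map_diagLinear, e]
      simp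
    obtain ⟨w, -, rfl⟩ := this
    obtain ⟨w', hw', e⟩ := hY 1
    rw [one_smul, hexp] at e
    have e0 := congrFun (congrFun e 0) 0
    have e1 := congrFun (congrFun e 1) 1
    simp at e0 e1
    exact ⟨w, by rwa [Prod.ext e0 e1], rfl⟩

theorem isLieModel_upper (W : Submodule ℝ (ℝ × ℝ)) :
    IsLieModel {M | ∃ w ∈ W, ∃ r, M = !![Real.exp w.1, r; 0, Real.exp w.2]}
      ((W.prod ⊤).map upperLinear) := by
  refine ⟨⟨0, W.zero_mem, 0, by simp [Matrix.one_fin_two]⟩, ?_, ?_, ?_, ?_⟩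
  · rintro _ ⟨w, hw, r, rfl⟩ _ ⟨w', hw', r', rfl⟩
    exact ⟨w + w', W.add_mem hw hw', Real.exp w.1 * r' + r * Real.exp w'.2,
      by simp [Real.exp_add]⟩
  · intro Y
    constructor
    · intro h t
      obtain ⟨⟨⟨a, b⟩, r⟩, ⟨h, -⟩, e⟩ := Submodule.smul_mem _ t h
      rw [← e]
      obtain ⟨s, hs⟩ := exists_exp_upperLinear a b r
      exact ⟨_, h, s, hs⟩
    · intro hY
      have : Y ∈ ((⊤ : Submodule ℝ (ℝ × ℝ)).prod ⊤).map upperLinear := by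
        refine mem_of_forall_exp_smul_mem fun t => ?_
        obtain ⟨w, -, r, e⟩ := hY t
        rw [mem_map_upperLinear, e]
        simp
      obtain ⟨⟨⟨a, b⟩, r⟩, -, rfl⟩ := this
      obtain ⟨w', hw', r', e⟩ := hY 1
      obtain ⟨s, hs⟩ := exists_exp_upperLinear a b r
      rw [one_smul, hs] at e
      have e0 := congrFun (congrFun e 0) 0
      have e1 := congrFun (congrFun e 1) 1
      simp at e0 e1
      exact ⟨_, ⟨by rwa [show (a, b) = w' from Prod.ext e0 e1], trivial⟩, rfl⟩
  · rintro _ ⟨⟨⟨a, b⟩, r⟩, ⟨h, -⟩, rfl⟩ _ ⟨⟨⟨a', b'⟩, r'⟩, ⟨h', -⟩, rfl⟩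
    rw [mem_map_upperLinear]
    simp [upperLinear, mul_comm]
    exact W.zero_mem
  · rintro _ ⟨w, hw, r, rfl⟩
    -- Factorisation into a diagonal and a unipotent matrix; `e^{-w.1}` compensates the scaling of
    -- the corner by the diagonal factor on the left.
    refine ⟨[upperLinear (w, 0), upperLinear (0, Real.exp (-w.1) * r)], ?_, ?_⟩
    · simp only [List.mem_cons, List.not_mem_nil, or_false]
      rintro X (rfl | rfl)
      · exact ⟨_, ⟨hw, trivial⟩, rfl⟩
      · exact ⟨_, ⟨W.zero_mem, trivial⟩, rfl⟩
    · have h1 := exp_smul_upperLinear_self 1 0 (Real.exp (-w.1) * r)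
      have h2 := exp_smul_diagLinear 1 w.1 w.2
      rw [one_smul] at h1 h2
      have h3 : upperLinear (w, 0) = diagLinear (w.1, w.2) := rfl
      have h4 : upperLinear (0, Real.exp (-w.1) * r) = upperLinear ((0, 0), Real.exp (-w.1) * r) :=
        rfl
      simp only [List.map_cons, List.map_nil, List.prod_cons, List.prod_nil, mul_one]
      rw [h3, h4, h1, h2]
      simp [← mul_assoc, ← Real.exp_add]

theorem isLieModel_upperJordan : IsLieModel upperJordan (ℝ ∙ upperLinear ((1, 1), 1)) := by
  have hexp := fun t => exp_smul_upperLinear_self t 1 1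
  refine isLieModel_span_singleton ?_ ?_
  · simp only [hexp, mul_one]
    rfl
  · intro Y hY
    have : Y ∈ ((⊤ : Submodule ℝ (ℝ × ℝ)).prod ⊤).map upperLinear := by
      refine mem_of_forall_exp_smul_mem fun t => ?_
      obtain ⟨s, e⟩ := hY t
      rw [mem_map_upperLinear, e]
      simp
    obtain ⟨⟨⟨a, b⟩, r⟩, -, rfl⟩ := this
    -- The entry at position `(0, 0)` determines the parameter on the curve, so the
    -- reparametrisation is linear with factor `a`.
    refine ⟨a, fun t => ?_⟩
    obtain ⟨s, e⟩ := hY t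
    obtain ⟨r', hr'⟩ := exists_exp_upperLinear (t * a) (t * b) (t * r)
    have hY' : t • upperLinear ((a, b), r) = upperLinear ((t * a, t * b), t * r) := by
      rw [← map_smul]; rfl
    have e0 : t * a = s := by
      rw [hY', hr'] at e
      simpa using congrFun (congrFun e 0) 0
    rw [e, hexp, e0, mul_one]

theorem mem_top_of_forall_exp_conf {Y : Matrix (Fin 2) (Fin 2) ℝ}
    (h : ∀ t : ℝ, ∃ s θ : ℝ, NormedSpace.exp (t • Y) = Real.exp s • rot θ) :
    ∃ a b, Y = confLinear (a, b) := by
  have : Y ∈ (⊤ : Submodule ℝ (ℝ × ℝ)).map confLinear := by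
    refine mem_of_forall_exp_smul_mem fun t => ?_
    obtain ⟨s, θ, e⟩ := h t
    rw [mem_map_confLinear, e]
    simp [rot]
  obtain ⟨⟨a, b⟩, -, rfl⟩ := this
  exact ⟨a, b, rfl⟩

/-- The determinant `e^{2s}` does not see the angle. Since the angle is determined only modulo `2π`,
the parameter on a spiral has to be read from the dilation. -/
theorem eq_of_exp_smul_rot_eq {s s' θ θ' : ℝ} (h : Real.exp s • rot θ = Real.exp s' • rot θ') :
    s = s' := by
  have hd := congrArg Matrix.det h
  have key : ∀ s θ, (Real.exp s • rot θ).det = Real.exp (2 * s) := by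
    intro s θ
    rw [Matrix.det_fin_two, two_mul, Real.exp_add]
    simp only [rot, Matrix.smul_apply, Matrix.of_apply, Matrix.cons_val', Matrix.cons_val_zero,
      Matrix.cons_val_one, smul_eq_mul, Matrix.cons_val_fin_one]
    linear_combination (Real.exp s * Real.exp s) * Real.sin_sq_add_cos_sq θ
  rw [key, key, Real.exp_eq_exp] at hd
  linarith

theorem isLieModel_conformal : IsLieModel conformal ((⊤ : Submodule ℝ (ℝ × ℝ)).map confLinear) := by
  refine isLieModel_of_commute ?_ ?_ ?_
  · ext M
    constructor
    · rintro ⟨t, θ, rfl⟩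
      exact ⟨_, ⟨(t, θ), trivial, rfl⟩, by simpa using exp_smul_confLinear 1 t θ⟩
    · rintro ⟨_, ⟨⟨t, θ⟩, -, rfl⟩, rfl⟩
      exact ⟨t, θ, by simpa using exp_smul_confLinear 1 t θ⟩
  · rintro _ ⟨w, -, rfl⟩ _ ⟨w', -, rfl⟩
    simp only [confLinear, LinearMap.coe_mk, AddHom.coe_mk]
    ext i j
    fin_cases i <;> fin_cases j <;> simp [Matrix.mul_apply] <;> ring
  · intro Y hY
    obtain ⟨a, b, rfl⟩ := mem_top_of_forall_exp_conf hY
    exact ⟨_, trivial, rfl⟩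

theorem isLieModel_spiral (α : ℝ) : IsLieModel (spiral α) (ℝ ∙ confLinear (1, α)) := by
  have hexp := fun t => exp_smul_confLinear t 1 α
  refine isLieModel_span_singleton ?_ ?_
  · simp only [hexp, mul_one]
    rfl
  · intro Y hY
    obtain ⟨a, b, rfl⟩ := mem_top_of_forall_exp_conf fun t => by
      obtain ⟨s, e⟩ := hY t
      exact ⟨s, _, e⟩
    refine ⟨a, fun t => ?_⟩
    obtain ⟨s, e⟩ := hY t
    have e' := e
    rw [exp_smul_confLinear] at e'
    rw [e, hexp, eq_of_exp_smul_rot_eq e', mul_one]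

theorem isLieModel_rotations : IsLieModel rotations (ℝ ∙ confLinear (0, 1)) := by
  have hexp : ∀ t : ℝ, NormedSpace.exp (t • confLinear (0, 1)) = rot t := fun t => by
    simpa using exp_smul_confLinear t 0 1
  refine isLieModel_span_singleton ?_ ?_
  · simp only [hexp]
    rfl
  · intro Y hY
    obtain ⟨a, b, rfl⟩ := mem_top_of_forall_exp_conf fun t => by
      obtain ⟨s, e⟩ := hY t
      exact ⟨0, s, by simpa using e⟩
    -- Rotations have dilation factor `e^0`, which leaves no scalar part in the generator.
    obtain rfl : a = 0 := by
      obtain ⟨s, e⟩ := hY 1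
      rw [exp_smul_confLinear, ← one_smul ℝ (rot s), ← Real.exp_zero] at e
      simpa using eq_of_exp_smul_rot_eq e
    exact ⟨b, fun t => by rw [hexp, exp_smul_confLinear]; simp⟩

end LieModels

/-! ### The list arranged by vector parts; membership and dimensions -/

section Shapes

open Matrix

/-- `(u, v) ↦ [u, v; v, -u]` -/
def onePerpLinear : ℝ × ℝ →ₗ[ℝ] Matrix (Fin 2) (Fin 2) ℝ where
  toFun w := !![w.1, w.2; w.2, -w.1]
  map_add' _ _ := by ext i j; fin_cases i <;> fin_cases j <;> simp [add_comm]
  map_smul' _ _ := by ext i j; fin_cases i <;> fin_cases j <;> simp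

/-- `(u, v) ↦ [0, u; u, v]` -/
def zeroPerpLinear : ℝ × ℝ →ₗ[ℝ] Matrix (Fin 2) (Fin 2) ℝ where
  toFun w := !![0, w.1; w.1, w.2]
  map_add' _ _ := by ext i j; fin_cases i <;> fin_cases j <;> simp
  map_smul' _ _ := by ext i j; fin_cases i <;> fin_cases j <;> simp

/-- `((a, c), b) ↦ [a, b; b, c]` -/
def symLinear : (ℝ × ℝ) × ℝ →ₗ[ℝ] Matrix (Fin 2) (Fin 2) ℝ where
  toFun w := !![w.1.1, w.2; w.2, w.1.2]
  map_add' _ _ := by ext i j; fin_cases i <;> fin_cases j <;> simp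
  map_smul' _ _ := by ext i j; fin_cases i <;> fin_cases j <;> simp

theorem onePerpLinear_injective : Function.Injective onePerpLinear := by
  rintro ⟨a, b⟩ ⟨a', b'⟩ h
  have h0 := congrFun (congrFun h 0) 0
  have h1 := congrFun (congrFun h 0) 1
  simp [onePerpLinear] at h0 h1
  rw [h0, h1]

theorem zeroPerpLinear_injective : Function.Injective zeroPerpLinear := by
  rintro ⟨a, b⟩ ⟨a', b'⟩ h
  have h0 := congrFun (congrFun h 0) 1
  have h1 := congrFun (congrFun h 1) 1
  simp [zeroPerpLinear] at h0 h1
  rw [h0, h1]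

theorem symLinear_injective : Function.Injective symLinear := by
  rintro ⟨⟨a, b⟩, r⟩ ⟨⟨a', b'⟩, r'⟩ h
  have h0 := congrFun (congrFun h 0) 0
  have h1 := congrFun (congrFun h 1) 1
  have h2 := congrFun (congrFun h 0) 1
  simp [symLinear] at h0 h1 h2
  rw [h0, h1, h2]

theorem mem_Sym_two {M : Matrix (Fin 2) (Fin 2) ℝ} : M ∈ Sym 2 ↔ M 1 0 = M 0 1 := by
  constructor
  · intro h
    exact congrFun (congrFun (show Mᵀ = M from h) 0) 1
  · intro h
    change Mᵀ = M
    ext i j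
    fin_cases i <;> fin_cases j <;> simp [h]

theorem finrank_Sym_two : Module.finrank ℝ (Sym 2) = 3 := by
  have : Sym 2 = LinearMap.range symLinear := by
    ext M
    rw [mem_Sym_two]
    constructor
    · intro h
      refine ⟨((M 0 0, M 1 1), M 0 1), ?_⟩
      ext i j
      fin_cases i <;> fin_cases j <;> simp [symLinear, h]
    · rintro ⟨w, rfl⟩
      simp [symLinear]
  rw [this, LinearMap.finrank_range_of_inj symLinear_injective]
  simp

/-- Indices of the subgroups of the conformal group occurring in the list. -/
inductive ConfIndex : Type
  | full
  | spiral (α : Set.Ici (0 : ℝ))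
  | rotations

/-- Indices of the diagonal subgroups occurring with `sigmaNeg` and `sigmaNegPerp`. -/
inductive DiagIndex : Type
  | full
  | curve (β : Set.Icc (-1 : ℝ) 1)

/-- Indices of the triangular subgroups occurring with `sigmaZero` and `sigmaZeroPerp`. -/
inductive TriIndex : Type
  | full
  | param (l : ℝ)
  | diagonals
  | scalarUnip
  | line (l : ℝ)
  | unip
  | jordan
  | scalars

/-- The group belonging to an index. -/
def ConfIndex.lin : ConfIndex → Set (Matrix (Fin 2) (Fin 2) ℝ)
  | .full => conformal
  | .spiral α => SympClass.spiral α
  | .rotations => SympClass.rotations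

/-- The Lie algebra belonging to an index. -/
noncomputable def ConfIndex.alg : ConfIndex → Submodule ℝ (Matrix (Fin 2) (Fin 2) ℝ)
  | .full => (⊤ : Submodule ℝ (ℝ × ℝ)).map confLinear
  | .spiral α => ℝ ∙ confLinear (1, α)
  | .rotations => ℝ ∙ confLinear (0, 1)

/-- The dimension of the group belonging to an index. -/
def ConfIndex.dim : ConfIndex → ℕ
  | .full => 2
  | .spiral _ => 1
  | .rotations => 1

/-- The group belonging to an index. -/
def DiagIndex.lin : DiagIndex → Set (Matrix (Fin 2) (Fin 2) ℝ)
  | .full => SympClass.diagonals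
  | .curve β => diagCurve β

/-- The Lie algebra belonging to an index. -/
noncomputable def DiagIndex.alg : DiagIndex → Submodule ℝ (Matrix (Fin 2) (Fin 2) ℝ)
  | .full => (⊤ : Submodule ℝ (ℝ × ℝ)).map diagLinear
  | .curve β => (ℝ ∙ ((1, β) : ℝ × ℝ)).map diagLinear

/-- The dimension of the group belonging to an index. -/
def DiagIndex.dim : DiagIndex → ℕ
  | .full => 2
  | .curve _ => 1

/-- The upper triangular group belonging to an index. -/
def TriIndex.lin : TriIndex → Set (Matrix (Fin 2) (Fin 2) ℝ)
  | .full => upperFull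
  | .param l => upperParam l
  | .diagonals => SympClass.diagonals
  | .scalarUnip => upperScalar
  | .line l => diagLine l
  | .unip => upperUnip
  | .jordan => upperJordan
  | .scalars => SympClass.scalars

/-- The Lie algebra of the upper triangular group belonging to an index. -/
noncomputable def TriIndex.alg : TriIndex → Submodule ℝ (Matrix (Fin 2) (Fin 2) ℝ)
  | .full => ((⊤ : Submodule ℝ (ℝ × ℝ)).prod ⊤).map upperLinear
  | .param l => ((ℝ ∙ ((l, l + 1) : ℝ × ℝ)).prod ⊤).map upperLinear
  | .diagonals => (⊤ : Submodule ℝ (ℝ × ℝ)).map diagLinear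
  | .scalarUnip => ((ℝ ∙ ((1, 1) : ℝ × ℝ)).prod ⊤).map upperLinear
  | .line l => (ℝ ∙ ((l, l + 1) : ℝ × ℝ)).map diagLinear
  | .unip => ((⊥ : Submodule ℝ (ℝ × ℝ)).prod ⊤).map upperLinear
  | .jordan => ℝ ∙ upperLinear ((1, 1), 1)
  | .scalars => (ℝ ∙ ((1, 1) : ℝ × ℝ)).map diagLinear

/-- The dimension of the group belonging to an index. -/
def TriIndex.dim : TriIndex → ℕ
  | .full => 3
  | .param _ => 2
  | .diagonals => 2
  | .scalarUnip => 2
  | .line _ => 1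
  | .unip => 1
  | .jordan => 1
  | .scalars => 1

theorem ConfIndex.isLieModel (i : ConfIndex) : IsLieModel i.lin i.alg := by
  cases i with
  | full => exact isLieModel_conformal
  | spiral α => exact isLieModel_spiral α
  | rotations => exact isLieModel_rotations

theorem IsLieModel.congr {n : Type*} [Fintype n] [DecidableEq n] {K K' : Set (Matrix n n ℝ)}
    {A : Submodule ℝ (Matrix n n ℝ)} (h : IsLieModel K A) (e : K' = K) : IsLieModel K' A :=
  e ▸ h

theorem setOf_exists_mem_span_singleton {α : Type*} (w : ℝ × ℝ) (f : ℝ × ℝ → α → Prop) :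
    {M | ∃ t : ℝ, f (t • w) M} = {M | ∃ v ∈ ℝ ∙ w, f v M} := by
  ext M
  constructor
  · rintro ⟨t, e⟩
    exact ⟨_, Submodule.mem_span_singleton.2 ⟨t, rfl⟩, e⟩
  · rintro ⟨_, h, e⟩
    obtain ⟨t, rfl⟩ := Submodule.mem_span_singleton.1 h
    exact ⟨t, e⟩

theorem isLieModel_diag_span (w : ℝ × ℝ) :
    IsLieModel {M | ∃ t : ℝ, M = !![Real.exp (t * w.1), 0; 0, Real.exp (t * w.2)]}
      ((ℝ ∙ w).map diagLinear) :=
  (isLieModel_diag (ℝ ∙ w)).congr (setOf_exists_mem_span_singleton w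
    fun w M => M = !![Real.exp w.1, 0; 0, Real.exp w.2])

theorem isLieModel_upper_span (w : ℝ × ℝ) :
    IsLieModel {M | ∃ t r : ℝ, M = !![Real.exp (t * w.1), r; 0, Real.exp (t * w.2)]}
      (((ℝ ∙ w).prod ⊤).map upperLinear) :=
  (isLieModel_upper (ℝ ∙ w)).congr (setOf_exists_mem_span_singleton w
    fun w M => ∃ r, M = !![Real.exp w.1, r; 0, Real.exp w.2])

theorem isLieModel_diagonals :
    IsLieModel SympClass.diagonals ((⊤ : Submodule ℝ (ℝ × ℝ)).map diagLinear) :=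
  (isLieModel_diag ⊤).congr (by ext M; simp [SympClass.diagonals])

theorem DiagIndex.isLieModel (i : DiagIndex) : IsLieModel i.lin i.alg := by
  cases i with
  | full => exact isLieModel_diagonals
  | curve β => exact (isLieModel_diag_span (1, β)).congr (by simp [DiagIndex.lin, diagCurve])

theorem TriIndex.isLieModel (i : TriIndex) : IsLieModel i.lin i.alg := by
  cases i with
  | full => exact (isLieModel_upper ⊤).congr (by ext M; simp [TriIndex.lin, upperFull])
  | param l => exact isLieModel_upper_span (l, l + 1)
  | diagonals => exact isLieModel_diagonals
  | scalarUnip => exact (isLieModel_upper_span (1, 1)).congr (by simp [TriIndex.lin, upperScalar])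
  | line l =>
    exact (isLieModel_diag_span (l, l + 1)).congr
      (by simp [TriIndex.lin, diagLine, mul_add, Real.exp_add])
  | unip => exact (isLieModel_upper ⊥).congr (by ext M; simp [TriIndex.lin, upperUnip])
  | jordan => exact isLieModel_upperJordan
  | scalars =>
    exact (isLieModel_diag_span (1, 1)).congr (by simp [TriIndex.lin, SympClass.scalars])

theorem ConfIndex.finrank_alg (i : ConfIndex) : Module.finrank ℝ i.alg = i.dim := by
  cases i with
  | full =>
    exact (finrank_map_of_injective confLinear_injective _).trans (by simp [ConfIndex.dim])
  | spiral α =>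
    refine finrank_span_singleton fun h => ?_
    simpa [confLinear] using congrFun (congrFun h 0) 0
  | rotations =>
    refine finrank_span_singleton fun h => ?_
    simpa [confLinear] using congrFun (congrFun h 1) 0

theorem finrank_map_diagLinear (W : Submodule ℝ (ℝ × ℝ)) :
    Module.finrank ℝ (W.map diagLinear) = Module.finrank ℝ W :=
  finrank_map_of_injective diagLinear_injective W

theorem finrank_map_upperLinear (W : Submodule ℝ (ℝ × ℝ)) :
    Module.finrank ℝ ((W.prod (⊤ : Submodule ℝ ℝ)).map upperLinear) = Module.finrank ℝ W + 1 :=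
  (finrank_map_of_injective upperLinear_injective _).trans
    ((finrank_submodule_prod _ _).trans (by simp))

theorem finrank_span_weight (l : ℝ) : Module.finrank ℝ (ℝ ∙ ((l, l + 1) : ℝ × ℝ)) = 1 := by
  refine finrank_span_singleton fun h => ?_
  have h1 := congrArg Prod.fst h
  have h2 := congrArg Prod.snd h
  simp only [Prod.fst_zero, Prod.snd_zero] at h1 h2
  linarith

theorem finrank_span_one_left (b : ℝ) : Module.finrank ℝ (ℝ ∙ ((1, b) : ℝ × ℝ)) = 1 :=
  finrank_span_singleton fun h => one_ne_zero (congrArg Prod.fst h)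

theorem DiagIndex.finrank_alg (i : DiagIndex) : Module.finrank ℝ i.alg = i.dim := by
  cases i with
  | full => exact (finrank_map_diagLinear _).trans (by simp [DiagIndex.dim])
  | curve β => exact (finrank_map_diagLinear _).trans (finrank_span_one_left _)

theorem TriIndex.finrank_alg (i : TriIndex) : Module.finrank ℝ i.alg = i.dim := by
  cases i with
  | full => exact (finrank_map_upperLinear _).trans (by simp [TriIndex.dim])
  | param l => exact (finrank_map_upperLinear _).trans (by rw [finrank_span_weight]; rfl)
  | diagonals => exact (finrank_map_diagLinear _).trans (by simp [TriIndex.dim])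
  | scalarUnip => exact (finrank_map_upperLinear _).trans (by rw [finrank_span_one_left]; rfl)
  | line l => exact (finrank_map_diagLinear _).trans (finrank_span_weight l)
  | unip => exact (finrank_map_upperLinear _).trans (by simp [TriIndex.dim])
  | jordan =>
    refine finrank_span_singleton fun h => ?_
    simpa [upperLinear] using congrFun (congrFun h 0) 0
  | scalars => exact (finrank_map_diagLinear _).trans (finrank_span_one_left 1)

/-- The entries of the list, grouped by their vector parts. -/
inductive Shape : Type
  | one (i : ConfIndex)
  | onePerp (i : ConfIndex)
  | neg (i : DiagIndex)
  | negPerp (i : DiagIndex)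
  | zero (i : TriIndex)
  | zeroPerp (i : TriIndex)

/-- The entry of the list given by a shape. -/
def Shape.entry : Shape → Entry
  | .one .full => .d3_1
  | .one (.spiral α) => .d2_1 α
  | .one .rotations => .d2_2
  | .onePerp .full => .d4_1
  | .onePerp (.spiral α) => .d3_2 α
  | .onePerp .rotations => .d3_3
  | .neg .full => .d3_11
  | .neg (.curve β) => .d2_7 β
  | .negPerp .full => .d4_6
  | .negPerp (.curve β) => .d3_12 β
  | .zero .full => .d4_2
  | .zero (.param l) => .d3_4 l
  | .zero .diagonals => .d3_5
  | .zero .scalarUnip => .d3_6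
  | .zero (.line l) => .d2_3 l
  | .zero .unip => .d2_4
  | .zero .jordan => .d2_5
  | .zero .scalars => .d2_6
  | .zeroPerp .full => .d5_1
  | .zeroPerp (.param l) => .d4_3 l
  | .zeroPerp .diagonals => .d4_4
  | .zeroPerp .scalarUnip => .d4_5
  | .zeroPerp (.line l) => .d3_7 l
  | .zeroPerp .unip => .d3_8
  | .zeroPerp .jordan => .d3_9
  | .zeroPerp .scalars => .d3_10

/-- Surjectivity is all that is needed: shapes with conjugate groups turn out to be equal, and then
so are their entries. -/
theorem Shape.entry_surjective : Function.Surjective Shape.entry := by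
  intro e
  cases e with
  | d5_1 => exact ⟨.zeroPerp .full, rfl⟩
  | d4_1 => exact ⟨.onePerp .full, rfl⟩
  | d4_2 => exact ⟨.zero .full, rfl⟩
  | d4_3 l => exact ⟨.zeroPerp (.param l), rfl⟩
  | d4_4 => exact ⟨.zeroPerp .diagonals, rfl⟩
  | d4_5 => exact ⟨.zeroPerp .scalarUnip, rfl⟩
  | d4_6 => exact ⟨.negPerp .full, rfl⟩
  | d3_1 => exact ⟨.one .full, rfl⟩
  | d3_2 α => exact ⟨.onePerp (.spiral α), rfl⟩
  | d3_3 => exact ⟨.onePerp .rotations, rfl⟩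
  | d3_4 l => exact ⟨.zero (.param l), rfl⟩
  | d3_5 => exact ⟨.zero .diagonals, rfl⟩
  | d3_6 => exact ⟨.zero .scalarUnip, rfl⟩
  | d3_7 l => exact ⟨.zeroPerp (.line l), rfl⟩
  | d3_8 => exact ⟨.zeroPerp .unip, rfl⟩
  | d3_9 => exact ⟨.zeroPerp .jordan, rfl⟩
  | d3_10 => exact ⟨.zeroPerp .scalars, rfl⟩
  | d3_11 => exact ⟨.neg .full, rfl⟩
  | d3_12 β => exact ⟨.negPerp (.curve β), rfl⟩
  | d2_1 α => exact ⟨.one (.spiral α), rfl⟩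
  | d2_2 => exact ⟨.one .rotations, rfl⟩
  | d2_3 l => exact ⟨.zero (.line l), rfl⟩
  | d2_4 => exact ⟨.zero .unip, rfl⟩
  | d2_5 => exact ⟨.zero .jordan, rfl⟩
  | d2_6 => exact ⟨.zero .scalars, rfl⟩
  | d2_7 β => exact ⟨.neg (.curve β), rfl⟩

/-- The vector part of a shape. -/
noncomputable def Shape.vec : Shape → Submodule ℝ (Matrix (Fin 2) (Fin 2) ℝ)
  | .one _ => ℝ ∙ !![1, 0; 0, 1]
  | .onePerp _ => LinearMap.range onePerpLinear
  | .neg _ => ℝ ∙ !![0, 1; 1, 0]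
  | .negPerp _ => LinearMap.range diagLinear
  | .zero _ => ℝ ∙ !![1, 0; 0, 0]
  | .zeroPerp _ => LinearMap.range zeroPerpLinear

/-- The linear part of a shape. -/
def Shape.lin : Shape → Set (Matrix (Fin 2) (Fin 2) ℝ)
  | .one i => i.lin
  | .onePerp i => i.lin
  | .neg i => i.lin
  | .negPerp i => i.lin
  | .zero i => {M | Mᵀ ∈ i.lin}
  | .zeroPerp i => i.lin

/-- The Lie algebra of the linear part of a shape. -/
noncomputable def Shape.alg : Shape → Submodule ℝ (Matrix (Fin 2) (Fin 2) ℝ)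
  | .one i => i.alg
  | .onePerp i => i.alg
  | .neg i => i.alg
  | .negPerp i => i.alg
  | .zero i => i.alg.comap transposeLinear
  | .zeroPerp i => i.alg

/-- The dimension of the vector part of a shape. -/
def Shape.vecDim : Shape → ℕ
  | .one _ => 1
  | .onePerp _ => 2
  | .neg _ => 1
  | .negPerp _ => 2
  | .zero _ => 1
  | .zeroPerp _ => 2

/-- The dimension of the linear part of a shape. -/
def Shape.linDim : Shape → ℕ
  | .one i => i.dim
  | .onePerp i => i.dim
  | .neg i => i.dim
  | .negPerp i => i.dim
  | .zero i => i.dim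
  | .zeroPerp i => i.dim

theorem Shape.isLieModel (s : Shape) : IsLieModel s.lin s.alg := by
  cases s with
  | one i => exact i.isLieModel
  | onePerp i => exact i.isLieModel
  | neg i => exact i.isLieModel
  | negPerp i => exact i.isLieModel
  | zero i => exact i.isLieModel.transpose
  | zeroPerp i => exact i.isLieModel

theorem finrank_comap_transposeLinear (A : Submodule ℝ (Matrix (Fin 2) (Fin 2) ℝ)) :
    Module.finrank ℝ (A.comap transposeLinear) = Module.finrank ℝ A := by
  have hinj : Function.Injective transposeLinear := Matrix.transpose_injective
  have : (A.comap transposeLinear).map transposeLinear = A :=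
    Submodule.map_comap_eq_of_surjective (fun M => ⟨Mᵀ, Matrix.transpose_transpose M⟩) A
  rw [← finrank_map_of_injective hinj, this]

theorem Shape.finrank_alg (s : Shape) : Module.finrank ℝ s.alg = s.linDim := by
  cases s with
  | one i => exact i.finrank_alg
  | onePerp i => exact i.finrank_alg
  | neg i => exact i.finrank_alg
  | negPerp i => exact i.finrank_alg
  | zero i => exact (finrank_comap_transposeLinear _).trans i.finrank_alg
  | zeroPerp i => exact i.finrank_alg

theorem Shape.finrank_vec (s : Shape) : Module.finrank ℝ s.vec = s.vecDim := by
  cases s with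
  | one i =>
    exact finrank_span_singleton fun h => by simpa using congrFun (congrFun h 0) 0
  | onePerp i =>
    exact (LinearMap.finrank_range_of_inj onePerpLinear_injective).trans (by simp [Shape.vecDim])
  | neg i =>
    exact finrank_span_singleton fun h => by simpa using congrFun (congrFun h 0) 1
  | negPerp i =>
    exact (LinearMap.finrank_range_of_inj diagLinear_injective).trans (by simp [Shape.vecDim])
  | zero i =>
    exact finrank_span_singleton fun h => by simpa using congrFun (congrFun h 0) 0
  | zeroPerp i =>
    exact (LinearMap.finrank_range_of_inj zeroPerpLinear_injective).trans (by simp [Shape.vecDim])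

theorem Shape.dim_entry (s : Shape) : s.entry.dim = s.vecDim + s.linDim := by
  cases s with
  | one i => cases i <;> rfl
  | onePerp i => cases i <;> rfl
  | neg i => cases i <;> rfl
  | negPerp i => cases i <;> rfl
  | zero i => cases i <;> rfl
  | zeroPerp i => cases i <;> rfl

theorem transpose_eq_fin_two {M : Matrix (Fin 2) (Fin 2) ℝ} {a b c d : ℝ} :
    Mᵀ = !![a, b; c, d] ↔ M = !![a, c; b, d] := by
  rw [← Matrix.transpose_inj, Matrix.transpose_transpose]
  have : !![a, b; c, d]ᵀ = !![a, c; b, d] := by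
    ext i j; fin_cases i <;> fin_cases j <;> rfl
  rw [this]

theorem Shape.group_entry (s : Shape) : s.entry.group = semidirectSet s.vec s.lin := by
  have hone : ((ℝ ∙ !![1, 0; 0, 1] : Submodule ℝ (Matrix (Fin 2) (Fin 2) ℝ)) : Set _) =
      sigmaOne := by
    ext M; simp [sigmaOne, Submodule.mem_span_singleton, eq_comm]
  have hneg : ((ℝ ∙ !![0, 1; 1, 0] : Submodule ℝ (Matrix (Fin 2) (Fin 2) ℝ)) : Set _) =
      sigmaNeg := by
    ext M; simp [sigmaNeg, Submodule.mem_span_singleton, eq_comm]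
  have hzero : ((ℝ ∙ !![1, 0; 0, 0] : Submodule ℝ (Matrix (Fin 2) (Fin 2) ℝ)) : Set _) =
      sigmaZero := by
    ext M; simp [sigmaZero, Submodule.mem_span_singleton, eq_comm]
  have honeP : (LinearMap.range onePerpLinear : Set _) = sigmaOnePerp := by
    ext M; simp [sigmaOnePerp, onePerpLinear, eq_comm]
  have hnegP : (LinearMap.range diagLinear : Set _) = sigmaNegPerp := by
    ext M; simp [sigmaNegPerp, diagLinear, eq_comm]
  have hzeroP : (LinearMap.range zeroPerpLinear : Set _) = sigmaZeroPerp := by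
    ext M; simp [sigmaZeroPerp, zeroPerpLinear, eq_comm]
  cases s with
  | one i => cases i <;> simp only [Shape.vec, hone] <;> rfl
  | onePerp i => cases i <;> simp only [Shape.vec, honeP] <;> rfl
  | neg i => cases i <;> simp only [Shape.vec, hneg] <;> rfl
  | negPerp i => cases i <;> simp only [Shape.vec, hnegP] <;> rfl
  | zero i =>
    cases i <;> simp only [Shape.vec, hzero, Shape.entry, Entry.group] <;> congr 1 <;> ext M <;>
      simp [Shape.lin, TriIndex.lin, lowerFull, upperFull, lowerParam, upperParam, lowerScalar,
        upperScalar, lowerUnip, upperUnip, lowerJordan, upperJordan, SympClass.diagonals, diagLine,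
        SympClass.scalars, transpose_eq_fin_two]
  | zeroPerp i => cases i <;> simp only [Shape.vec, hzeroP] <;> rfl

theorem mem_sigmaOne {M : Matrix (Fin 2) (Fin 2) ℝ} :
    M ∈ ℝ ∙ (!![1, 0; 0, 1] : Matrix (Fin 2) (Fin 2) ℝ) ↔
      M 0 1 = 0 ∧ M 1 0 = 0 ∧ M 1 1 = M 0 0 := by
  rw [Submodule.mem_span_singleton]
  constructor
  · rintro ⟨t, rfl⟩
    simp
  · rintro ⟨h1, h2, h3⟩
    refine ⟨M 0 0, ?_⟩
    ext i j
    fin_cases i <;> fin_cases j <;> simp [h1, h2, h3]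

theorem mem_sigmaNeg {M : Matrix (Fin 2) (Fin 2) ℝ} :
    M ∈ ℝ ∙ (!![0, 1; 1, 0] : Matrix (Fin 2) (Fin 2) ℝ) ↔
      M 0 0 = 0 ∧ M 1 1 = 0 ∧ M 1 0 = M 0 1 := by
  rw [Submodule.mem_span_singleton]
  constructor
  · rintro ⟨t, rfl⟩
    simp
  · rintro ⟨h1, h2, h3⟩
    refine ⟨M 0 1, ?_⟩
    ext i j
    fin_cases i <;> fin_cases j <;> simp [h1, h2, h3]

theorem mem_sigmaZero {M : Matrix (Fin 2) (Fin 2) ℝ} :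
    M ∈ ℝ ∙ (!![1, 0; 0, 0] : Matrix (Fin 2) (Fin 2) ℝ) ↔
      M 0 1 = 0 ∧ M 1 0 = 0 ∧ M 1 1 = 0 := by
  rw [Submodule.mem_span_singleton]
  constructor
  · rintro ⟨t, rfl⟩
    simp
  · rintro ⟨h1, h2, h3⟩
    refine ⟨M 0 0, ?_⟩
    ext i j
    fin_cases i <;> fin_cases j <;> simp [h1, h2, h3]

theorem mem_sigmaOnePerp {M : Matrix (Fin 2) (Fin 2) ℝ} :
    M ∈ LinearMap.range onePerpLinear ↔ M 1 0 = M 0 1 ∧ M 1 1 = -M 0 0 := by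
  constructor
  · rintro ⟨w, rfl⟩
    simp [onePerpLinear]
  · rintro ⟨h1, h2⟩
    refine ⟨(M 0 0, M 0 1), ?_⟩
    ext i j
    fin_cases i <;> fin_cases j <;> simp [onePerpLinear, h1, h2]

theorem mem_sigmaNegPerp {M : Matrix (Fin 2) (Fin 2) ℝ} :
    M ∈ LinearMap.range diagLinear ↔ M 0 1 = 0 ∧ M 1 0 = 0 := by
  constructor
  · rintro ⟨w, rfl⟩
    simp [diagLinear]
  · rintro ⟨h1, h2⟩
    refine ⟨(M 0 0, M 1 1), ?_⟩
    ext i j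
    fin_cases i <;> fin_cases j <;> simp [diagLinear, h1, h2]

theorem mem_sigmaZeroPerp {M : Matrix (Fin 2) (Fin 2) ℝ} :
    M ∈ LinearMap.range zeroPerpLinear ↔ M 0 0 = 0 ∧ M 1 0 = M 0 1 := by
  constructor
  · rintro ⟨w, rfl⟩
    simp [zeroPerpLinear]
  · rintro ⟨h1, h2⟩
    refine ⟨(M 0 1, M 1 1), ?_⟩
    ext i j
    fin_cases i <;> fin_cases j <;> simp [zeroPerpLinear, h1, h2]

theorem Shape.vec_le_Sym (s : Shape) : s.vec ≤ Sym 2 := by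
  intro M hM
  rw [mem_Sym_two]
  cases s with
  | one i => have := mem_sigmaOne.1 hM; rw [this.1, this.2.1]
  | onePerp i => exact (mem_sigmaOnePerp.1 hM).1
  | neg i => exact (mem_sigmaNeg.1 hM).2.2
  | negPerp i => have := mem_sigmaNegPerp.1 hM; rw [this.1, this.2]
  | zero i => have := mem_sigmaZero.1 hM; rw [this.1, this.2.1]
  | zeroPerp i => exact (mem_sigmaZeroPerp.1 hM).2

theorem Shape.vec_lt_Sym (s : Shape) : s.vec < Sym 2 := by
  refine lt_of_le_of_ne s.vec_le_Sym fun h => ?_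
  have h1 := s.finrank_vec
  rw [h, finrank_Sym_two] at h1
  cases s <;> simp [Shape.vecDim] at h1

theorem Shape.vec_ne_bot (s : Shape) : s.vec ≠ ⊥ := by
  intro h
  have h1 := s.finrank_vec
  rw [h, finrank_bot] at h1
  cases s <;> simp [Shape.vecDim] at h1

theorem Shape.alg_ne_bot (s : Shape) : s.alg ≠ ⊥ := by
  intro h
  have h1 := s.finrank_alg
  rw [h, finrank_bot] at h1
  rcases s with i | i | i | i | i | i <;> cases i <;>
    simp [Shape.linDim, ConfIndex.dim, DiagIndex.dim, TriIndex.dim] at h1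

theorem ConfIndex.lin_entries (i : ConfIndex) {M : Matrix (Fin 2) (Fin 2) ℝ} (h : M ∈ i.lin) :
    M 0 1 = -M 1 0 ∧ M 1 1 = M 0 0 := by
  cases i with
  | full => obtain ⟨t, θ, rfl⟩ := h; simp [rot]
  | spiral α => obtain ⟨t, rfl⟩ := h; simp [rot]
  | rotations => obtain ⟨θ, rfl⟩ := h; simp [rot]

theorem DiagIndex.lin_entries (i : DiagIndex) {M : Matrix (Fin 2) (Fin 2) ℝ} (h : M ∈ i.lin) :
    M 0 1 = 0 ∧ M 1 0 = 0 := by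
  cases i with
  | full => obtain ⟨t, s, rfl⟩ := h; simp
  | curve β => obtain ⟨t, rfl⟩ := h; simp

theorem TriIndex.lin_entries (i : TriIndex) {M : Matrix (Fin 2) (Fin 2) ℝ} (h : M ∈ i.lin) :
    M 1 0 = 0 := by
  cases i with
  | full => obtain ⟨t, s, r, rfl⟩ := h; simp
  | param l => obtain ⟨t, s, rfl⟩ := h; simp
  | diagonals => obtain ⟨t, s, rfl⟩ := h; simp
  | scalarUnip => obtain ⟨t, s, rfl⟩ := h; simp
  | line l => obtain ⟨t, rfl⟩ := h; simp
  | unip => obtain ⟨t, rfl⟩ := h; simp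
  | jordan => obtain ⟨t, rfl⟩ := h; simp
  | scalars => obtain ⟨t, rfl⟩ := h; simp

/-- Here `N` plays the role of `h⁻¹` in `h†`. Only the pattern of the linear part matters:
conformal, diagonal, lower or upper triangular. -/
theorem Shape.transpose_mul_mul_mem (s : Shape) {N σ : Matrix (Fin 2) (Fin 2) ℝ} (hN : N ∈ s.lin)
    (hσ : σ ∈ s.vec) : Nᵀ * σ * N ∈ s.vec := by
  cases s with
  | one i =>
    obtain ⟨h1, h2⟩ := i.lin_entries hN
    obtain ⟨k1, k2, k3⟩ := mem_sigmaOne.1 hσ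
    refine mem_sigmaOne.2 ⟨?_, ?_, ?_⟩ <;>
      simp [Matrix.mul_apply, h1, h2, k1, k2, k3] <;> ring
  | onePerp i =>
    obtain ⟨h1, h2⟩ := i.lin_entries hN
    obtain ⟨k1, k2⟩ := mem_sigmaOnePerp.1 hσ
    refine mem_sigmaOnePerp.2 ⟨?_, ?_⟩ <;> simp [Matrix.mul_apply, h1, h2, k1, k2] <;> ring
  | neg i =>
    obtain ⟨h1, h2⟩ := i.lin_entries hN
    obtain ⟨k1, k2, k3⟩ := mem_sigmaNeg.1 hσ
    refine mem_sigmaNeg.2 ⟨?_, ?_, ?_⟩ <;>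
      simp [Matrix.mul_apply, h1, h2, k1, k2, k3]
    ring
  | negPerp i =>
    obtain ⟨h1, h2⟩ := i.lin_entries hN
    obtain ⟨k1, k2⟩ := mem_sigmaNegPerp.1 hσ
    refine mem_sigmaNegPerp.2 ⟨?_, ?_⟩ <;> simp [Matrix.mul_apply, h1, h2, k1, k2]
  | zero i =>
    have h1 : N 0 1 = 0 := i.lin_entries hN
    obtain ⟨k1, k2, k3⟩ := mem_sigmaZero.1 hσ
    refine mem_sigmaZero.2 ⟨?_, ?_, ?_⟩ <;> simp [Matrix.mul_apply, h1, k1, k2, k3]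
  | zeroPerp i =>
    have h1 := i.lin_entries hN
    obtain ⟨k1, k2⟩ := mem_sigmaZeroPerp.1 hσ
    refine mem_sigmaZeroPerp.2 ⟨?_, ?_⟩ <;> simp [Matrix.mul_apply, h1, k1, k2]
    ring

theorem Shape.exists_subgroup (s : Shape) : ∃ H : Subgroup (GL (Fin 2) ℝ), matSet H = s.lin ∧
    (s.alg : Set (Matrix (Fin 2) (Fin 2) ℝ)) = lieAlg H ∧ IsConnectedLieSubgroup H ∧ H ≠ ⊥ ∧
    ∀ h ∈ H, ∀ σ ∈ s.vec, dag h σ ∈ s.vec := by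
  obtain ⟨H, h1, h2, h3⟩ := s.isLieModel.exists_subgroup
  refine ⟨H, h1, h2, h3, ?_, ?_⟩
  -- The Lie algebra of the trivial group is zero, whereas that of a shape has positive dimension.
  · rintro rfl
    refine s.alg_ne_bot (le_bot_iff.1 fun X hX => ?_)
    have hX' : X ∈ lieAlg (⊥ : Subgroup (GL (Fin 2) ℝ)) := h2 ▸ hX
    refine (Submodule.mem_bot ℝ).2 (eq_of_forall_exp_smul_eq fun t => ?_)
    rw [smul_zero, NormedSpace.exp_zero]
    exact congrArg Units.val (Subgroup.mem_bot.1 (mem_lieAlg.1 hX' t))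
  · intro h hh σ hσ
    exact s.transpose_mul_mul_mem (h1 ▸ coe_mem_matSet.2 (H.inv_mem hh)) hσ

/-- Every entry of the list is a group of the class, of the stated dimension. -/
theorem Shape.exists_mem_E2 (s : Shape) : ∃ G ∈ E2,
    (G : Set (GL (Fin 2 ⊕ Fin 2) ℝ)) = s.entry.group ∧ lieDim G = s.entry.dim := by
  obtain ⟨H, h1, h2, h3, h4, h5⟩ := s.exists_subgroup
  refine ⟨semidirect s.vec H h5, ⟨?_, isConnectedLieSubgroup_semidirect h5 h3, s.vec, H,
    s.vec_ne_bot, s.vec_lt_Sym, h4, h3, rfl⟩, ?_, ?_⟩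
  · intro x hx
    obtain ⟨σ, hσ, h, -, rfl⟩ := (mem_semidirect h5).1 hx
    exact ⟨σ, s.vec_le_Sym hσ, h, rfl⟩
  · rw [s.group_entry, ← h1]
    rfl
  · rw [lieDim_semidirect h5 h2, s.finrank_vec, s.finrank_alg, s.dim_entry]

end Shapes

/-! ### Invariants separating the entries of the list -/

section NonConjugacy

open Matrix

theorem mem_span_pair_iff {a b x y : ℝ} (h : a ≠ 0 ∨ b ≠ 0) :
    (x, y) ∈ ℝ ∙ ((a, b) : ℝ × ℝ) ↔ x * b = y * a := by
  rw [Submodule.mem_span_singleton]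
  constructor
  · rintro ⟨t, e⟩
    simp only [Prod.smul_mk, smul_eq_mul, Prod.mk.injEq] at e
    rw [← e.1, ← e.2]
    ring
  · intro e
    rcases h with h | h
    · refine ⟨x / a, Prod.ext ?_ ?_⟩
      · simp [h]
      · simp only [Prod.smul_mk, smul_eq_mul]
        field_simp
        linarith
    · refine ⟨y / b, Prod.ext ?_ ?_⟩
      · simp only [Prod.smul_mk, smul_eq_mul]
        field_simp
        linarith
      · simp [h]

theorem mem_span_weight_iff {l x y : ℝ} :
    (x, y) ∈ ℝ ∙ ((l, l + 1) : ℝ × ℝ) ↔ x * (l + 1) = y * l :=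
  mem_span_pair_iff (by by_cases h : l = 0 <;> simp [h])

theorem mem_span_one_left_iff {b x y : ℝ} :
    (x, y) ∈ ℝ ∙ ((1, b) : ℝ × ℝ) ↔ x * b = y := by
  rw [mem_span_pair_iff (Or.inl one_ne_zero), mul_one]

/-- Two Lie algebras are conjugate by a matrix with given inverse. -/
def IsConjBy (M N : Matrix (Fin 2) (Fin 2) ℝ) (A B : Submodule ℝ (Matrix (Fin 2) (Fin 2) ℝ)) :
    Prop :=
  ∀ X, X ∈ B ↔ N * X * M ∈ A

theorem IsConjBy.symm {M N : Matrix (Fin 2) (Fin 2) ℝ}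
    {A B : Submodule ℝ (Matrix (Fin 2) (Fin 2) ℝ)} (h : IsConjBy M N A B) (hNM : N * M = 1) :
    IsConjBy N M B A := by
  intro X
  rw [h]
  simp only [← Matrix.mul_assoc, hNM, Matrix.one_mul]
  rw [Matrix.mul_assoc, hNM, Matrix.mul_one]

/-- The pairs (trace, determinant) of the elements of a set of matrices. -/
def TraceDet (A : Submodule ℝ (Matrix (Fin 2) (Fin 2) ℝ)) (x y : ℝ) : Prop :=
  ∃ X ∈ A, X 0 0 + X 1 1 = x ∧ X 0 0 * X 1 1 - X 0 1 * X 1 0 = y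

theorem IsConjBy.traceDet_imp {M N : Matrix (Fin 2) (Fin 2) ℝ}
    {A B : Submodule ℝ (Matrix (Fin 2) (Fin 2) ℝ)} (h : IsConjBy M N A B) (hMN : M * N = 1)
    {x y : ℝ} (hB : TraceDet B x y) : TraceDet A x y := by
  obtain ⟨X, hX, rfl, rfl⟩ := hB
  refine ⟨_, (h X).1 hX, ?_, ?_⟩
  · rw [← Matrix.trace_fin_two, ← Matrix.trace_fin_two, Matrix.trace_mul_cycle, hMN,
      Matrix.one_mul]
  · rw [← Matrix.det_fin_two, ← Matrix.det_fin_two, Matrix.det_mul, Matrix.det_mul, mul_comm,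
      ← mul_assoc, ← Matrix.det_mul, hMN, Matrix.det_one, one_mul]

theorem IsConjBy.traceDet_iff {M N : Matrix (Fin 2) (Fin 2) ℝ}
    {A B : Submodule ℝ (Matrix (Fin 2) (Fin 2) ℝ)} (h : IsConjBy M N A B) (hMN : M * N = 1)
    (x y : ℝ) : TraceDet B x y ↔ TraceDet A x y :=
  ⟨h.traceDet_imp hMN,
    (h.symm (mul_eq_one_comm.1 hMN)).traceDet_imp (mul_eq_one_comm.1 hMN)⟩

theorem traceDet_full_conf (x y : ℝ) :
    TraceDet (ConfIndex.full).alg x y ↔ ∃ a b : ℝ, 2 * a = x ∧ a * a + b * b = y := by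
  constructor
  · rintro ⟨_, ⟨⟨a, b⟩, -, rfl⟩, rfl, rfl⟩
    exact ⟨a, b, by simp [confLinear]; ring, by simp [confLinear]⟩
  · rintro ⟨a, b, rfl, rfl⟩
    exact ⟨_, ⟨(a, b), trivial, rfl⟩, by simp [confLinear]; ring, by simp [confLinear]⟩

theorem traceDet_spiral (α : Set.Ici (0 : ℝ)) (x y : ℝ) : TraceDet (ConfIndex.spiral α).alg x y ↔
    ∃ t : ℝ, 2 * t = x ∧ t * t * (1 + α * α) = y := by
  constructor
  · rintro ⟨X, hX, rfl, rfl⟩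
    obtain ⟨t, rfl⟩ := Submodule.mem_span_singleton.1 hX
    exact ⟨t, by simp [confLinear]; ring, by simp [confLinear]; ring⟩
  · rintro ⟨t, rfl, rfl⟩
    exact ⟨_, Submodule.mem_span_singleton.2 ⟨t, rfl⟩, by simp [confLinear]; ring,
      by simp [confLinear]; ring⟩

theorem traceDet_rotations (x y : ℝ) : TraceDet (ConfIndex.rotations).alg x y ↔
    ∃ t : ℝ, 0 = x ∧ t * t = y := by
  constructor
  · rintro ⟨X, hX, rfl, rfl⟩
    obtain ⟨t, rfl⟩ := Submodule.mem_span_singleton.1 hX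
    exact ⟨t, by simp [confLinear], by simp [confLinear]⟩
  · rintro ⟨t, rfl, rfl⟩
    exact ⟨_, Submodule.mem_span_singleton.2 ⟨t, rfl⟩, by simp [confLinear],
      by simp [confLinear]⟩

/-- The full algebra attains both `(0, 1)` and `(2, 1)`; the rotations miss the second pair, having
trace zero, and every spiral misses the first. At trace `2` the spiral of slope `α` has determinant
`1 + α²`, which determines `α ≥ 0`. -/
theorem ConfIndex.eq_of_traceDet {i j : ConfIndex}
    (h : ∀ x y, TraceDet i.alg x y ↔ TraceDet j.alg x y) : i = j := by
  have f01 : TraceDet ConfIndex.full.alg 0 1 := (traceDet_full_conf _ _).2 ⟨0, 1, by simp⟩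
  have f21 : TraceDet ConfIndex.full.alg 2 1 := (traceDet_full_conf _ _).2 ⟨1, 0, by simp⟩
  have r01 : TraceDet ConfIndex.rotations.alg 0 1 := (traceDet_rotations _ _).2 ⟨1, by simp⟩
  have r21 : ¬TraceDet ConfIndex.rotations.alg 2 1 := fun h => by
    obtain ⟨t, h1, -⟩ := (traceDet_rotations _ _).1 h
    norm_num at h1
  have s01 : ∀ α, ¬TraceDet (ConfIndex.spiral α).alg 0 1 := fun α h => by
    obtain ⟨t, h1, h2⟩ := (traceDet_spiral _ _ _).1 h
    obtain rfl : t = 0 := by linarith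
    norm_num at h2
  cases i with
  | full =>
    cases j with
    | full => rfl
    | spiral α => exact absurd ((h _ _).1 f01) (s01 α)
    | rotations => exact absurd ((h _ _).1 f21) r21
  | spiral α =>
    cases j with
    | full => exact absurd ((h _ _).2 f01) (s01 α)
    | spiral α' =>
      obtain ⟨t, h1, h2⟩ := (traceDet_spiral α' 2 (1 + α * α)).1
        ((h _ _).1 ((traceDet_spiral α _ _).2 ⟨1, by norm_num, by ring⟩))
      obtain rfl : t = 1 := by linarith
      have h3 : (α' : ℝ) = α := by
        rw [← mul_self_inj α'.2 α.2]
        linarith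
      rw [Subtype.ext h3]
    | rotations => exact absurd ((h _ _).2 r01) (s01 α)
  | rotations =>
    cases j with
    | full => exact absurd ((h _ _).2 f21) r21
    | spiral α => exact absurd ((h _ _).1 r01) (s01 α)
    | rotations => rfl

theorem traceDet_full_diag (a b : ℝ) : TraceDet (DiagIndex.full).alg (a + b) (a * b) :=
  ⟨_, ⟨(a, b), trivial, rfl⟩, by simp [diagLinear], by simp [diagLinear]⟩

theorem traceDet_curve (β : Set.Icc (-1 : ℝ) 1) (x y : ℝ) :
    TraceDet (DiagIndex.curve β).alg x y ↔ ∃ t : ℝ, t * (1 + β) = x ∧ t * t * β = y := by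
  constructor
  · rintro ⟨_, ⟨w, hw, rfl⟩, rfl, rfl⟩
    obtain ⟨t, rfl⟩ := Submodule.mem_span_singleton.1 hw
    exact ⟨t, by simp [diagLinear]; ring, by simp [diagLinear]; ring⟩
  · rintro ⟨t, rfl, rfl⟩
    exact ⟨_, ⟨_, Submodule.mem_span_singleton.2 ⟨t, rfl⟩, rfl⟩, by simp [diagLinear]; ring,
      by simp [diagLinear]; ring⟩

/-- Eigenvalues `1, -1` force `β = -1`; but then every trace vanishes, which excludes eigenvalues
`1, 0`. -/
theorem not_forall_traceDet_curve (β : Set.Icc (-1 : ℝ) 1) :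
    ¬∀ a b, TraceDet (DiagIndex.curve β).alg (a + b) (a * b) := by
  intro h
  obtain ⟨t, h1, h2⟩ := (traceDet_curve _ _ _).1 (h 1 (-1))
  obtain ⟨s, h3, h4⟩ := (traceDet_curve _ _ _).1 (h 1 0)
  have ht : t ≠ 0 := by
    rintro rfl
    norm_num at h2
  have hβ : 1 + (β : ℝ) = 0 := by
    have : t * (1 + (β : ℝ)) = 0 := by linarith
    exact (mul_eq_zero.1 this).resolve_left ht
  rw [hβ] at h3
  norm_num at h3

theorem DiagIndex.eq_of_traceDet {i j : DiagIndex}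
    (h : ∀ x y, TraceDet i.alg x y ↔ TraceDet j.alg x y) : i = j := by
  cases i with
  | full =>
    cases j with
    | full => rfl
    | curve β =>
      exact absurd (fun a b => (h _ _).1 (traceDet_full_diag a b)) (not_forall_traceDet_curve β)
  | curve β =>
    cases j with
    | full =>
      exact absurd (fun a b => (h _ _).2 (traceDet_full_diag a b)) (not_forall_traceDet_curve β)
    | curve β' =>
      obtain ⟨t, h1, h2⟩ := (traceDet_curve β' (1 + β) β).1
        ((h _ _).1 ((traceDet_curve β _ _).2 ⟨1, by ring, by ring⟩))
      have h3 : (β : ℝ) = β' := by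
        obtain ⟨b, hb1, hb2⟩ := β
        obtain ⟨c, hc1, hc2⟩ := β'
        simp only at h1 h2 ⊢
        -- The pairs `1, b` and `t, tc` have equal sums and products, so `1` is one of `t, tc`. In
        -- the second case `b = t` and `bc = 1`, which within `[-1, 1]` leaves only `b = c = ±1`.
        have hprod : (t - 1) * (t * c - 1) = 0 := by linear_combination h2 - h1
        rcases mul_eq_zero.1 hprod with ht | ht
        · obtain rfl : t = 1 := by linarith
          linarith
        · have hb : b = t := by linarith
          subst hb
          nlinarith
      rw [Subtype.ext h3]

/-- The pairs of diagonal entries of the elements of a set of matrices. -/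
def DiagPair (A : Submodule ℝ (Matrix (Fin 2) (Fin 2) ℝ)) (x y : ℝ) : Prop :=
  ∃ X ∈ A, X 0 0 = x ∧ X 1 1 = y

theorem TriIndex.apply_one_zero (i : TriIndex) {X : Matrix (Fin 2) (Fin 2) ℝ} (h : X ∈ i.alg) :
    X 1 0 = 0 := by
  cases i with
  | full => exact (mem_map_upperLinear.1 h).1
  | param l => exact (mem_map_upperLinear.1 h).1
  | diagonals => exact (mem_map_diagLinear.1 h).2.1
  | scalarUnip => exact (mem_map_upperLinear.1 h).1
  | line l => exact (mem_map_diagLinear.1 h).2.1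
  | unip => exact (mem_map_upperLinear.1 h).1
  | jordan =>
    obtain ⟨t, rfl⟩ := Submodule.mem_span_singleton.1 h
    simp [upperLinear]
  | scalars => exact (mem_map_diagLinear.1 h).2.1

/-- The invariants of a Lie algebra of upper triangular matrices under conjugation by upper
triangular matrices that separate the algebras of the list. -/
structure TriEquiv (A B : Submodule ℝ (Matrix (Fin 2) (Fin 2) ℝ)) : Prop where
  diagPair : ∀ x y, DiagPair A x y ↔ DiagPair B x y
  unip : !![0, 1; 0, 0] ∈ A ↔ !![0, 1; 0, 0] ∈ B
  one : 1 ∈ A ↔ 1 ∈ B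

/-- Triangular conjugation keeps each diagonal entry in its place, so the ordered pair is an
invariant. Trace and determinant would not suffice: they do not distinguish the weights `(l, l + 1)`
for `l` and for `-1 - l`. -/
theorem IsConjBy.diagPair_imp {M N : Matrix (Fin 2) (Fin 2) ℝ}
    {A : Submodule ℝ (Matrix (Fin 2) (Fin 2) ℝ)} {i : TriIndex} (h : IsConjBy M N A i.alg)
    (hMN : M * N = 1) (hM : M 1 0 = 0) (hN : N 1 0 = 0) {x y : ℝ}
    (hB : DiagPair i.alg x y) : DiagPair A x y := by
  obtain ⟨X, hX, rfl, rfl⟩ := hB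
  have h10 := i.apply_one_zero hX
  have h00 : M 0 0 * N 0 0 = 1 := by
    simpa [Matrix.mul_apply, hN] using congrFun (congrFun hMN 0) 0
  have h11 : M 1 1 * N 1 1 = 1 := by
    simpa [Matrix.mul_apply, hM] using congrFun (congrFun hMN 1) 1
  refine ⟨_, (h X).1 hX, ?_, ?_⟩
  · simp only [Matrix.mul_apply, Fin.sum_univ_two, h10, hM]
    linear_combination X 0 0 * h00
  · simp only [Matrix.mul_apply, Fin.sum_univ_two, h10, hN]
    linear_combination X 1 1 * h11

theorem IsConjBy.triEquiv {M N : Matrix (Fin 2) (Fin 2) ℝ} {i j : TriIndex}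
    (h : IsConjBy M N i.alg j.alg) (hMN : M * N = 1) (hM : M 1 0 = 0) (hN : N 1 0 = 0) :
    TriEquiv i.alg j.alg := by
  have hNM := mul_eq_one_comm.1 hMN
  have h00 : M 0 0 * N 0 0 = 1 := by
    simpa [Matrix.mul_apply, hN] using congrFun (congrFun hMN 0) 0
  have h11 : M 1 1 * N 1 1 = 1 := by
    simpa [Matrix.mul_apply, hM] using congrFun (congrFun hMN 1) 1
  refine ⟨fun x y => ⟨(h.symm hNM).diagPair_imp hNM hN hM, h.diagPair_imp hMN hM hN⟩, ?_, ?_⟩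
  · rw [h]
    -- The strictly upper triangular line is stable under triangular conjugation, and its generator
    -- is multiplied by a nonzero factor.
    have : N * !![0, 1; 0, 0] * M = (N 0 0 * M 1 1) • !![0, 1; 0, 0] := by
      ext a b
      fin_cases a <;> fin_cases b <;> simp [Matrix.mul_apply, hM, hN]
    rw [this]
    refine (Submodule.smul_mem_iff _ (mul_ne_zero ?_ ?_)).symm
    · exact right_ne_zero_of_mul_eq_one h00
    · exact left_ne_zero_of_mul_eq_one h11
  · rw [h, Matrix.mul_one, hNM]

/-- Explicit description of the Lie algebra of an index. -/
def TriIndex.Cond : TriIndex → Matrix (Fin 2) (Fin 2) ℝ → Prop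
  | .full, X => X 1 0 = 0
  | .param l, X => X 1 0 = 0 ∧ X 0 0 * (l + 1) = X 1 1 * l
  | .diagonals, X => X 0 1 = 0 ∧ X 1 0 = 0
  | .scalarUnip, X => X 1 0 = 0 ∧ X 0 0 = X 1 1
  | .line l, X => X 0 1 = 0 ∧ X 1 0 = 0 ∧ X 0 0 * (l + 1) = X 1 1 * l
  | .unip, X => X 1 0 = 0 ∧ X 0 0 = 0 ∧ X 1 1 = 0
  | .jordan, X => X 1 0 = 0 ∧ X 0 0 = X 1 1 ∧ X 0 1 = X 1 1
  | .scalars, X => X 0 1 = 0 ∧ X 1 0 = 0 ∧ X 0 0 = X 1 1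

theorem TriIndex.mem_alg (i : TriIndex) {X : Matrix (Fin 2) (Fin 2) ℝ} :
    X ∈ i.alg ↔ i.Cond X := by
  cases i with
  | full => exact mem_map_upperLinear.trans (by simp [TriIndex.Cond])
  | param l => exact mem_map_upperLinear.trans (by simp [TriIndex.Cond, mem_span_weight_iff])
  | diagonals => exact mem_map_diagLinear.trans (by simp [TriIndex.Cond])
  | scalarUnip => exact mem_map_upperLinear.trans (by simp [TriIndex.Cond, mem_span_one_left_iff])
  | line l => exact mem_map_diagLinear.trans (by simp [TriIndex.Cond, mem_span_weight_iff])
  | unip => exact mem_map_upperLinear.trans (by simp [TriIndex.Cond])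
  | jordan =>
    refine Submodule.mem_span_singleton.trans ⟨?_, ?_⟩
    · rintro ⟨t, rfl⟩
      simp [TriIndex.Cond, upperLinear]
    · rintro ⟨h1, h2, h3⟩
      refine ⟨X 1 1, ?_⟩
      ext a b
      fin_cases a <;> fin_cases b <;> simp [upperLinear, h1, h2, h3]
  | scalars => exact mem_map_diagLinear.trans (by simp [TriIndex.Cond, mem_span_one_left_iff])

/-- Explicit description of the diagonal parts. -/
def TriIndex.DiagCond : TriIndex → ℝ → ℝ → Prop
  | .full, _, _ => True
  | .param l, x, y => x * (l + 1) = y * l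
  | .diagonals, _, _ => True
  | .scalarUnip, x, y => x = y
  | .line l, x, y => x * (l + 1) = y * l
  | .unip, x, y => x = 0 ∧ y = 0
  | .jordan, x, y => x = y
  | .scalars, x, y => x = y

theorem TriIndex.diagPair_iff (i : TriIndex) (x y : ℝ) :
    DiagPair i.alg x y ↔ i.DiagCond x y := by
  constructor
  · rintro ⟨X, hX, rfl, rfl⟩
    rw [TriIndex.mem_alg] at hX
    cases i <;> simp only [TriIndex.Cond] at hX <;> simp [TriIndex.DiagCond, hX]
  · intro h
    -- A zero corner is admissible in every algebra except the Jordan one, where the corner equals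
    -- the diagonal entries.
    by_cases hi : i = .jordan
    · subst hi
      refine ⟨!![x, y; 0, y], (TriIndex.mem_alg _).2 ?_, rfl, rfl⟩
      simpa [TriIndex.Cond] using show x = y from h
    · refine ⟨!![x, 0; 0, y], (TriIndex.mem_alg _).2 ?_, rfl, rfl⟩
      cases i <;> simp [TriIndex.DiagCond] at h hi <;> simp [TriIndex.Cond, h]

/-- The nilpotent `[0, 1; 0, 0]` divides the eight types into two groups of four. Within each group
the diagonal pairs decide, since weights `(l, l + 1)` and `(l', l' + 1)` are proportional only if `l
= l'`; the one exception is Jordan against scalars, which the identity matrix settles. -/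
theorem TriIndex.eq_of_triEquiv {i j : TriIndex} (h : TriEquiv i.alg j.alg) : i = j := by
  have hu := h.unip
  have ho := h.one
  have hd := h.diagPair
  simp only [TriIndex.diagPair_iff] at hd
  have d10 := hd 1 0
  have d11 := hd 1 1
  have d01 := hd 0 1
  have dl : ∀ l, _ := fun l => hd l (l + 1)
  rw [TriIndex.mem_alg, TriIndex.mem_alg] at hu ho
  rcases i with _ | l | _ | _ | l | _ | _ | _ <;> rcases j with _ | l' | _ | _ | l' | _ | _ | _ <;>
    first
    | rfl
    | (exfalso; simp [TriIndex.Cond] at hu; done)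
    | (exfalso; simp [TriIndex.Cond] at ho; done)
    | (exfalso; simp [TriIndex.DiagCond] at d10 d01 d11 dl; done)
    | (have e : l * (l' + 1) = (l + 1) * l' := (dl l).1 (mul_comm _ _)
       congr 1
       linarith)
    | (have e : l = 0 ∧ l + 1 = 0 := (dl l).1 (mul_comm _ _)
       linarith)
    | (have e : l' = 0 ∧ l' + 1 = 0 := (dl l').2 (mul_comm _ _)
       linarith)

/-- Everything that conjugacy of the groups says about the pairs `(Σ, A)`, in terms of the matrices
`M = g` and `N = g⁻¹`. -/
theorem Shape.conj_data {s s' : Shape} {g : GL (Fin 2) ℝ}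
    (h : conjSet g s.entry.group = s'.entry.group) : ∃ M N : Matrix (Fin 2) (Fin 2) ℝ,
    M * N = 1 ∧ N * M = 1 ∧ (∀ σ ∈ s.vec, Nᵀ * σ * N ∈ s'.vec) ∧
      (∀ σ ∈ s'.vec, Mᵀ * σ * M ∈ s.vec) ∧ IsConjBy M N s.alg s'.alg := by
  obtain ⟨H, h1, h2, -⟩ := s.exists_subgroup
  obtain ⟨H', h1', h2', -⟩ := s'.exists_subgroup
  have hmap : dag g '' (s.vec : Set _) = (s.vec.map (dagLinear g) : Submodule ℝ _) := rfl
  rw [s.group_entry, s'.group_entry, ← h1, ← h1', conjSet_semidirectSet, hmap] at h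
  obtain ⟨hv, rfl⟩ := semidirectSet_inj h
  have hv1 : ∀ σ ∈ s.vec, dag g σ ∈ s'.vec := fun σ hσ => hv ▸ ⟨σ, hσ, rfl⟩
  refine ⟨g, (g⁻¹ : GL (Fin 2) ℝ), g.mul_inv, g.inv_mul, hv1, ?_, ?_⟩
  · intro σ hσ
    rw [← hv] at hσ
    obtain ⟨τ, hτ, rfl⟩ := hσ
    have : dag g⁻¹ (dag g τ) = τ := by rw [← dag_mul, inv_mul_cancel, dag_one]
    rw [dagLinear_apply]
    simp only [dag, inv_inv] at this ⊢
    rw [this]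
    exact hτ
  · intro X
    rw [← SetLike.mem_coe, h2', mem_lieAlg_conjGL, ← h2]
    rfl

/-- Which signs of determinants occur in the vector part, and its dimension. -/
def Shape.vecType : Shape → Bool × Bool × Bool × ℕ
  | .one _ => (true, false, false, 1)
  | .onePerp _ => (false, true, false, 2)
  | .neg _ => (false, true, false, 1)
  | .negPerp _ => (true, true, true, 2)
  | .zero _ => (false, false, true, 1)
  | .zeroPerp _ => (false, true, true, 2)

theorem Shape.exists_det_pos (s : Shape) :
    s.vecType.1 = true ↔ ∃ σ ∈ s.vec, 0 < σ.det := by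
  cases s with
  | one i =>
    refine iff_of_true rfl ⟨!![1, 0; 0, 1], mem_sigmaOne.2 (by simp), by simp [det_fin_two]⟩
  | onePerp i =>
    refine iff_of_false (by simp [Shape.vecType]) ?_
    rintro ⟨σ, hσ, hd⟩
    rw [det_fin_two, (mem_sigmaOnePerp.1 hσ).1, (mem_sigmaOnePerp.1 hσ).2] at hd
    nlinarith [sq_nonneg (σ 0 0), sq_nonneg (σ 0 1)]
  | neg i =>
    refine iff_of_false (by simp [Shape.vecType]) ?_
    rintro ⟨σ, hσ, hd⟩
    obtain ⟨h1, h2, h3⟩ := mem_sigmaNeg.1 hσ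
    rw [det_fin_two, h1, h2, h3] at hd
    nlinarith [sq_nonneg (σ 0 1)]
  | negPerp i =>
    refine iff_of_true rfl ⟨!![1, 0; 0, 1], mem_sigmaNegPerp.2 (by simp), by simp [det_fin_two]⟩
  | zero i =>
    refine iff_of_false (by simp [Shape.vecType]) ?_
    rintro ⟨σ, hσ, hd⟩
    obtain ⟨h1, h2, h3⟩ := mem_sigmaZero.1 hσ
    rw [det_fin_two, h1, h2, h3] at hd
    simp at hd
  | zeroPerp i =>
    refine iff_of_false (by simp [Shape.vecType]) ?_
    rintro ⟨σ, hσ, hd⟩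
    obtain ⟨h1, h2⟩ := mem_sigmaZeroPerp.1 hσ
    rw [det_fin_two, h1, h2] at hd
    nlinarith [sq_nonneg (σ 0 1)]

theorem Shape.exists_det_neg (s : Shape) :
    s.vecType.2.1 = true ↔ ∃ σ ∈ s.vec, σ.det < 0 := by
  cases s with
  | one i =>
    refine iff_of_false (by simp [Shape.vecType]) ?_
    rintro ⟨σ, hσ, hd⟩
    obtain ⟨h1, h2, h3⟩ := mem_sigmaOne.1 hσ
    rw [det_fin_two, h1, h2, h3] at hd
    nlinarith [sq_nonneg (σ 0 0)]
  | onePerp i =>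
    refine iff_of_true rfl ⟨!![0, 1; 1, 0], mem_sigmaOnePerp.2 (by simp), by simp [det_fin_two]⟩
  | neg i =>
    refine iff_of_true rfl ⟨!![0, 1; 1, 0], mem_sigmaNeg.2 (by simp), by simp [det_fin_two]⟩
  | negPerp i =>
    refine iff_of_true rfl ⟨!![1, 0; 0, -1], mem_sigmaNegPerp.2 (by simp), by simp [det_fin_two]⟩
  | zero i =>
    refine iff_of_false (by simp [Shape.vecType]) ?_
    rintro ⟨σ, hσ, hd⟩
    obtain ⟨h1, h2, h3⟩ := mem_sigmaZero.1 hσ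
    rw [det_fin_two, h1, h2, h3] at hd
    simp at hd
  | zeroPerp i =>
    refine iff_of_true rfl ⟨!![0, 1; 1, 0], mem_sigmaZeroPerp.2 (by simp), by simp [det_fin_two]⟩

theorem Shape.exists_det_zero (s : Shape) :
    s.vecType.2.2.1 = true ↔ ∃ σ ∈ s.vec, σ ≠ 0 ∧ σ.det = 0 := by
  have hne : ∀ {M : Matrix (Fin 2) (Fin 2) ℝ} {i j}, M i j = 1 → M ≠ 0 := by
    rintro M i j h rfl
    simp at h
  cases s with
  | one i =>
    refine iff_of_false (by simp [Shape.vecType]) ?_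
    rintro ⟨σ, hσ, h0, hd⟩
    obtain ⟨h1, h2, h3⟩ := mem_sigmaOne.1 hσ
    rw [det_fin_two, h1, h2, h3] at hd
    have : σ 0 0 = 0 := by nlinarith
    exact h0 (by ext a b; fin_cases a <;> fin_cases b <;> simp [h1, h2, h3, this])
  | onePerp i =>
    refine iff_of_false (by simp [Shape.vecType]) ?_
    rintro ⟨σ, hσ, h0, hd⟩
    obtain ⟨h1, h2⟩ := mem_sigmaOnePerp.1 hσ
    rw [det_fin_two, h1, h2] at hd
    have h3 : σ 0 0 = 0 := by nlinarith [sq_nonneg (σ 0 0), sq_nonneg (σ 0 1)]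
    have h4 : σ 0 1 = 0 := by nlinarith [sq_nonneg (σ 0 0), sq_nonneg (σ 0 1)]
    exact h0 (by ext a b; fin_cases a <;> fin_cases b <;> simp [h1, h2, h3, h4])
  | neg i =>
    refine iff_of_false (by simp [Shape.vecType]) ?_
    rintro ⟨σ, hσ, h0, hd⟩
    obtain ⟨h1, h2, h3⟩ := mem_sigmaNeg.1 hσ
    rw [det_fin_two, h1, h2, h3] at hd
    have : σ 0 1 = 0 := by nlinarith
    exact h0 (by ext a b; fin_cases a <;> fin_cases b <;> simp [h1, h2, h3, this])
  | negPerp i =>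
    exact iff_of_true rfl ⟨!![1, 0; 0, 0], mem_sigmaNegPerp.2 (by simp),
      hne (i := 0) (j := 0) rfl, by simp [det_fin_two]⟩
  | zero i =>
    exact iff_of_true rfl ⟨!![1, 0; 0, 0], mem_sigmaZero.2 (by simp),
      hne (i := 0) (j := 0) rfl, by simp [det_fin_two]⟩
  | zeroPerp i =>
    exact iff_of_true rfl ⟨!![0, 0; 0, 1], mem_sigmaZeroPerp.2 (by simp),
      hne (i := 1) (j := 1) rfl, by simp [det_fin_two]⟩

/-- Congruence multiplies determinants by a nonzero square, so it preserves their signs. These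
separate all vector parts except `onePerp` and `neg`, which differ in dimension. -/
theorem Shape.vecType_eq {s s' : Shape} {g : GL (Fin 2) ℝ}
    (h : conjSet g s.entry.group = s'.entry.group) : s.vecType = s'.vecType := by
  obtain ⟨M, N, hMN, hNM, hv, hv', -⟩ := Shape.conj_data h
  have hsq : ∀ {M N : Matrix (Fin 2) (Fin 2) ℝ}, M * N = 1 → 0 < N.det * N.det := by
    intro M N h
    have h1 : M.det * N.det = 1 := by rw [← Matrix.det_mul, h, Matrix.det_one]
    have h2 : N.det ≠ 0 := right_ne_zero_of_mul_eq_one h1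
    exact mul_self_pos.2 h2
  have hdet : ∀ N σ : Matrix (Fin 2) (Fin 2) ℝ,
      (Nᵀ * σ * N).det = N.det * N.det * σ.det := by
    intro N σ
    rw [Matrix.det_mul, Matrix.det_mul, Matrix.det_transpose]
    ring
  have hzero : ∀ {M N σ : Matrix (Fin 2) (Fin 2) ℝ}, M * N = 1 → Nᵀ * σ * N = 0 → σ = 0 := by
    intro M N σ h h0
    have h1 : N * M = 1 := mul_eq_one_comm.1 h
    have h2 : Mᵀ * Nᵀ = 1 := by rw [← Matrix.transpose_mul, h1, Matrix.transpose_one]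
    calc σ = Mᵀ * Nᵀ * σ * (N * M) := by rw [h1, h2, Matrix.one_mul, Matrix.mul_one]
      _ = Mᵀ * (Nᵀ * σ * N) * M := by simp only [Matrix.mul_assoc]
      _ = 0 := by rw [h0, Matrix.mul_zero, Matrix.zero_mul]
  have e1 : s.vecType.1 = s'.vecType.1 := by
    rw [Bool.eq_iff_iff, Shape.exists_det_pos, Shape.exists_det_pos]
    constructor
    · rintro ⟨σ, hσ, hd⟩
      exact ⟨_, hv σ hσ, by rw [hdet]; exact mul_pos (hsq hMN) hd⟩
    · rintro ⟨σ, hσ, hd⟩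
      exact ⟨_, hv' σ hσ, by rw [hdet]; exact mul_pos (hsq hNM) hd⟩
  have e2 : s.vecType.2.1 = s'.vecType.2.1 := by
    rw [Bool.eq_iff_iff, Shape.exists_det_neg, Shape.exists_det_neg]
    constructor
    · rintro ⟨σ, hσ, hd⟩
      exact ⟨_, hv σ hσ, by rw [hdet]; exact mul_neg_of_pos_of_neg (hsq hMN) hd⟩
    · rintro ⟨σ, hσ, hd⟩
      exact ⟨_, hv' σ hσ, by rw [hdet]; exact mul_neg_of_pos_of_neg (hsq hNM) hd⟩
  have e3 : s.vecType.2.2.1 = s'.vecType.2.2.1 := by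
    rw [Bool.eq_iff_iff, Shape.exists_det_zero, Shape.exists_det_zero]
    constructor
    · rintro ⟨σ, hσ, h0, hd⟩
      exact ⟨_, hv σ hσ, fun h => h0 (hzero hMN h), by rw [hdet, hd, mul_zero]⟩
    · rintro ⟨σ, hσ, h0, hd⟩
      exact ⟨_, hv' σ hσ, fun h => h0 (hzero hNM h), by rw [hdet, hd, mul_zero]⟩
  have e4 : s.vecType.2.2.2 = s'.vecType.2.2.2 := by
    have hdim : ∀ s : Shape, s.vecType.2.2.2 = Module.finrank ℝ s.vec := by
      intro s
      rw [s.finrank_vec]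
      cases s <;> rfl
    have key : ∀ {s s' : Shape} {M N : Matrix (Fin 2) (Fin 2) ℝ}, M * N = 1 →
        (∀ σ ∈ s.vec, Nᵀ * σ * N ∈ s'.vec) →
        Module.finrank ℝ s.vec ≤ Module.finrank ℝ s'.vec := by
      intro s s' M N h hv
      let f : Matrix (Fin 2) (Fin 2) ℝ →ₗ[ℝ] Matrix (Fin 2) (Fin 2) ℝ :=
        { toFun := fun σ => Nᵀ * σ * N
          map_add' := by simp [Matrix.mul_add, Matrix.add_mul]
          map_smul' := by simp }
      have hf : Function.Injective f := (injective_iff_map_eq_zero f).2 fun σ => hzero h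
      rw [← finrank_map_of_injective hf]
      refine Submodule.finrank_mono ?_
      rintro _ ⟨σ, hσ, rfl⟩
      exact hv σ hσ
    rw [hdim, hdim]
    exact le_antisymm (key hMN hv) (key hNM hv')
  exact Prod.ext e1 (Prod.ext e2 (Prod.ext e3 e4))

theorem IsConjBy.of_comap_transpose {M N : Matrix (Fin 2) (Fin 2) ℝ}
    {A B : Submodule ℝ (Matrix (Fin 2) (Fin 2) ℝ)}
    (h : IsConjBy M N (A.comap transposeLinear) (B.comap transposeLinear)) :
    IsConjBy Nᵀ Mᵀ A B := by
  intro X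
  have := h Xᵀ
  simpa only [mem_comap_transposeLinear, Matrix.transpose_mul, Matrix.transpose_transpose,
    Matrix.mul_assoc] using this

/-- Different entries of the list are not conjugate. -/
theorem Shape.eq_of_conjSet {s s' : Shape} {g : GL (Fin 2) ℝ}
    (h : conjSet g s.entry.group = s'.entry.group) : s = s' := by
  have ht := Shape.vecType_eq h
  obtain ⟨M, N, hMN, hNM, hv, hv', hc⟩ := Shape.conj_data h
  cases s <;> cases s' <;> first | (exfalso; simp [Shape.vecType] at ht; done) | skip
  · congr 1
    exact ConfIndex.eq_of_traceDet fun x y => (hc.traceDet_iff hMN x y).symm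
  · congr 1
    exact ConfIndex.eq_of_traceDet fun x y => (hc.traceDet_iff hMN x y).symm
  · congr 1
    exact DiagIndex.eq_of_traceDet fun x y => (hc.traceDet_iff hMN x y).symm
  · congr 1
    exact DiagIndex.eq_of_traceDet fun x y => (hc.traceDet_iff hMN x y).symm
  · congr 1
    -- The conjugating matrix preserves the line of `[1, 0; 0, 0]`; the lower right entry of the
    -- transformed matrix is the square of `N 0 1`, so `N` is lower triangular.
    have key : ∀ {N : Matrix (Fin 2) (Fin 2) ℝ},
        (∀ σ ∈ ℝ ∙ (!![1, 0; 0, 0] : Matrix (Fin 2) (Fin 2) ℝ),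
          Nᵀ * σ * N ∈ ℝ ∙ (!![1, 0; 0, 0] : Matrix (Fin 2) (Fin 2) ℝ)) → N 0 1 = 0 := by
      intro N h
      have := (mem_sigmaZero.1 (h _ (Submodule.mem_span_singleton_self _))).2.2
      simpa [Matrix.mul_apply] using this
    refine TriIndex.eq_of_triEquiv (hc.of_comap_transpose.triEquiv ?_ (key hv) (key hv'))
    rw [← Matrix.transpose_mul, hMN, Matrix.transpose_one]
  · congr 1
    -- Tested on `[0, 0; 0, 1]`, the upper left entry of the transform is the square of `N 1 0`, so
    -- `N` is upper triangular.
    have key : ∀ {N : Matrix (Fin 2) (Fin 2) ℝ},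
        (∀ σ ∈ LinearMap.range zeroPerpLinear,
          Nᵀ * σ * N ∈ LinearMap.range zeroPerpLinear) → N 1 0 = 0 := by
      intro N h
      have := (mem_sigmaZeroPerp.1 (h !![0, 0; 0, 1] (mem_sigmaZeroPerp.2 (by simp)))).1
      simpa [Matrix.mul_apply] using this
    exact TriIndex.eq_of_triEquiv (hc.triEquiv hMN (key hv') (key hv))

end NonConjugacy

/-! ### Reduction of every group of the class to the list -/

section Classification

open Matrix

/-- Normal forms of binary quadratic forms under congruence and scaling. -/
theorem exists_congruence_normal_form {σ : Matrix (Fin 2) (Fin 2) ℝ} (hσ : σ 1 0 = σ 0 1)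
    (h0 : σ ≠ 0) : ∃ N : Matrix (Fin 2) (Fin 2) ℝ, N.det ≠ 0 ∧ ∃ c : ℝ, c ≠ 0 ∧
      (Nᵀ * σ * N = c • !![1, 0; 0, 1] ∨ Nᵀ * σ * N = c • !![1, 0; 0, 0] ∨
        Nᵀ * σ * N = c • !![0, 1; 1, 0]) := by
  obtain ⟨a, b, d, rfl⟩ : ∃ a b d, σ = !![a, b; b, d] :=
    ⟨σ 0 0, σ 0 1, σ 1 1, by ext i j; fin_cases i <;> fin_cases j <;> simp [hσ]⟩
  by_cases ha : a = 0
  · subst ha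
    by_cases hb : b = 0
    · subst hb
      have hd : d ≠ 0 := by
        rintro rfl
        exact h0 (by ext i j; fin_cases i <;> fin_cases j <;> rfl)
      refine ⟨!![0, 1; 1, 0], by simp [det_fin_two], d, hd, Or.inr (Or.inl ?_)⟩
      ext i j
      fin_cases i <;> fin_cases j <;> simp [Matrix.mul_apply]
    -- The form is `y (2bx + dy)`; a shear absorbs the square term.
    · refine ⟨!![1, -d / (2 * b); 0, 1], by simp [det_fin_two], b, hb, Or.inr (Or.inr ?_)⟩
      ext i j
      fin_cases i <;> fin_cases j <;> simp [Matrix.mul_apply]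
      field_simp
      ring
  · rcases lt_trichotomy (a * d - b * b) 0 with hd | hd | hd
    · have hr : 0 < Real.sqrt (b * b - a * d) := Real.sqrt_pos.2 (by linarith)
      have hr2 : Real.sqrt (b * b - a * d) * Real.sqrt (b * b - a * d) = b * b - a * d :=
        Real.mul_self_sqrt (by linarith)
      set r := Real.sqrt (b * b - a * d)
      have hd' : d = (b * b - r * r) / a := by field_simp; linarith
      -- The columns are the two isotropic vectors of the indefinite form, and the scalar is their
      -- mutual value.
      refine ⟨!![-b + r, -b - r; a, a], ?_, -(2 * a * (r * r)),
        by simp [ha, hr.ne'], Or.inr (Or.inr ?_)⟩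
      · rw [det_fin_two]
        simp only [of_apply, cons_val', cons_val_zero, cons_val_one, cons_val_fin_one]
        rw [show (-b + r) * a - (-b - r) * a = 2 * r * a by ring]
        simp [ha, hr.ne']
      · rw [hd']
        ext i j
        fin_cases i <;> fin_cases j <;> simp [Matrix.mul_apply] <;> field_simp <;> ring
    · have hd' : d = b * b / a := by field_simp; linarith
      -- The second column spans the kernel of the degenerate form.
      refine ⟨!![1, -b / a; 0, 1], by simp [det_fin_two], a, ha, Or.inr (Or.inl ?_)⟩
      rw [hd']
      ext i j
      fin_cases i <;> fin_cases j <;> simp [Matrix.mul_apply] <;> field_simp <;> ring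
    · have hr : 0 < Real.sqrt (a * d - b * b) := Real.sqrt_pos.2 hd
      have hr2 : Real.sqrt (a * d - b * b) * Real.sqrt (a * d - b * b) = a * d - b * b :=
        Real.mul_self_sqrt hd.le
      set r := Real.sqrt (a * d - b * b)
      have hd' : d = (b * b + r * r) / a := by field_simp; linarith
      -- The columns are orthogonal for the form, scaled so that it takes the value `a r²` on both.
      refine ⟨!![r, -b; 0, a], by simp [det_fin_two, ha, hr.ne'], a * (r * r),
        by simp [ha, hr.ne'], Or.inl ?_⟩
      rw [hd']
      ext i j
      fin_cases i <;> fin_cases j <;> simp [Matrix.mul_apply] <;> field_simp <;>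
        first | ring1 | (left; ring1)

/-- The six normal forms of lines and planes of symmetric matrices. -/
def IsNormalVec (V : Submodule ℝ (Matrix (Fin 2) (Fin 2) ℝ)) : Prop :=
  V = ℝ ∙ !![1, 0; 0, 1] ∨ V = LinearMap.range onePerpLinear ∨ V = ℝ ∙ !![0, 1; 1, 0] ∨
    V = LinearMap.range diagLinear ∨ V = ℝ ∙ !![1, 0; 0, 0] ∨ V = LinearMap.range zeroPerpLinear

/-- An invertible matrix with given inverse. -/
def mkGL (M N : Matrix (Fin 2) (Fin 2) ℝ) (h : M * N = 1) : GL (Fin 2) ℝ :=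
  ⟨M, N, h, mul_eq_one_comm.1 h⟩

theorem exists_mkGL_inv {N : Matrix (Fin 2) (Fin 2) ℝ} (h : N.det ≠ 0) :
    ∃ g : GL (Fin 2) ℝ, ((g⁻¹ : GL (Fin 2) ℝ) : Matrix (Fin 2) (Fin 2) ℝ) = N := by
  refine ⟨(Matrix.GeneralLinearGroup.mkOfDetNeZero N h)⁻¹, ?_⟩
  rw [inv_inv]
  rfl

theorem exists_isNormalVec_of_line {σ : Matrix (Fin 2) (Fin 2) ℝ} (hσ : σ ∈ Sym 2)
    (h0 : σ ≠ 0) : ∃ g : GL (Fin 2) ℝ, IsNormalVec ((ℝ ∙ σ).map (dagLinear g)) := by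
  obtain ⟨N, hN, c, hc, h⟩ := exists_congruence_normal_form (mem_Sym_two.1 hσ) h0
  obtain ⟨g, hg⟩ := exists_mkGL_inv hN
  refine ⟨g, ?_⟩
  have hspan : ∀ T : Matrix (Fin 2) (Fin 2) ℝ, Nᵀ * σ * N = c • T →
      (ℝ ∙ σ).map (dagLinear g) = ℝ ∙ T := by
    intro T hT
    rw [LinearMap.map_span, Set.image_singleton, dagLinear_apply, dag, hg, hT]
    exact Submodule.span_singleton_smul_eq hc.isUnit T
  rcases h with h | h | h
  · exact Or.inl (hspan _ h)
  · exact Or.inr (Or.inr (Or.inr (Or.inr (Or.inl (hspan _ h)))))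
  · exact Or.inr (Or.inr (Or.inl (hspan _ h)))

/-- By cyclicity of the trace, moving the plane by `g†` with `g = Nᵀ` replaces its annihilator `ρ`
by `NᵀρN`. The normal forms of `ρ` therefore give those of planes. -/
theorem exists_isNormalVec_of_plane {S : Submodule ℝ (Matrix (Fin 2) (Fin 2) ℝ)}
    {ρ : Matrix (Fin 2) (Fin 2) ℝ} (hρ : ρ ∈ Sym 2) (h0 : ρ ≠ 0)
    (hS : ∀ σ, σ ∈ S ↔ σ ∈ Sym 2 ∧ (ρ * σ).trace = 0) :
    ∃ g : GL (Fin 2) ℝ, IsNormalVec (S.map (dagLinear g)) := by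
  obtain ⟨N, hN, c, hc, h⟩ := exists_congruence_normal_form (mem_Sym_two.1 hρ) h0
  obtain ⟨g, hg⟩ : ∃ g : GL (Fin 2) ℝ, (g : Matrix (Fin 2) (Fin 2) ℝ) = Nᵀ :=
    ⟨Matrix.GeneralLinearGroup.mkOfDetNeZero Nᵀ (by rwa [Matrix.det_transpose]), rfl⟩
  refine ⟨g, ?_⟩
  have hmem : ∀ T : Matrix (Fin 2) (Fin 2) ℝ, Nᵀ * ρ * N = c • T → ∀ τ,
      τ ∈ S.map (dagLinear g) ↔ τ ∈ Sym 2 ∧ (T * τ).trace = 0 := by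
    intro T hT τ
    have h1 : τ ∈ S.map (dagLinear g) ↔ dag g⁻¹ τ ∈ S := by
      constructor
      · rintro ⟨σ, hσ, rfl⟩
        rw [dagLinear_apply, ← dag_mul, inv_mul_cancel, dag_one]
        exact hσ
      · intro h
        exact ⟨_, h, by rw [dagLinear_apply, ← dag_mul, mul_inv_cancel, dag_one]⟩
    have h2 : dag g⁻¹ τ ∈ Sym 2 ↔ τ ∈ Sym 2 := by
      refine ⟨fun h => ?_, dag_mem_Sym _⟩
      have := dag_mem_Sym g h
      rwa [← dag_mul, mul_inv_cancel, dag_one] at this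
    have h3 : (ρ * dag g⁻¹ τ).trace = c * (T * τ).trace := by
      rw [dag, inv_inv, hg, Matrix.transpose_transpose, ← smul_eq_mul c, ← Matrix.trace_smul,
        ← Matrix.smul_mul, ← hT, ← Matrix.mul_assoc, ← Matrix.mul_assoc, Matrix.trace_mul_comm]
      simp only [Matrix.mul_assoc]
    rw [h1, hS, h2, h3, mul_eq_zero, or_iff_right hc]
  rcases h with h | h | h
  · refine Or.inr (Or.inl ?_)
    ext τ
    rw [hmem _ h, mem_sigmaOnePerp, mem_Sym_two, Matrix.trace_fin_two]
    refine and_congr_right fun _ => ?_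
    simp [-Matrix.cons_mul, Matrix.mul_apply]
    exact ⟨fun h => by linarith, fun h => by linarith⟩
  · refine Or.inr (Or.inr (Or.inr (Or.inr (Or.inr ?_))))
    ext τ
    rw [hmem _ h, mem_sigmaZeroPerp, mem_Sym_two, Matrix.trace_fin_two, and_comm]
    simp [-Matrix.cons_mul, Matrix.mul_apply]
  · refine Or.inr (Or.inr (Or.inr (Or.inl ?_)))
    ext τ
    rw [hmem _ h, mem_sigmaNegPerp, mem_Sym_two, Matrix.trace_fin_two]
    simp [-Matrix.cons_mul, Matrix.mul_apply]
    constructor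
    · rintro ⟨h1, h2⟩
      constructor <;> linarith
    · rintro ⟨h1, h2⟩
      constructor <;> linarith

theorem exists_isNormalVec {S : Submodule ℝ (Matrix (Fin 2) (Fin 2) ℝ)} (h0 : S ≠ ⊥)
    (hS : S < Sym 2) : ∃ g : GL (Fin 2) ℝ, IsNormalVec (S.map (dagLinear g)) := by
  have h1 : 0 < Module.finrank ℝ S := by
    rw [Nat.pos_iff_ne_zero, Ne, Submodule.finrank_eq_zero]
    exact h0
  have h3 := Submodule.finrank_lt_finrank_of_lt hS
  rw [finrank_Sym_two] at h3
  obtain h | h : Module.finrank ℝ S = 1 ∨ Module.finrank ℝ S = 2 := by omega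
  · obtain ⟨⟨σ, hσ⟩, hσ0, hspan⟩ := finrank_eq_one_iff'.1 h
    have : S = ℝ ∙ σ := by
      refine le_antisymm (fun τ hτ => ?_) ((Submodule.span_singleton_le_iff_mem _ _).2 hσ)
      obtain ⟨c, hc⟩ := hspan ⟨τ, hτ⟩
      exact Submodule.mem_span_singleton.2 ⟨c, congrArg Subtype.val hc⟩
    rw [this]
    exact exists_isNormalVec_of_line (hS.le hσ) fun h => hσ0 (Subtype.ext h)
  · obtain ⟨v, hv, hvS⟩ := SetLike.exists_of_lt hS
    obtain ⟨φ, hφ, hker⟩ := Submodule.exists_le_ker_of_notMem hvS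
    -- The symmetric matrix representing `φ` on `Sym 2` through the trace pairing; that pairing
    -- counts the off-diagonal entry twice, hence the halves.
    set ρ : Matrix (Fin 2) (Fin 2) ℝ := !![φ !![1, 0; 0, 0], φ !![0, 1; 1, 0] / 2;
      φ !![0, 1; 1, 0] / 2, φ !![0, 0; 0, 1]] with hρ
    have htr : ∀ σ ∈ Sym 2, φ σ = (ρ * σ).trace := by
      intro σ hσ
      rw [mem_Sym_two] at hσ
      have e : σ = σ 0 0 • !![1, 0; 0, 0] + σ 0 1 • !![0, 1; 1, 0] + σ 1 1 • !![0, 0; 0, 1] := by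
        ext i j
        fin_cases i <;> fin_cases j <;> simp [hσ]
      conv_lhs => rw [e]
      rw [map_add, map_add, map_smul, map_smul, map_smul, Matrix.trace_fin_two]
      simp [hρ, Matrix.mul_apply, hσ]
      ring
    refine exists_isNormalVec_of_plane (ρ := ρ) (mem_Sym_two.2 (by simp [hρ])) ?_ ?_
    · intro h
      rw [htr v hv, h] at hφ
      simp at hφ
    · have hle : S ≤ Sym 2 ⊓ LinearMap.ker φ := le_inf hS.le hker
      have hlt : Sym 2 ⊓ LinearMap.ker φ < Sym 2 :=
        lt_of_le_of_ne inf_le_left fun e => hφ ((e.ge hv).2)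
      have h4 := Submodule.finrank_lt_finrank_of_lt hlt
      rw [finrank_Sym_two] at h4
      -- The right side is properly contained in the three-dimensional `Sym 2` and contains the
      -- plane `S`.
      have : S = Sym 2 ⊓ LinearMap.ker φ :=
        Submodule.eq_of_le_of_finrank_le hle (by omega)
      intro σ
      conv_lhs => rw [this]
      rw [Submodule.mem_inf]
      refine and_congr_right fun hσ => ?_
      rw [LinearMap.mem_ker, htr σ hσ]

theorem submodule_prod_cases (W : Submodule ℝ (ℝ × ℝ)) :
    W = ⊥ ∨ W = ⊤ ∨ (∃ b : ℝ, W = ℝ ∙ (1, b)) ∨ W = ℝ ∙ (0, 1) := by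
  have h2 : Module.finrank ℝ W ≤ 2 := by
    simpa using Submodule.finrank_le W
  obtain h | h | h : Module.finrank ℝ W = 0 ∨ Module.finrank ℝ W = 1 ∨
    Module.finrank ℝ W = 2 := by omega
  · exact Or.inl (Submodule.finrank_eq_zero.1 h)
  · obtain ⟨⟨⟨a, b⟩, hw⟩, hw0, hspan⟩ := finrank_eq_one_iff'.1 h
    have : W = ℝ ∙ (a, b) := by
      refine le_antisymm (fun τ hτ => ?_) ((Submodule.span_singleton_le_iff_mem _ _).2 hw)
      obtain ⟨c, hc⟩ := hspan ⟨τ, hτ⟩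
      exact Submodule.mem_span_singleton.2 ⟨c, congrArg Subtype.val hc⟩
    by_cases ha : a = 0
    · subst ha
      have hb : b ≠ 0 := by
        rintro rfl
        exact hw0 (Subtype.ext rfl)
      refine Or.inr (Or.inr (Or.inr ?_))
      rw [this, ← Submodule.span_singleton_smul_eq hb.isUnit ((0, 1) : ℝ × ℝ)]
      simp
    · refine Or.inr (Or.inr (Or.inl ⟨b / a, ?_⟩))
      rw [this, ← Submodule.span_singleton_smul_eq (Ne.isUnit ha) ((1, b / a) : ℝ × ℝ)]
      simp [mul_div_cancel₀ _ ha]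
  · exact Or.inr (Or.inl (Submodule.eq_top_of_finrank_eq (by simpa using h)))

/-- A direction off the diagonal is normalised so that its second coordinate exceeds the first by
`1`; for `(1, b)` the factor is `(b - 1)⁻¹`. -/
theorem submodule_prod_weight_cases (W : Submodule ℝ (ℝ × ℝ)) :
    W = ⊥ ∨ W = ⊤ ∨ W = ℝ ∙ (1, 1) ∨ ∃ l : ℝ, W = ℝ ∙ (l, l + 1) := by
  rcases submodule_prod_cases W with h | h | ⟨b, h⟩ | h
  · exact Or.inl h
  · exact Or.inr (Or.inl h)
  · by_cases hb : b = 1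
    · subst hb
      exact Or.inr (Or.inr (Or.inl h))
    · have hb' : b - 1 ≠ 0 := sub_ne_zero.2 hb
      refine Or.inr (Or.inr (Or.inr ⟨(b - 1)⁻¹, ?_⟩))
      rw [h, ← Submodule.span_singleton_smul_eq (Ne.isUnit (inv_ne_zero hb')) ((1, b) : ℝ × ℝ)]
      congr 2
      ext
      · simp
      · simp only [Prod.smul_mk, smul_eq_mul]
        field_simp
        ring
  · exact Or.inr (Or.inr (Or.inr ⟨0, by simpa using h⟩))

/-- Conjugation by the reflection `diag(1, -1)` changes the sign of the infinitesimal rotation,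
which makes the slope nonnegative. The reflection is its own inverse, hence the single matrix `M`.
-/
theorem exists_confIndex {A : Submodule ℝ (Matrix (Fin 2) (Fin 2) ℝ)} (h0 : A ≠ ⊥)
    (hA : ∀ X ∈ A, X 0 1 = -X 1 0 ∧ X 1 1 = X 0 0) :
    ∃ (i : ConfIndex) (M : Matrix (Fin 2) (Fin 2) ℝ), (M = 1 ∨ M = !![1, 0; 0, -1]) ∧
      IsConjBy M M A i.alg := by
  have hAW : A = (A.comap confLinear).map confLinear := by
    ext X
    constructor
    · intro hX
      obtain ⟨h1, h2⟩ := hA X hX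
      have e : confLinear (X 0 0, X 1 0) = X := by
        ext i j
        fin_cases i <;> fin_cases j <;> simp [confLinear, h1, h2]
      exact ⟨(X 0 0, X 1 0), show confLinear _ ∈ A by rwa [e], e⟩
    · rintro ⟨w, hw, rfl⟩
      exact hw
  have hspan : ∀ w, (ℝ ∙ w).map confLinear = ℝ ∙ confLinear w := fun w => by
    rw [LinearMap.map_span, Set.image_singleton]
  rcases submodule_prod_cases (A.comap confLinear) with h | h | ⟨b, h⟩ | h <;> rw [h] at hAW
  · rw [Submodule.map_bot] at hAW
    exact absurd hAW h0
  · exact ⟨.full, 1, Or.inl rfl, fun X => by simp [hAW, ConfIndex.alg]⟩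
  · rcases le_or_gt 0 b with hb | hb
    · exact ⟨.spiral ⟨b, hb⟩, 1, Or.inl rfl, fun X => by
        rw [hAW, hspan, Matrix.one_mul, Matrix.mul_one]; rfl⟩
    · refine ⟨.spiral ⟨-b, by simpa using hb.le⟩, _, Or.inr rfl, fun X => ?_⟩
      rw [ConfIndex.alg, ← hspan, hAW, mem_map_confLinear, mem_map_confLinear,
        mem_span_one_left_iff, mem_span_one_left_iff]
      simp [-Matrix.cons_mul, Matrix.mul_apply]
      constructor <;> rintro ⟨h1, h2, h3⟩ <;> refine ⟨?_, ?_, ?_⟩ <;> linarith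
  · exact ⟨.rotations, 1, Or.inl rfl, fun X => by
      rw [hAW, hspan, Matrix.one_mul, Matrix.mul_one]; rfl⟩

/-- Exchanging the coordinate axes inverts the slope `b`, which brings it into `[-1, 1]`; the
direction `(0, 1)` becomes slope `0`. -/
theorem exists_diagIndex {A : Submodule ℝ (Matrix (Fin 2) (Fin 2) ℝ)} (h0 : A ≠ ⊥)
    (hA : ∀ X ∈ A, X 0 1 = 0 ∧ X 1 0 = 0) :
    ∃ (i : DiagIndex) (M : Matrix (Fin 2) (Fin 2) ℝ), (M = 1 ∨ M = !![0, 1; 1, 0]) ∧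
      IsConjBy M M A i.alg := by
  have hAW : A = (A.comap diagLinear).map diagLinear := by
    ext X
    constructor
    · intro hX
      obtain ⟨h1, h2⟩ := hA X hX
      have e : diagLinear (X 0 0, X 1 1) = X := by
        ext i j
        fin_cases i <;> fin_cases j <;> simp [diagLinear, h1, h2]
      exact ⟨(X 0 0, X 1 1), show diagLinear _ ∈ A by rwa [e], e⟩
    · rintro ⟨w, hw, rfl⟩
      exact hw
  rcases submodule_prod_cases (A.comap diagLinear) with h | h | ⟨b, h⟩ | h <;> rw [h] at hAW
  · rw [Submodule.map_bot] at hAW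
    exact absurd hAW h0
  · exact ⟨.full, 1, Or.inl rfl, fun X => by simp [hAW, DiagIndex.alg]⟩
  · by_cases hb : |b| ≤ 1
    · exact ⟨.curve ⟨b, abs_le.1 hb⟩, 1, Or.inl rfl, fun X => by
        rw [hAW, Matrix.one_mul, Matrix.mul_one]; rfl⟩
    · rw [not_le] at hb
      have hb0 : b ≠ 0 := by
        rintro rfl
        norm_num at hb
      have hb1 : |b⁻¹| ≤ 1 := by
        rw [abs_inv]
        exact inv_le_one_of_one_le₀ hb.le
      refine ⟨.curve ⟨b⁻¹, abs_le.1 hb1⟩, _, Or.inr rfl, fun X => ?_⟩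
      rw [DiagIndex.alg, hAW, mem_map_diagLinear, mem_map_diagLinear, mem_span_one_left_iff,
        mem_span_one_left_iff]
      simp [-Matrix.cons_mul, Matrix.mul_apply]
      have : X 0 0 * b⁻¹ = X 1 1 ↔ X 1 1 * b = X 0 0 :=
        ⟨fun h => by rw [← h]; field_simp, fun h => by rw [← h]; field_simp⟩
      tauto
  · refine ⟨.curve ⟨0, by norm_num⟩, _, Or.inr rfl, fun X => ?_⟩
    rw [DiagIndex.alg, hAW, mem_map_diagLinear, mem_map_diagLinear, mem_span_one_left_iff,
      mem_span_pair_iff (Or.inr one_ne_zero)]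
    simp [-Matrix.cons_mul, Matrix.mul_apply]
    have : 0 = X 1 1 ↔ X 1 1 = 0 := eq_comm
    tauto

/-- A corner equal to `m` times the difference of the diagonal entries means that `(1, 0)` and `(-m,
1)` are common eigenvectors; a shear diagonalises the whole algebra. -/
theorem isConjBy_unip {A : Submodule ℝ (Matrix (Fin 2) (Fin 2) ℝ)} {W : Submodule ℝ (ℝ × ℝ)}
    {m : ℝ} (hA : ∀ X, X ∈ A ↔ X 1 0 = 0 ∧ X 0 1 = m * (X 0 0 - X 1 1) ∧ (X 0 0, X 1 1) ∈ W) :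
    IsConjBy !![1, m; 0, 1] !![1, -m; 0, 1] A (W.map diagLinear) := by
  intro X
  rw [hA, mem_map_diagLinear]
  constructor
  · rintro ⟨h1, h2, h3⟩
    refine ⟨?_, ?_, ?_⟩
    · simp [-Matrix.cons_mul, Matrix.mul_apply, h2]
    · simp [-Matrix.cons_mul, Matrix.mul_apply, h1, h2]
      ring
    · simpa [-Matrix.cons_mul, Matrix.mul_apply, h2] using h3
  · rintro ⟨h1, h2, h3⟩
    simp [-Matrix.cons_mul, Matrix.mul_apply] at h1
    simp [-Matrix.cons_mul, Matrix.mul_apply, h1] at h2 h3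
    exact ⟨by linarith, h1, h3⟩

/-- If `A` contains `[0, 1; 0, 0]`, it is the full preimage of its diagonal part. Otherwise the
corner is a linear function of the diagonal and has to be removed or normalised by triangular
conjugation. The bracket matters only when the diagonal part is two-dimensional. -/
theorem exists_triIndex {A : Submodule ℝ (Matrix (Fin 2) (Fin 2) ℝ)} (h0 : A ≠ ⊥)
    (hA : ∀ X ∈ A, X 1 0 = 0) (hbr : ∀ X ∈ A, ∀ Y ∈ A, X * Y - Y * X ∈ A) :
    ∃ (i : TriIndex) (M N : Matrix (Fin 2) (Fin 2) ℝ), M * N = 1 ∧ M 1 0 = 0 ∧ N 1 0 = 0 ∧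
      IsConjBy M N A i.alg := by
  have hrefl : ∀ {i : TriIndex}, A = i.alg → ∃ (i : TriIndex) (M N : Matrix (Fin 2) (Fin 2) ℝ),
      M * N = 1 ∧ M 1 0 = 0 ∧ N 1 0 = 0 ∧ IsConjBy M N A i.alg := by
    rintro i rfl
    exact ⟨i, 1, 1, by simp, by simp, by simp, fun X => by simp⟩
  by_cases hE : !![0, 1; 0, 0] ∈ A
  · have hAW : A = ((A.comap diagLinear).prod ⊤).map upperLinear := by
      ext X
      have hsub : X 0 1 • !![0, 1; 0, 0] ∈ A := A.smul_mem _ hE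
      constructor
      · intro hX
        refine mem_map_upperLinear.2 ⟨hA X hX, ?_⟩
        have e : diagLinear (X 0 0, X 1 1) = X - X 0 1 • !![0, 1; 0, 0] := by
          ext i j
          fin_cases i <;> fin_cases j <;> simp [diagLinear, hA X hX]
        change diagLinear _ ∈ A
        rw [e]
        exact A.sub_mem hX hsub
      · intro hX
        obtain ⟨h1, h2⟩ := mem_map_upperLinear.1 hX
        have e : X = diagLinear (X 0 0, X 1 1) + X 0 1 • !![0, 1; 0, 0] := by
          ext i j
          fin_cases i <;> fin_cases j <;> simp [diagLinear, h1]
        rw [e]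
        exact A.add_mem h2 hsub
    rcases submodule_prod_weight_cases (A.comap diagLinear) with h | h | h | ⟨l, h⟩ <;>
      rw [h] at hAW
    · exact hrefl (i := .unip) hAW
    · exact hrefl (i := .full) hAW
    · exact hrefl (i := .scalarUnip) hAW
    · exact hrefl (i := .param l) hAW
  · have huniq : ∀ X ∈ A, ∀ Y ∈ A, X 0 0 = Y 0 0 → X 1 1 = Y 1 1 → X = Y := by
      intro X hX Y hY h1 h2
      have h3 : X 0 1 = Y 0 1 := by
        by_contra h3
        have h4 : X 0 1 - Y 0 1 ≠ 0 := sub_ne_zero.2 h3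
        have e : X - Y = (X 0 1 - Y 0 1) • !![0, 1; 0, 0] := by
          ext i j
          fin_cases i <;> fin_cases j <;> simp [h1, h2, hA X hX, hA Y hY]
        have := A.sub_mem hX hY
        rw [e, Submodule.smul_mem_iff _ h4] at this
        exact hE this
      ext i j
      fin_cases i <;> fin_cases j <;> simp [h1, h2, h3, hA X hX, hA Y hY]
    let δ : Matrix (Fin 2) (Fin 2) ℝ →ₗ[ℝ] ℝ × ℝ :=
      { toFun := fun X => (X 0 0, X 1 1)
        map_add' := fun _ _ => rfl
        map_smul' := fun _ _ => rfl }
    have hδ : ∀ X ∈ A, (X 0 0, X 1 1) ∈ A.map δ := fun X hX => ⟨X, hX, rfl⟩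
    have hlift : ∀ {a b : ℝ}, (a, b) ∈ A.map δ → ∃ r, !![a, r; 0, b] ∈ A := by
      rintro a b ⟨X, hX, e⟩
      have e1 : X 0 0 = a := congrArg Prod.fst e
      have e2 : X 1 1 = b := congrArg Prod.snd e
      have : X = !![a, X 0 1; 0, b] := by
        ext i j
        fin_cases i <;> fin_cases j <;> simp [e1, e2, hA X hX]
      exact ⟨X 0 1, by rwa [← this]⟩
    have hline : ∀ {a b r : ℝ}, A.map δ = ℝ ∙ (a, b) → !![a, r; 0, b] ∈ A →
        A = ℝ ∙ !![a, r; 0, b] := by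
      intro a b r h hX
      refine le_antisymm (fun Z hZ => ?_) ((Submodule.span_singleton_le_iff_mem _ _).2 hX)
      have h1 := hδ Z hZ
      rw [h] at h1
      obtain ⟨t, ht⟩ := Submodule.mem_span_singleton.1 h1
      refine Submodule.mem_span_singleton.2 ⟨t, huniq _ (A.smul_mem t hX) Z hZ ?_ ?_⟩
      · simpa using congrArg Prod.fst ht
      · simpa using congrArg Prod.snd ht
    have hunip : ∀ {i : TriIndex} {m : ℝ} {W : Submodule ℝ (ℝ × ℝ)}, i.alg = W.map diagLinear →
        (∀ X, X ∈ A ↔ X 1 0 = 0 ∧ X 0 1 = m * (X 0 0 - X 1 1) ∧ (X 0 0, X 1 1) ∈ W) →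
        ∃ (i : TriIndex) (M N : Matrix (Fin 2) (Fin 2) ℝ),
          M * N = 1 ∧ M 1 0 = 0 ∧ N 1 0 = 0 ∧ IsConjBy M N A i.alg := by
      intro i m W hi h
      exact ⟨i, !![1, m; 0, 1], !![1, -m; 0, 1], by simp [Matrix.one_fin_two], by simp, by simp,
        hi ▸ isConjBy_unip h⟩
    rcases submodule_prod_weight_cases (A.map δ) with h | h | h | ⟨l, h⟩
    · refine absurd (le_bot_iff.1 fun X hX => ?_) h0
      have h1 := hδ X hX
      rw [h, Submodule.mem_bot] at h1
      exact (Submodule.mem_bot ℝ).2 (huniq X hX 0 A.zero_mem (congrArg Prod.fst h1)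
        (congrArg Prod.snd h1))
    · obtain ⟨r, hX⟩ := hlift (a := 1) (b := 0) (h ▸ Submodule.mem_top)
      obtain ⟨s, hY⟩ := hlift (a := 0) (b := 1) (h ▸ Submodule.mem_top)
      -- The commutator of the two lifts is `(r + s)` times `[0, 1; 0, 0]`, which is not in `A`.
      have hrs : s = -r := by
        by_contra hrs
        have h1 : r + s ≠ 0 := fun h => hrs (by linarith)
        have h2 := hbr _ hX _ hY
        have e : !![1, r; 0, 0] * !![0, s; 0, 1] - !![0, s; 0, 1] * !![1, r; 0, 0] =
            (r + s) • (!![0, 1; 0, 0] : Matrix (Fin 2) (Fin 2) ℝ) := by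
          ext i j
          fin_cases i <;> fin_cases j <;> simp
          ring
        rw [e, Submodule.smul_mem_iff _ h1] at h2
        exact hE h2
      subst hrs
      refine hunip (i := .diagonals) (m := r) rfl fun X => ?_
      have key : ∀ a b : ℝ, !![a, r * (a - b); 0, b] ∈ A := by
        intro a b
        have := A.add_mem (A.smul_mem a hX) (A.smul_mem b hY)
        convert this using 1
        ext i j
        fin_cases i <;> fin_cases j <;> simp
        ring
      constructor
      · intro hZ
        have e := huniq X hZ _ (key (X 0 0) (X 1 1)) (by simp) (by simp)
        exact ⟨hA X hZ, by simpa using congrFun (congrFun e 0) 1, trivial⟩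
      · rintro ⟨h1, h2, -⟩
        have e : X = !![X 0 0, r * (X 0 0 - X 1 1); 0, X 1 1] := by
          ext i j
          fin_cases i <;> fin_cases j <;> simp [h1, h2]
        rw [e]
        exact key _ _
    · obtain ⟨r, hX⟩ := hlift (a := 1) (b := 1) (h ▸ Submodule.mem_span_singleton_self _)
      have hAr := hline h hX
      by_cases hr : r = 0
      · subst hr
        refine hrefl (i := .scalars) ?_
        rw [hAr, TriIndex.alg, LinearMap.map_span, Set.image_singleton]
        rfl
      -- With equal eigenvalues no shear can remove the corner; a diagonal conjugation rescales it
      -- to `1`.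
      · refine ⟨.jordan, !![r⁻¹, 0; 0, 1], !![r, 0; 0, 1], ?_, by simp, by simp, fun X => ?_⟩
        · simp [hr, Matrix.one_fin_two]
        · rw [hAr, TriIndex.alg, Submodule.mem_span_singleton, Submodule.mem_span_singleton]
          refine exists_congr fun t => ?_
          constructor
          · rintro rfl
            ext i j
            fin_cases i <;> fin_cases j <;>
              simp [upperLinear, -Matrix.cons_mul, Matrix.mul_apply, mul_comm]
            field_simp
          · intro e
            have e00 := congrFun (congrFun e 0) 0
            have e01 := congrFun (congrFun e 0) 1
            have e10 := congrFun (congrFun e 1) 0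
            have e11 := congrFun (congrFun e 1) 1
            simp [-Matrix.cons_mul, Matrix.mul_apply, hr] at e00 e01 e10 e11
            have e00' : X 0 0 = t := by
              rw [e00]
              field_simp
            have e01' : t = X 0 1 := mul_left_cancel₀ hr (by linarith)
            ext i j
            fin_cases i <;> fin_cases j <;> simp [upperLinear, e01', e10]
            · linarith
            · linarith
    · obtain ⟨r, hX⟩ := hlift (a := l) (b := l + 1) (h ▸ Submodule.mem_span_singleton_self _)
      have hAr := hline h hX
      -- The diagonal entries differ by `l - (l + 1) = -1`, so the corner `r` is `-r` times their
      -- difference.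
      refine hunip (i := .line l) (m := -r) rfl fun X => ?_
      rw [hAr, Submodule.mem_span_singleton, Submodule.mem_span_singleton]
      constructor
      · rintro ⟨t, rfl⟩
        exact ⟨by simp, by simp; ring, t, by simp⟩
      · rintro ⟨h1, h2, t, ht⟩
        have ht0 : t * l = X 0 0 := congrArg Prod.fst ht
        have ht1 : t * (l + 1) = X 1 1 := congrArg Prod.snd ht
        refine ⟨t, ?_⟩
        ext i j
        fin_cases i <;> fin_cases j <;> simp [h1, h2, ht0, ht1]
        linear_combination r * (ht1 - ht0)

theorem isConjBy_comap_transpose {M N : Matrix (Fin 2) (Fin 2) ℝ}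
    {A B : Submodule ℝ (Matrix (Fin 2) (Fin 2) ℝ)}
    (h : IsConjBy M N (A.comap transposeLinear) B) :
    IsConjBy Nᵀ Mᵀ A (B.comap transposeLinear) := by
  intro X
  rw [mem_comap_transposeLinear, h]
  simp only [mem_comap_transposeLinear, Matrix.transpose_mul, Matrix.transpose_transpose,
    Matrix.mul_assoc]

/-- Classification of the Lie algebras leaving a normal form invariant. -/
theorem exists_shape_of_isNormalVec {V A : Submodule ℝ (Matrix (Fin 2) (Fin 2) ℝ)}
    (hV : IsNormalVec V) (h0 : A ≠ ⊥) (hbr : ∀ X ∈ A, ∀ Y ∈ A, X * Y - Y * X ∈ A)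
    (hinv : ∀ X ∈ A, ∀ σ ∈ V, Xᵀ * σ + σ * X ∈ V) :
    ∃ (s : Shape) (M N : Matrix (Fin 2) (Fin 2) ℝ), s.vec = V ∧ M * N = 1 ∧
      (∀ σ ∈ V, Nᵀ * σ * N ∈ V) ∧ (∀ σ ∈ V, Mᵀ * σ * M ∈ V) ∧ IsConjBy M N A s.alg := by
  rcases hV with rfl | rfl | rfl | rfl | rfl | rfl
  · obtain ⟨i, M, hM, hc⟩ := exists_confIndex h0 fun X hX => by
      have := mem_sigmaOne.1 (hinv X hX _ (Submodule.mem_span_singleton_self _))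
      simp [-Matrix.cons_mul, Matrix.mul_apply] at this
      constructor <;> linarith
    have hst : ∀ σ ∈ ℝ ∙ (!![1, 0; 0, 1] : Matrix (Fin 2) (Fin 2) ℝ),
        Mᵀ * σ * M ∈ ℝ ∙ (!![1, 0; 0, 1] : Matrix (Fin 2) (Fin 2) ℝ) := by
      intro σ hσ
      obtain ⟨h1, h2, h3⟩ := mem_sigmaOne.1 hσ
      rcases hM with rfl | rfl
      · simpa using hσ
      · exact mem_sigmaOne.2 (by simp [-Matrix.cons_mul, Matrix.mul_apply, h1, h2, h3])
    refine ⟨.one i, M, M, rfl, ?_, hst, hst, hc⟩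
    rcases hM with rfl | rfl <;> simp [Matrix.one_fin_two]
  · obtain ⟨i, M, hM, hc⟩ := exists_confIndex h0 fun X hX => by
      have k1 := (mem_sigmaOnePerp.1 (hinv X hX !![1, 0; 0, -1]
        (mem_sigmaOnePerp.2 (by simp)))).2
      have k2 := (mem_sigmaOnePerp.1 (hinv X hX !![0, 1; 1, 0]
        (mem_sigmaOnePerp.2 (by simp)))).2
      simp [-Matrix.cons_mul, Matrix.mul_apply] at k1 k2
      constructor <;> linarith
    have hst : ∀ σ ∈ LinearMap.range onePerpLinear,
        Mᵀ * σ * M ∈ LinearMap.range onePerpLinear := by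
      intro σ hσ
      obtain ⟨h1, h2⟩ := mem_sigmaOnePerp.1 hσ
      rcases hM with rfl | rfl
      · simpa using hσ
      · exact mem_sigmaOnePerp.2 (by simp [-Matrix.cons_mul, Matrix.mul_apply, h1, h2])
    refine ⟨.onePerp i, M, M, rfl, ?_, hst, hst, hc⟩
    rcases hM with rfl | rfl <;> simp [Matrix.one_fin_two]
  · obtain ⟨i, M, hM, hc⟩ := exists_diagIndex h0 fun X hX => by
      have := mem_sigmaNeg.1 (hinv X hX _ (Submodule.mem_span_singleton_self _))
      simp [-Matrix.cons_mul, Matrix.mul_apply] at this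
      constructor <;> linarith
    have hst : ∀ σ ∈ ℝ ∙ (!![0, 1; 1, 0] : Matrix (Fin 2) (Fin 2) ℝ),
        Mᵀ * σ * M ∈ ℝ ∙ (!![0, 1; 1, 0] : Matrix (Fin 2) (Fin 2) ℝ) := by
      intro σ hσ
      obtain ⟨h1, h2, h3⟩ := mem_sigmaNeg.1 hσ
      rcases hM with rfl | rfl
      · simpa using hσ
      · exact mem_sigmaNeg.2 (by simp [-Matrix.cons_mul, Matrix.mul_apply, h1, h2, h3])
    refine ⟨.neg i, M, M, rfl, ?_, hst, hst, hc⟩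
    rcases hM with rfl | rfl <;> simp [Matrix.one_fin_two]
  · obtain ⟨i, M, hM, hc⟩ := exists_diagIndex h0 fun X hX => by
      have k1 := (mem_sigmaNegPerp.1 (hinv X hX !![1, 0; 0, 0]
        (mem_sigmaNegPerp.2 (by simp)))).1
      have k2 := (mem_sigmaNegPerp.1 (hinv X hX !![0, 0; 0, 1]
        (mem_sigmaNegPerp.2 (by simp)))).1
      simp [-Matrix.cons_mul, Matrix.mul_apply] at k1 k2
      constructor <;> linarith
    have hst : ∀ σ ∈ LinearMap.range diagLinear,
        Mᵀ * σ * M ∈ LinearMap.range diagLinear := by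
      intro σ hσ
      obtain ⟨h1, h2⟩ := mem_sigmaNegPerp.1 hσ
      rcases hM with rfl | rfl
      · simpa using hσ
      · exact mem_sigmaNegPerp.2 (by simp [-Matrix.cons_mul, Matrix.mul_apply, h1, h2])
    refine ⟨.negPerp i, M, M, rfl, ?_, hst, hst, hc⟩
    rcases hM with rfl | rfl <;> simp [Matrix.one_fin_two]
  -- Here `A` is lower triangular. Its transpose is classified, and transposing back turns the
  -- conjugating pair `(M, N)` into `(Nᵀ, Mᵀ)`.
  · have h0' : A.comap transposeLinear ≠ ⊥ := by
      intro h
      refine h0 (le_bot_iff.1 fun X hX => ?_)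
      have : Xᵀ ∈ A.comap transposeLinear := by
        rw [mem_comap_transposeLinear, Matrix.transpose_transpose]
        exact hX
      rw [h, Submodule.mem_bot, Matrix.transpose_eq_zero] at this
      exact (Submodule.mem_bot ℝ).2 this
    have hlow : ∀ X ∈ A.comap transposeLinear, X 1 0 = 0 := by
      intro X hX
      have := (mem_sigmaZero.1 (hinv Xᵀ hX _ (Submodule.mem_span_singleton_self _))).1
      simpa [-Matrix.cons_mul, Matrix.mul_apply] using this
    have hbr' : ∀ X ∈ A.comap transposeLinear, ∀ Y ∈ A.comap transposeLinear,
        X * Y - Y * X ∈ A.comap transposeLinear := by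
      intro X hX Y hY
      rw [mem_comap_transposeLinear, Matrix.transpose_sub, Matrix.transpose_mul,
        Matrix.transpose_mul]
      exact hbr _ hY _ hX
    obtain ⟨i, M, N, hMN, hM, hN, hc⟩ := exists_triIndex h0' hlow hbr'
    have hst : ∀ {M : Matrix (Fin 2) (Fin 2) ℝ}, M 1 0 = 0 →
        ∀ σ ∈ ℝ ∙ (!![1, 0; 0, 0] : Matrix (Fin 2) (Fin 2) ℝ),
        Mᵀᵀ * σ * Mᵀ ∈ ℝ ∙ (!![1, 0; 0, 0] : Matrix (Fin 2) (Fin 2) ℝ) := by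
      intro M hM σ hσ
      obtain ⟨h1, h2, h3⟩ := mem_sigmaZero.1 hσ
      exact mem_sigmaZero.2 (by simp [-Matrix.cons_mul, Matrix.mul_apply, h1, h2, h3, hM])
    refine ⟨.zero i, Nᵀ, Mᵀ, rfl, ?_, hst hM, hst hN, isConjBy_comap_transpose hc⟩
    rw [← Matrix.transpose_mul, hMN, Matrix.transpose_one]
  · obtain ⟨i, M, N, hMN, hM, hN, hc⟩ := exists_triIndex h0 (fun X hX => by
      have := (mem_sigmaZeroPerp.1 (hinv X hX !![0, 1; 1, 0]
        (mem_sigmaZeroPerp.2 (by simp)))).1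
      simp [-Matrix.cons_mul, Matrix.mul_apply] at this
      linarith) hbr
    have hst : ∀ {M : Matrix (Fin 2) (Fin 2) ℝ}, M 1 0 = 0 →
        ∀ σ ∈ LinearMap.range zeroPerpLinear,
        Mᵀ * σ * M ∈ LinearMap.range zeroPerpLinear := by
      intro M hM σ hσ
      obtain ⟨h1, h2⟩ := mem_sigmaZeroPerp.1 hσ
      refine mem_sigmaZeroPerp.2 ?_
      simp [-Matrix.cons_mul, Matrix.mul_apply, h1, h2, hM]
      ring
    exact ⟨.zeroPerp i, M, N, rfl, hMN, hst hN, hst hM, hc⟩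

theorem lieAlg_conjGL_submodule {H : Subgroup (GL (Fin 2) ℝ)} (hH : IsConnectedLieSubgroup H)
    (g : GL (Fin 2) ℝ) : ∃ A : Submodule ℝ (Matrix (Fin 2) (Fin 2) ℝ),
      (A : Set (Matrix (Fin 2) (Fin 2) ℝ)) = lieAlg (conjGL g H) ∧
      ∀ X ∈ A, ∀ Y ∈ A, X * Y - Y * X ∈ A := by
  obtain ⟨⟨A, hA, hbr⟩, -⟩ := hH
  let f : Matrix (Fin 2) (Fin 2) ℝ →ₗ[ℝ] Matrix (Fin 2) (Fin 2) ℝ :=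
    { toFun := fun X => ((g⁻¹ : GL (Fin 2) ℝ) : Matrix (Fin 2) (Fin 2) ℝ) * X * g
      map_add' := by simp [-coe_units_inv, Matrix.mul_add, Matrix.add_mul]
      map_smul' := by simp [-coe_units_inv] }
  have hf : ∀ X Y, f (X * Y) = f X * f Y := by
    intro X Y
    change _ * (X * Y) * _ = (_ * X * _) * (_ * Y * _)
    simp only [Matrix.mul_assoc]
    rw [← Matrix.mul_assoc (g : Matrix (Fin 2) (Fin 2) ℝ), Units.mul_inv, Matrix.one_mul]
  refine ⟨A.comap f, ?_, ?_⟩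
  · ext X
    rw [mem_lieAlg_conjGL, ← hA]
    rfl
  · intro X hX Y hY
    rw [Submodule.mem_comap, map_sub, hf, hf]
    exact hbr _ hX _ hY

theorem conjGL_mul (g g' : GL (Fin 2) ℝ) (H : Subgroup (GL (Fin 2) ℝ)) :
    conjGL (g * g') H = conjGL g (conjGL g' H) := by
  ext x
  simp only [mem_conjGL, _root_.mul_inv_rev, mul_assoc]

/-- Every group of the class is conjugate to an entry of the list. -/
theorem exists_shape_of_mem_E2 {G : Subgroup (GL (Fin 2 ⊕ Fin 2) ℝ)} (hG : G ∈ E2) :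
    ∃ (s : Shape) (g : GL (Fin 2) ℝ),
      conjSet g (G : Set (GL (Fin 2 ⊕ Fin 2) ℝ)) = s.entry.group := by
  obtain ⟨-, -, S, H, hS0, hS, hH0, hH, hG⟩ := hG
  have hinv := dag_mem_of_semidirectSet (S := S) (H := H) hG
  obtain ⟨g, hg⟩ := exists_isNormalVec hS0 hS
  obtain ⟨A, hA, hbr⟩ := lieAlg_conjGL_submodule hH g
  have hgen := hH.isExpGenerated.conjGL g
  -- A group generated by exponentials of the zero algebra is trivial, against `H ≠ ⊥`.
  have hA0 : A ≠ ⊥ := by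
    rintro rfl
    refine hH0 (le_bot_iff.1 fun x hx => ?_)
    have hle : conjGL g H ≤ ⊥ := hgen.le fun X hX => by
      rw [← hA] at hX
      rw [(Submodule.mem_bot ℝ).1 hX, mem_lieAlg]
      intro t
      rw [smul_zero, Subgroup.mem_bot]
      exact Units.ext NormedSpace.exp_zero
    have := hle ((mem_conjGL (x := g * x * g⁻¹)).2 (by simpa [mul_assoc] using hx))
    rw [Subgroup.mem_bot] at this ⊢
    simpa using this
  have hinv' : ∀ h ∈ conjGL g H, ∀ σ ∈ S.map (dagLinear g), dag h σ ∈ S.map (dagLinear g) := by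
    rintro h hh _ ⟨σ, hσ, rfl⟩
    refine ⟨_, hinv _ (mem_conjGL.1 hh) σ hσ, ?_⟩
    rw [dagLinear_apply, dagLinear_apply, ← dag_mul, ← dag_mul]
    congr 1
    group
  -- The second conjugation, by `M`, normalises the Lie algebra while preserving the vector part
  -- already normalised by `g`.
  obtain ⟨s, M, N, hs, hMN, hN, hM, hc⟩ := exists_shape_of_isNormalVec hg hA0 hbr
    fun X hX σ hσ => transpose_mul_add_mul_mem hinv' (hA ▸ hX) hσ
  obtain ⟨K, hK1, hK2, hK3, -⟩ := s.exists_subgroup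
  refine ⟨s, mkGL M N hMN * g, ?_⟩
  have hKH : conjGL (mkGL M N hMN * g) H = K := by
    rw [conjGL_mul]
    -- Both groups are generated by exponentials, so equality of their Lie algebras suffices.
    refine (hgen.conjGL _).eq hK3.isExpGenerated ?_
    ext X
    rw [mem_lieAlg_conjGL, ← hA, ← hK2]
    exact (hc X).symm
  have hSs : dag (mkGL M N hMN * g) '' (S : Set (Matrix (Fin 2) (Fin 2) ℝ)) = s.vec := by
    rw [hs]
    ext τ
    constructor
    · rintro ⟨σ, hσ, rfl⟩
      rw [dag_mul]
      exact hN _ ⟨σ, hσ, rfl⟩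
    · intro hτ
      obtain ⟨σ, hσ, e⟩ := hM τ hτ
      refine ⟨σ, hσ, ?_⟩
      have e' : dag g σ = dag (mkGL M N hMN)⁻¹ τ := e
      rw [dag_mul, e', ← dag_mul, mul_inv_cancel, dag_one]
  have hG' : (G : Set (GL (Fin 2 ⊕ Fin 2) ℝ)) = semidirectSet S (matSet H) := hG
  rw [hG', conjSet_semidirectSet, hKH, hK1, hSs, s.group_entry]

end Classification

end SympClass

/-- Classification of the class `𝓔₂` up to conjugation by `GL(2, ℝ) ⊂ Sp(2, ℝ)`:
every group of the class is conjugate to an entry of the list; every entry of the list is a group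
of the class, of the stated dimension; different entries are not conjugate. -/
theorem theorem2p1 :
    (∀ G ∈ SympClass.E2, ∃ (e : SympClass.Entry) (g : GL (Fin 2) ℝ),
      SympClass.conjSet g (G : Set (GL (Fin 2 ⊕ Fin 2) ℝ)) = e.group) ∧
    (∀ e : SympClass.Entry, ∃ G ∈ SympClass.E2,
      (G : Set (GL (Fin 2 ⊕ Fin 2) ℝ)) = e.group ∧ SympClass.lieDim G = e.dim) ∧
    (∀ (e e' : SympClass.Entry) (g : GL (Fin 2) ℝ),
      SympClass.conjSet g e.group = e'.group → e = e') := by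
  refine ⟨fun G hG => ?_, fun e => ?_, fun e e' g h => ?_⟩
  · obtain ⟨s, g, h⟩ := SympClass.exists_shape_of_mem_E2 hG
    exact ⟨s.entry, g, h⟩
  · obtain ⟨s, rfl⟩ := SympClass.Shape.entry_surjective e
    exact s.exists_mem_E2
  · obtain ⟨s, rfl⟩ := SympClass.Shape.entry_surjective e
    obtain ⟨s', rfl⟩ := SympClass.Shape.entry_surjective e'
    rw [SympClass.Shape.eq_of_conjSet h]
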